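/- **Theorem 5.12 (Properties of coheir).** *Setting and conventions.* Let $K^0$ be an abstract elementary class (finitary vocabulary $\tau$) with amalgamation, and let $\kappa > \mathrm{LS}(K^0)$ be a cardinal. Galois types $\mathrm{gtp}(\bar b/A;N)$ are the classes of triples $(\bar b,A,N)$ ($N$ in the class, $A\subseteq |N|$, $\bar b$ a sequence from $N$) under the equivalence relation generated by: $(\bar b_1,A,N_1)$ and $(\bar b_2,A,N_2)$ are related if there are embeddings $f_\ell:N_\ell\to N$ of the class, fixing $A$ pointwise, with $f_1(\bar b_1)=f_2(\bar b_2)$. A model $M\in K^0$ is $\kappa$-saturated if for every $N\ge M$ in $K^0$ and every $A\subseteq|M|$ with $|A|<\kappa$, every Galois type over $A$ of length $<\kappa$ realized in $N$ is realized in $M$. Let $K$ be the class of $\kappa$-saturated models of $K^0$ of size at least $\kappa$, with the ordering of $K^0$. The $(<\kappa)$-Galois Morleyization $\widehat K$ of $K$ is obtained by adding, for each Galois type $p$ (computed in $K$) of length less than $\kappa$ over $\emptyset$, a relation symbol $R_p$ of arity $\ell(p)$; in the expansion $\widehat N$ of $N \in K$, $R_p(\bar a)$ holds if and only if $\mathrm{gtp}(\bar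 a/\emptyset;N)=p$. Let $\widehat\tau$ be the vocabulary of $\widehat K$. Syntactic types $\mathrm{tp}(\bar b/B;\widehat N)$ are quantifier-free $\mathbb L_{\kappa,\kappa}(\widehat\tau)$-types, where formulas have fewer than $\kappa$ free variables. A set $p$ of formulas over $\widehat N$ is a *coheir over $A\subseteq |N|$ in $\widehat N$* if for every $\phi(\bar x)\in p$ there is $\bar a\in{}^{<\kappa}A$ with $\widehat N\models\phi[\bar a]$. Write $A\perp_M^N B$ if $M\le N$ are in $K$, $A,B\subseteq|N|$, and $\mathrm{tp}(A/|M|\cup B;\widehat N)$ is a coheir over $|M|$ in $\widehat N$. For $M_0\le M\le N$ in $K$, the Galois type $\mathrm{gtp}(\bar b/M;N)$ *is a coheir over $M_0$* if $\mathrm{ran}(\bar b)\perp_{M_0}^N |M|$. $\widehat K$ has the *syntactic order property of length $\kappa$* if for some $M\in K$ and some cardinal $\alpha<\kappa$ there are $\alpha$-tuples $\langle\bar a_i:i<\kappa\rangle$ of $M$ and a quantifier-free $\mathbb L_{\kappa,\kappa}(\widehat\tau)$-formula $\phi(\bar x,\bar y)$ such that for all $i,j<\kappa$: $\widehat M\models\phi[\bar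 a_i,\bar a_j]$ iff $i<j$. For a cardinal $\alpha$, a class is *$\alpha$-stable in $\lambda$* if for every $N$ in it and every $A\subseteq|N|$ with $|A|\le\lambda$, at most $\lambda$ Galois types over $A$ of sequences of length $<\alpha^+$ are realized in $N$; *syntactically $\alpha$-stable* is the same for syntactic types. Here $\alpha^+$ is the successor cardinal of $\alpha$. Let $\kappa_r$ be the least regular cardinal $\ge\kappa$, and $\mu_\alpha:=(\alpha+2)^{<\kappa_r}$. All models in (1), (2) and (3)(a) are in $K$. 1. The following hold. (a) *Invariance*: if $f:N\cong N'$ and $A\perp_M^N B$, then $f[A]\perp_{f[M]}^{N'}f[B]$. (b) *Monotonicity*: if $A\perp_M^N B$, $M\le M'\le N_0\le N$, $A_0\subseteq A$, $B_0\subseteq B$, $|M'|\subseteq B$ and $A_0\cup B_0\subseteq|N_0|$, then $A_0\perp_{M'}^{N_0}B_0$. (c) *Normality*: if $A\perp_M^N B$, then $A\cup|M|\perp_M^N B\cup|M|$. (d) *Disjointness*: if $A\perp_M^N B$, then $A\cap B\subseteq|M|$. (e) *Left and right existence*: if $M\le N$ and $A,B\subseteq|N|$, then $A\perp_M^N|M|$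 and $|M|\perp_M^N B$. (f) *Left and right $(<\kappa)$-set-witness*: $A\perp_M^N B$ if and only if $A_0\perp_M^N B_0$ for all $A_0\subseteq A$ and $B_0\subseteq B$ of size less than $\kappa$. (g) *Strong left transitivity*: if $M_0\le M_1$, $|M_1|\perp_{M_0}^N B$ and $A\perp_{M_1}^N B$, then $A\perp_{M_0}^N B$. 2. If $\widehat K$ does not have the syntactic order property of length $\kappa$, then: (a) *Symmetry*: $A\perp_M^N B$ if and only if $B\perp_M^N A$. (b) *Strong right transitivity*: if $M_0\le M_1$, $A\perp_{M_0}^N|M_1|$ and $A\perp_{M_1}^N B$, then $A\perp_{M_0}^N B$. (c) *Set local character*: for every cardinal $\alpha$, every $M\in K$ and every Galois type $p$ (in $K$) of length $\alpha$ over $M$, there is $M_0\le M$ in $K$ with $\|M_0\|\le\mu_\alpha$ such that $p$ is a coheir over $M_0$. (d) *Syntactic uniqueness*: let $M_0\le M\le N_\ell$ for $\ell=1,2$ and $|M_0|\subseteq B\subseteq|M|$. If $q_\ell$ is the syntactic type over $B$ of a sequence of $N_\ell$ (of the same length for $\ell=1,2$), $q_\ell$ is a coheir over $M_0$ in $\widehat{N_\ell}$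 for $\ell=1,2$, and $q_1\restriction M_0=q_2\restriction M_0$, then $q_1=q_2$. (e) *Syntactic stability*: for every cardinal $\alpha$, $\widehat K$ is syntactically $\alpha$-stable in every $\lambda\ge\mathrm{LS}(K^0)$ with $\lambda^{\mu_\alpha}=\lambda$. 3. Let $\alpha$ be an ordinal. If $\widehat K$ does not have the syntactic order property of length $\kappa$, and $K^0$ is $(<\kappa)$-tame and $(<\kappa)$-short for types over models of length less than $\alpha$ (that is, any two distinct Galois types of the same length $<\alpha$ over a model $M \in K^0$ have distinct restrictions to some $A_0\subseteq|M|$ of size less than $\kappa$, and also distinct restrictions to some set of fewer than $\kappa$ of their indices), then: (a) *Uniqueness*: if $p,q$ are Galois types (in $K$) of the same length $<\alpha$ over $M\in K$ that are coheirs over $M_0\le M$ with $p\restriction M_0=q\restriction M_0$, then $p=q$. (b) *Stability*: for every cardinal $\beta<\alpha$, $K^0$ is $\beta$-stable in every $\lambda\ge\mathrm{LS}(K^0)$ with $\lambda^{\mu_\beta}=\lambda$. -/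

import Mathlib

open FirstOrder Cardinal

universe u

namespace CoheirAEC

variable {L : FirstOrder.Language.{u, u}}

/-! ### Abstract classes and abstract elementary classes

Vocabularies are small relative to the universe of the structures, so that `Type u` plays the role
of the universe of sets.  A model `M ≤ N` is a substructure of `N` for which `Strong` holds. -/

/-- The data `(K, ≤)` of a class of `L`-structures with an ordering: `Strong N S` says that the
substructure `S` of `N` satisfies `S ≤ N`.  The laws are in `IsAbstractClass` and `IsAEC`. -/
structure ModelClass (L : FirstOrder.Language.{u, u}) where
  Mem : (M : Type u) → [L.Structure M] → Prop
  Strong : (N : Type u) → [L.Structure N] → L.Substructure N → Prop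

namespace ModelClass

variable (K : ModelClass L)

/-- `S ≤ T` in the class, for two substructures `S`, `T` of a common structure. -/
def StrongLE {N : Type u} [L.Structure N] (S T : L.Substructure N) : Prop :=
  S ≤ T ∧ K.Strong T (S.comap T.subtype.toHom)

/-- `(K, ≤)` is an abstract class: `≤` is a partial order on `K` refining the substructure
relation, and everything is closed under isomorphism. -/
structure IsAbstractClass : Prop where
  mem_of_strong : ∀ (N : Type u) [L.Structure N] (S : L.Substructure N),
    K.Strong N S → K.Mem N ∧ K.Mem S
  refl : ∀ (N : Type u) [L.Structure N], K.Mem N → K.Strong N ⊤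
  trans : ∀ (N : Type u) [L.Structure N] (S T : L.Substructure N),
    K.StrongLE S T → K.Strong N T → K.Strong N S
  iso : ∀ (N N' : Type u) [L.Structure N] [L.Structure N'] (S : L.Substructure N) (e : N ≃[L] N'),
    K.Strong N S → K.Strong N' (S.map e.toHom)

/-- The infinite cardinals that witness the Löwenheim-Skolem-Tarski axiom. -/
def LSCardinals : Set Cardinal.{u} :=
  {lam | L.card + ℵ₀ ≤ lam ∧ ∀ (M : Type u) [L.Structure M], K.Mem M → ∀ A : Set M,
    ∃ S : L.Substructure M, K.Strong M S ∧ A ⊆ (S : Set M) ∧ #S ≤ #A + lam}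

/-- The Löwenheim-Skolem number. -/
noncomputable def LS : Cardinal.{u} := sInf K.LSCardinals

/-- `(K, ≤)` is an abstract elementary class.  The union of a directed system of structures is a
structure that contains all of them as substructures and is covered by them. -/
structure IsAEC : Prop extends K.IsAbstractClass where
  coherence : ∀ (N : Type u) [L.Structure N] (S T : L.Substructure N),
    K.Strong N S → K.Strong N T → S ≤ T → K.StrongLE S T
  union_mem : ∀ (N : Type u) [L.Structure N] (I : Type u) [PartialOrder I] [Nonempty I]
    [IsDirected I (· ≤ ·)] (S : I → L.Substructure N),
    (∀ i, K.Mem (S i)) → (∀ i j, i < j → K.StrongLE (S i) (S j)) → (∀ x : N, ∃ i, x ∈ S i) →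
      K.Mem N ∧ ∀ i, K.Strong N (S i)
  union_strong : ∀ (N : Type u) [L.Structure N] (I : Type u) [PartialOrder I] [Nonempty I]
    [IsDirected I (· ≤ ·)] (S : I → L.Substructure N),
    (∀ i, K.Strong N (S i)) → (∀ i j, i < j → K.StrongLE (S i) (S j)) → K.Strong N (⨆ i, S i)
  lowenheim_skolem : K.LSCardinals.Nonempty

/-- `f : M → N` is a `K`-embedding: `M, N ∈ K` and `f : M ≅ f[M] ≤ N`. -/
structure IsEmbedding {M N : Type u} [L.Structure M] [L.Structure N] (f : M ↪[L] N) : Prop where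
  mem_dom : K.Mem M
  mem_cod : K.Mem N
  strong_range : K.Strong N f.toHom.range

def Amalgamation : Prop :=
  ∀ (M₀ M₁ M₂ : Type u) [L.Structure M₀] [L.Structure M₁] [L.Structure M₂]
    (f₁ : M₀ ↪[L] M₁) (f₂ : M₀ ↪[L] M₂), K.IsEmbedding f₁ → K.IsEmbedding f₂ →
    ∃ (N : Type u) (_ : L.Structure N) (g₁ : M₁ ↪[L] N) (g₂ : M₂ ↪[L] N),
      K.IsEmbedding g₁ ∧ K.IsEmbedding g₂ ∧ ∀ x, g₁ (f₁ x) = g₂ (f₂ x)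

/-! ### Galois types -/

/-- A triple `(b, A, N)`: a sequence `b` from `N ∈ K` indexed by `ι`, and a set `A` included
in `N`. -/
structure Triple (ι A : Type u) where
  N : Type u
  [str : L.Structure N]
  mem : K.Mem N
  b : ι → N
  a : A ↪ N

attribute [instance] Triple.str

variable {K}

/-- Atomic equivalence of triples. -/
def Eat {ι A : Type u} (s t : K.Triple ι A) : Prop :=
  ∃ (N : Type u) (_ : L.Structure N) (f : s.N ↪[L] N) (g : t.N ↪[L] N),
    K.IsEmbedding f ∧ K.IsEmbedding g ∧ (∀ x, f (s.a x) = g (t.a x)) ∧ ∀ i, f (s.b i) = g (t.b i)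

variable (K)

/-- Galois types over the set `A` of sequences indexed by `ι`: classes of triples for the
equivalence relation generated by `Eat`. -/
def GType (ι A : Type u) : Type (u + 1) := Quot (Eat (K := K) (ι := ι) (A := A))

variable {K}

/-- `gtp (b / A; N)`. -/
def gtp {ι A N : Type u} [L.Structure N] (hN : K.Mem N) (b : ι → N) (a : A ↪ N) : K.GType ι A :=
  Quot.mk _ ⟨N, hN, b, a⟩

/-- The restriction of a Galois type to a subset of its domain. -/
def GType.restrictDom {ι A : Type u} (p : K.GType ι A) (A₀ : Set A) : K.GType ι A₀ :=
  Quot.map (fun t : K.Triple ι A =>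
      (⟨t.N, t.mem, t.b, (Function.Embedding.subtype _).trans t.a⟩ : K.Triple ι A₀))
    (fun _ _ ⟨N, i, f, g, hf, hg, ha, hb⟩ => ⟨N, i, f, g, hf, hg, fun x => ha x, hb⟩) p

/-- The restriction `p ^ I` of a Galois type to a set of indices. -/
def GType.restrictLen {ι A : Type u} (p : K.GType ι A) (I : Set ι) : K.GType I A :=
  Quot.map (fun t : K.Triple ι A => (⟨t.N, t.mem, fun i => t.b i, t.a⟩ : K.Triple I A))
    (fun _ _ ⟨N, i, f, g, hf, hg, ha, hb⟩ => ⟨N, i, f, g, hf, hg, ha, fun j => hb j⟩) p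

variable (K)

/-- The set `gS (A; N)` of Galois types over `A ⊆ N` of `ι`-sequences of `N`. -/
def gSIn (ι : Type u) {N : Type u} [L.Structure N] (hN : K.Mem N) (A : Set N) :
    Set (K.GType ι A) :=
  Set.range fun b : ι → N => gtp hN b (Function.Embedding.subtype (· ∈ A))

/-- The set `gS (M)` of all Galois types over the model `M` of `ι`-sequences. -/
def gS (ι M : Type u) [L.Structure M] : Set (K.GType ι M) :=
  {p | ∃ (N : Type u) (_ : L.Structure N) (f : M ↪[L] N) (hf : K.IsEmbedding f) (b : ι → N),
    p = gtp hf.mem_cod b f.toEmbedding}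

/-- `K` is `(<κ)`-tame for types over models of length less than `α`. -/
def TameFor (κ : Cardinal.{u}) (α : Ordinal.{u}) : Prop :=
  ∀ γ < α, ∀ (M : Type u) [L.Structure M], K.Mem M →
    ∀ p ∈ K.gS γ.ToType M, ∀ q ∈ K.gS γ.ToType M, p ≠ q →
      ∃ A₀ : Set M, #A₀ < κ ∧ p.restrictDom A₀ ≠ q.restrictDom A₀

/-- `K` is `(<κ)`-type short for types over models of length less than `α`. -/
def ShortFor (κ : Cardinal.{u}) (α : Ordinal.{u}) : Prop :=
  ∀ γ < α, ∀ (M : Type u) [L.Structure M], K.Mem M →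
    ∀ p ∈ K.gS γ.ToType M, ∀ q ∈ K.gS γ.ToType M, p ≠ q →
      ∃ I : Set γ.ToType, #I < κ ∧ p.restrictLen I ≠ q.restrictLen I

/-- `K` is (Galois) `α`-stable in `lam`: over any set of size at most `lam` in any `N ∈ K`, there
are at most `lam` types of length less than the successor cardinal of `α` realized in `N`. -/
def GaloisStable (α lam : Cardinal.{u}) : Prop :=
  ∀ (N : Type u) [L.Structure N] (hN : K.Mem N) (A : Set N), #A ≤ lam →
    #{p : Σ γ : Ordinal.{u}, K.GType γ.ToType A |
        p.1 < (Order.succ α).ord ∧ p.2 ∈ K.gSIn p.1.ToType hN A} ≤ Cardinal.lift.{u + 1} lam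

/-- `M` is `κ`-saturated: for every `N ≥ M` and every `A ⊆ M` of size less than `κ`, every type
over `A` of length less than `κ` realized in `N` is realized in `M`. -/
def Saturated (κ : Cardinal.{u}) (M : Type u) [L.Structure M] : Prop :=
  ∀ (N : Type u) [L.Structure N] (f : M ↪[L] N) (hf : K.IsEmbedding f) (A : Set M), #A < κ →
    ∀ γ : Ordinal.{u}, γ < κ.ord → ∀ b : γ.ToType → N, ∃ a : γ.ToType → M,
      gtp hf.mem_dom a (Function.Embedding.subtype (· ∈ A)) =
        gtp hf.mem_cod b ((Function.Embedding.subtype (· ∈ A)).trans f.toEmbedding)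

/-- The class of `κ`-saturated models of `K` of size at least `κ`, with the ordering of `K`. -/
def sat (κ : Cardinal.{u}) : ModelClass L where
  Mem M := K.Mem M ∧ κ ≤ #M ∧ K.Saturated κ M
  Strong N _ S := K.Strong N S ∧ (K.Mem N ∧ κ ≤ #N ∧ K.Saturated κ N) ∧
    (K.Mem S ∧ κ ≤ #S ∧ K.Saturated κ S)

/-! ### The Galois Morleyization and its quantifier-free infinitary formulas -/

/-- The relation symbols `R_p` added by the `(<κ)`-Galois Morleyization, one for each Galois type
`p` over the empty set of length `γ < κ`; the arity of `R_p` is `γ`. -/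
abbrev MorleySymbol (κ : Cardinal.{u}) : Type (u + 1) :=
  Σ γ : Set.Iio κ.ord, K.GType γ.1.ToType PEmpty

/-- Quantifier-free infinitary formulas in the vocabulary of the Galois Morleyization, closed under
negations and conjunctions of size less than `κ`, with variables in `V`.  See `QF` for the bound
on the number of variables. -/
inductive PreQF (κ : Cardinal.{u}) (V : Type u) : Type (u + 1)
  | eq (s t : L.Term V) : PreQF κ V
  | rel {n : ℕ} (R : L.Relations n) (ts : Fin n → L.Term V) : PreQF κ V
  | gal (p : K.MorleySymbol κ) (ts : p.1.1.ToType → L.Term V) : PreQF κ V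
  | neg (φ : PreQF κ V) : PreQF κ V
  | conj (I : Type u) (hI : #I < κ) (φ : I → PreQF κ V) : PreQF κ V

end ModelClass

/-- The variables that occur in a term. -/
def termVars {V : Type u} : L.Term V → Set V
  | .var v => {v}
  | .func _ ts => ⋃ i, termVars (ts i)

namespace ModelClass

variable {K : ModelClass L} {κ : Cardinal.{u}} {V : Type u}

/-- The variables that occur in a formula. -/
def PreQF.vars : K.PreQF κ V → Set V
  | .eq s t => termVars s ∪ termVars t
  | .rel _ ts => ⋃ i, termVars (ts i)
  | .gal _ ts => ⋃ i, termVars (ts i)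
  | .neg φ => φ.vars
  | .conj _ _ φ => ⋃ i, (φ i).vars

/-- Satisfaction in the Galois Morleyization of `N`: `R_p` holds of the sequences of type `p`. -/
def PreQF.Realize {N : Type u} [L.Structure N] : K.PreQF κ V → (V → N) → Prop
  | .eq s t, v => s.realize v = t.realize v
  | .rel R ts, v => FirstOrder.Language.Structure.RelMap R fun i => (ts i).realize v
  | .gal p ts, v => ∃ hN : K.Mem N,
      gtp hN (fun i => (ts i).realize v) (Function.Embedding.ofIsEmpty : PEmpty ↪ N) = p.2
  | .neg φ, v => ¬ φ.Realize v
  | .conj _ _ φ, v => ∀ i, (φ i).Realize v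

variable (K κ V)

/-- Quantifier-free `𝕃_{κ,κ}`-formulas of the Galois Morleyization: they have fewer than `κ`
variables. -/
abbrev QF : Type (u + 1) := {φ : K.PreQF κ V // #φ.vars < κ}

/-- Quantifier-free `𝕃_{κ,κ}`-formulas over `A`: the free variables are indexed by `ι`, and the
elements of `A` occur as parameters. -/
abbrev QFOver (ι A : Type u) : Type (u + 1) := K.QF κ (ι ⊕ A)

variable {V}

/-- The quantifier-free syntactic type of `b` over `A`, computed in the Galois Morleyization
of `N`. -/
def tp {ι A N : Type u} [L.Structure N] (b : ι → N) (a : A ↪ N) : Set (K.QFOver κ ι A) :=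
  {φ | φ.1.Realize (Sum.elim b a)}

/-- The quantifier-free syntactic types over `A` of `ι`-sequences of `N`. -/
def synS (ι : Type u) {A N : Type u} [L.Structure N] (a : A ↪ N) : Set (Set (K.QFOver κ ι A)) :=
  Set.range fun b : ι → N => K.tp κ b a

variable {K κ}

/-- The formulas of `q` that are over the subset `C` of the domain of `q`. -/
def restrictSyn {ι A : Type u} (q : Set (K.QFOver κ ι A)) (C : Set A) : Set (K.QFOver κ ι A) :=
  {φ | φ ∈ q ∧ ∀ c, Sum.inr c ∈ φ.1.vars → c ∈ C}

/-- The set `p` of formulas over `B ⊆ N` is a `(<κ)`-coheir over `A` in (the Galois Morleyization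
of) `N`: each formula of `p` holds in `N` of some assignment of elements of `A` to its free
variables. -/
def IsCoheir {ι B N : Type u} [L.Structure N] (j : B ↪ N) (p : Set (K.QFOver κ ι B))
    (A : Set N) : Prop :=
  ∀ φ ∈ p, ∃ a : ι → N, (∀ i, Sum.inl i ∈ φ.1.vars → a i ∈ A) ∧ φ.1.Realize (Sum.elim a j)

variable (K κ)

/-- The coheir independence relation: `M ≤ N` are in `K` and the quantifier-free type of `A` over
`M ∪ B` is a `(<κ)`-coheir over `M` in the Galois Morleyization of `N`. -/
def Indep (N : Type u) [L.Structure N] (M : L.Substructure N) (A B : Set N) : Prop :=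
  K.Strong N M ∧
    IsCoheir (Function.Embedding.subtype (· ∈ (M : Set N) ∪ B))
      (K.tp κ (Subtype.val : A → N) (Function.Embedding.subtype (· ∈ (M : Set N) ∪ B)))
      (M : Set N)

variable {K}

/-- The Galois type `p` over the model `M` is a `(<κ)`-coheir over `M₀ ≤ M`: it is of the form
`gtp (b / M; N)` for some `N ≥ M` in which `b` is independent of `M` over `M₀`. -/
def GType.IsCoheirOver {ι M : Type u} [L.Structure M] (p : K.GType ι M)
    (M₀ : L.Substructure M) : Prop :=
  ∃ (N : Type u) (_ : L.Structure N) (f : M ↪[L] N) (hf : K.IsEmbedding f) (b : ι → N),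
    p = gtp hf.mem_cod b f.toEmbedding ∧
      K.Indep κ N (M₀.map f.toHom) (Set.range b) (Set.range f)

variable (K)

/-- Some `M ∈ K` has, in its Galois Morleyization, the syntactic order property of length `μ`:
a sequence of length `μ` of `α`-tuples, `α < κ`, is ordered by a quantifier-free formula. -/
def SyntacticOrderProperty (μ : Cardinal.{u}) : Prop :=
  ∃ (M : Type u) (_ : L.Structure M), K.Mem M ∧ ∃ α : Cardinal.{u}, α < κ ∧
    ∃ (a : μ.ord.ToType → α.ord.ToType → M) (φ : K.QF κ (α.ord.ToType ⊕ α.ord.ToType)),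
      ∀ i j, φ.1.Realize (Sum.elim (a i) (a j)) ↔ i < j

/-- The Galois Morleyization of `K` is syntactically `α`-stable in `lam`. -/
def SyntacticallyStable (α lam : Cardinal.{u}) : Prop :=
  ∀ (N : Type u) [L.Structure N], K.Mem N → ∀ A : Set N, #A ≤ lam →
    #{p : Σ γ : Ordinal.{u}, Set (K.QFOver κ γ.ToType A) |
        p.1 < (Order.succ α).ord ∧
          p.2 ∈ K.synS κ p.1.ToType (Function.Embedding.subtype (· ∈ A))} ≤
      Cardinal.lift.{u + 1} lam

end ModelClass

/-- The least regular cardinal greater than or equal to `κ`. -/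
noncomputable def regCeil (κ : Cardinal.{u}) : Cardinal.{u} := sInf {c | κ ≤ c ∧ c.IsRegular}

/-- `μ_α = (α + 2)^{<κ_r}`, where `κ_r` is the least regular cardinal that is at least `κ`. -/
noncomputable def muCard (κ α : Cardinal.{u}) : Cardinal.{u} := (α + 2) ^< regCeil κ

end CoheirAEC

open CoheirAEC

namespace CoheirAEC
namespace ModelClass

open FirstOrder.Language

variable {L : FirstOrder.Language.{u, u}} {K : ModelClass L} {κ : Cardinal.{u}}

/-! ### Embeddings of an abstract class -/

section Embeddings

variable {M N P : Type u} [L.Structure M] [L.Structure N] [L.Structure P]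

/-! Formulas are traded for Galois types of short sequences over the empty set. Under amalgamation,
`SameType v w` (some common extension identifies `v` with `w`) is an equivalence relation and
amounts to equality of Galois types. Every model of size at least `κ` has a `κ`-saturated extension,
so types computed in `K₀` and in `K₀.sat κ` agree. A single symbol `R_p` isolates the type of a
sequence of length less than `κ`, and a quantifier-free formula sees only the type of its fewer than
`κ` variables. Hence being a coheir becomes `CoheirIn`: each small tuple of `A` has the same type
over a given small tuple of `B` as some tuple of `M` (`isCoheir_tp_iff`, `indep_sat_iff`). The
unconditional properties are then manipulations of tuples, except `A ⊥_M M`, which is the saturation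
of `M`.

The order property enters through one construction, `false_of_ordered`. For symmetry, let `a` be a
coheir over `M` and `b`, let `m` be in `M`, and suppose that the type of `b` over `a m` is not
realized in `M`. Choose alternately `a_i` in `M` that resembles `a` over `b`, `m` and the earlier
`b_j`, and `b_i` in `M` that resembles `b` over `m` and the `a_j` with `j ≤ i`. Then `a_i b_j m` has
the type of `a b m` exactly when `i ≤ j`. Uniqueness of coheirs is a similar alternation between two
coheirs, and uses symmetry for the second.

Local character is symmetry applied to a closing-off argument: since `μ_α ^ θ ≤ μ_α` for `θ < κ`,
there is `M₀ ≤ M` of size at most `μ_α` that realizes all small types of tuples of `M` over small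
subsets of `M₀ ∪ D`, where `D` is the given sequence. So `M` is a coheir over `M₀`, and by symmetry
so is `D`. Stability follows by counting: a sequence is determined over `M`, as far as small types
go, by a base `M₀` of size at most `μ_α` and its type over that base. Tameness and shortness upgrade
agreement of all small types to equality of Galois types. -/

theorem IsAbstractClass.mem_equiv (hK : K.IsAbstractClass) (e : M ≃[L] N) (hM : K.Mem M) :
    K.Mem N :=
  (hK.mem_of_strong _ _ (hK.iso M N ⊤ e (hK.refl M hM))).1

theorem IsAbstractClass.isEmbedding_equiv (hK : K.IsAbstractClass) (e : M ≃[L] N) (hM : K.Mem M) :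
    K.IsEmbedding e.toEmbedding := by
  refine ⟨hM, hK.mem_equiv e hM, ?_⟩
  have : e.toEmbedding.toHom.range = ⊤ := by
    rw [Hom.range_eq_top]; exact e.surjective
  rw [this]
  exact hK.refl N (hK.mem_equiv e hM)

theorem IsAbstractClass.isEmbedding_refl (hK : K.IsAbstractClass) (hM : K.Mem M) :
    K.IsEmbedding (Embedding.refl L M) :=
  hK.isEmbedding_equiv (FirstOrder.Language.Equiv.refl L M) hM

theorem IsAbstractClass.isEmbedding_of_strong_range (hK : K.IsAbstractClass) (f : M ↪[L] N)
    (h : K.Strong N f.toHom.range) : K.IsEmbedding f :=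
  ⟨hK.mem_equiv f.equivRange.symm (hK.mem_of_strong _ _ h).2, (hK.mem_of_strong _ _ h).1, h⟩

theorem IsAbstractClass.isEmbedding_subtype (hK : K.IsAbstractClass) {S : L.Substructure N}
    (h : K.Strong N S) : K.IsEmbedding S.subtype := by
  refine hK.isEmbedding_of_strong_range _ ?_
  rwa [Substructure.range_subtype]

theorem comap_range_eq_map_equivRange (f : M ↪[L] N) (S : L.Substructure M) :
    (S.map f.toHom).comap f.toHom.range.subtype.toHom = S.map f.equivRange.toHom := by
  ext ⟨x, hx⟩
  simp only [Substructure.mem_comap, Substructure.mem_map]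
  constructor
  · rintro ⟨y, hy, h⟩
    exact ⟨y, hy, Subtype.ext h⟩
  · rintro ⟨y, hy, h⟩
    exact ⟨y, hy, congrArg Subtype.val h⟩

theorem IsAbstractClass.isEmbedding_comp (hK : K.IsAbstractClass) {f : M ↪[L] N} {g : N ↪[L] P}
    (hg : K.IsEmbedding g) (hf : K.IsEmbedding f) : K.IsEmbedding (g.comp f) := by
  refine ⟨hf.mem_dom, hg.mem_cod, ?_⟩
  have h1 : (g.comp f).toHom.range = f.toHom.range.map g.toHom := by
    ext x; simp
  rw [h1]
  refine hK.trans P _ g.toHom.range ⟨?_, ?_⟩ hg.strong_range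
  · exact Hom.map_le_range
  · rw [comap_range_eq_map_equivRange]
    exact hK.iso _ _ _ _ hf.strong_range

theorem IsAbstractClass.strong_map (hK : K.IsAbstractClass) {f : M ↪[L] N} (hf : K.IsEmbedding f)
    {S : L.Substructure M} (hS : K.Strong M S) : K.Strong N (S.map f.toHom) := by
  have h := (hK.isEmbedding_comp hf (hK.isEmbedding_subtype hS)).strong_range
  have h1 : (f.comp S.subtype).toHom.range = S.map f.toHom := by
    ext x; simp
  rwa [h1] at h

/-- This is the coherence axiom, applied to the two ranges in `P` and carried back along the
isomorphism of `N` with the range of `g`. -/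
theorem IsAEC.isEmbedding_of_comp (hK : K.IsAEC) {f : M ↪[L] N} {g : N ↪[L] P}
    (hg : K.IsEmbedding g) (hgf : K.IsEmbedding (g.comp f)) : K.IsEmbedding f := by
  refine hK.isEmbedding_of_strong_range _ ?_
  have h1 : (g.comp f).toHom.range = f.toHom.range.map g.toHom := by
    ext x; simp
  have h2 := hgf.strong_range
  rw [h1] at h2
  have h3 := (hK.coherence P _ _ h2 hg.strong_range Hom.map_le_range).2
  rw [comap_range_eq_map_equivRange] at h3
  have h4 := hK.iso _ _ _ g.equivRange.symm h3
  convert h4 using 1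
  ext x
  simp only [Substructure.mem_map]
  constructor
  · intro hx
    exact ⟨_, ⟨x, hx, rfl⟩, g.equivRange.symm_apply_apply x⟩
  · rintro ⟨_, ⟨y, hy, rfl⟩, rfl⟩
    have := g.equivRange.symm_apply_apply y
    exact (congrArg (· ∈ f.toHom.range) this).mpr hy

theorem IsAEC.isEmbedding_inclusion (hK : K.IsAEC) {S T : L.Substructure N} (hS : K.Strong N S)
    (hT : K.Strong N T) (h : S ≤ T) : K.IsEmbedding (Substructure.inclusion h) :=
  hK.isEmbedding_of_comp (hK.isEmbedding_subtype hT)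
    (by simpa using hK.isEmbedding_subtype hS)

end Embeddings

theorem IsAEC.LS_mem (hK : K.IsAEC) : K.LS ∈ K.LSCardinals := csInf_mem hK.lowenheim_skolem

theorem IsAEC.exists_strong (hK : K.IsAEC) {M : Type u} [L.Structure M] (hM : K.Mem M)
    (A : Set M) : ∃ S : L.Substructure M, K.Strong M S ∧ A ⊆ (S : Set M) ∧ #S ≤ #A + K.LS :=
  hK.LS_mem.2 M hM A

theorem IsAEC.card_le_LS (hK : K.IsAEC) : L.card ≤ K.LS :=
  le_self_add.trans hK.LS_mem.1

theorem IsAEC.aleph0_le_LS (hK : K.IsAEC) : ℵ₀ ≤ K.LS :=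
  le_add_self.trans hK.LS_mem.1

/-! ### Sequences with the same type over the empty set -/

/-- The sequences `v` and `w` have the same Galois type over the empty set, witnessed by a common
extension. -/
def SameType (K : ModelClass L) {V N N' : Type u} [L.Structure N] [L.Structure N'] (v : V → N)
    (w : V → N') : Prop :=
  ∃ (P : Type u) (_ : L.Structure P) (f : N ↪[L] P) (g : N' ↪[L] P),
    K.IsEmbedding f ∧ K.IsEmbedding g ∧ ∀ i, f (v i) = g (w i)

section SameType

variable {V W N N' N'' : Type u} [L.Structure N] [L.Structure N'] [L.Structure N'']

theorem SameType.mem_right {v : V → N} {w : V → N'} (h : K.SameType v w) : K.Mem N' :=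
  let ⟨_, _, _, _, _, hg, _⟩ := h; hg.mem_dom

theorem SameType.symm {v : V → N} {w : V → N'} (h : K.SameType v w) : K.SameType w v :=
  let ⟨P, s, f, g, hf, hg, h⟩ := h; ⟨P, s, g, f, hg, hf, fun i => (h i).symm⟩

theorem SameType.reindex {v : V → N} {w : V → N'} (h : K.SameType v w) (e : W → V) :
    K.SameType (v ∘ e) (w ∘ e) :=
  let ⟨P, s, f, g, hf, hg, h⟩ := h; ⟨P, s, f, g, hf, hg, fun i => h (e i)⟩

theorem SameType.of_reindex {v : V → N} {w : V → N'} (e : W → V) (he : Function.Surjective e)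
    (h : K.SameType (v ∘ e) (w ∘ e)) : K.SameType v w :=
  let ⟨P, s, f, g, hf, hg, h⟩ := h
  ⟨P, s, f, g, hf, hg, fun i => by obtain ⟨j, rfl⟩ := he i; exact h j⟩

theorem SameType.eq_iff {v : V → N} {w : V → N'} (h : K.SameType v w) (i j : V) :
    v i = v j ↔ w i = w j := by
  obtain ⟨P, s, f, g, hf, hg, h⟩ := h
  rw [← f.injective.eq_iff, h, h, g.injective.eq_iff]

theorem IsAbstractClass.sameType_refl (hK : K.IsAbstractClass) (hN : K.Mem N) (v : V → N) :
    K.SameType v v :=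
  ⟨N, _, _, _, hK.isEmbedding_refl hN, hK.isEmbedding_refl hN, fun _ => rfl⟩

theorem IsAbstractClass.sameType_embedding (hK : K.IsAbstractClass) {f : N ↪[L] N'}
    (hf : K.IsEmbedding f) (v : V → N) : K.SameType v (f ∘ v) :=
  ⟨N', _, f, Embedding.refl L N', hf, hK.isEmbedding_refl hf.mem_cod, fun _ => rfl⟩

/-- The two common extensions are amalgamated over the middle model. -/
theorem SameType.trans (hK : K.IsAbstractClass) (hAP : K.Amalgamation) {v : V → N} {w : V → N'}
    {x : V → N''} (h₁ : K.SameType v w) (h₂ : K.SameType w x) : K.SameType v x := by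
  obtain ⟨P, s, f, g, hf, hg, h⟩ := h₁
  obtain ⟨Q, s', f', g', hf', hg', h'⟩ := h₂
  obtain ⟨R, t, k, l, hk, hl, hkl⟩ := hAP _ _ _ g f' hg hf'
  exact ⟨R, t, k.comp f, l.comp g', hK.isEmbedding_comp hk hf, hK.isEmbedding_comp hl hg',
    fun i => by
      simp only [Embedding.comp_apply]
      rw [h i, hkl, h' i]⟩

/-- Amalgamation makes `Eat` transitive, so the generated equivalence relation adds nothing to it.
Listing the domain `A` as part of the sequence turns a type over `A` into a type over the empty set.
-/
theorem gtp_eq_iff (hK : K.IsAbstractClass) (hAP : K.Amalgamation) {ι A : Type u} (hN : K.Mem N)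
    (hN' : K.Mem N') (b : ι → N) (a : A ↪ N) (b' : ι → N') (a' : A ↪ N') :
    gtp hN b a = gtp hN' b' a' ↔ K.SameType (Sum.elim b a) (Sum.elim b' a') := by
  have key : ∀ s t : K.Triple ι A, Eat s t ↔ K.SameType (Sum.elim s.b s.a) (Sum.elim t.b t.a) := by
    intro s t
    constructor
    · rintro ⟨P, i, f, g, hf, hg, ha, hb⟩
      exact ⟨P, i, f, g, hf, hg, fun x => by cases x <;> simp [ha, hb]⟩
    · rintro ⟨P, i, f, g, hf, hg, h⟩
      exact ⟨P, i, f, g, hf, hg, fun x => h (.inr x), fun x => h (.inl x)⟩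
  have heq : Equivalence (Eat (K := K) (ι := ι) (A := A)) := by
    refine ⟨fun s => ?_, fun {s t} h => ?_, fun {r s t} h h' => ?_⟩
    · rw [key]; exact hK.sameType_refl s.mem _
    · rw [key] at *; exact h.symm
    · rw [key] at *; exact h.trans hK hAP h'
  rw [← key ⟨N, hN, b, a⟩ ⟨N', hN', b', a'⟩]
  constructor
  · intro h
    exact heq.eqvGen_iff.mp (Quot.eqvGen_exact h)
  · intro h
    exact Quot.sound h

theorem gtp_empty_eq_iff (hK : K.IsAbstractClass) (hAP : K.Amalgamation) {ι : Type u}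
    (hN : K.Mem N) (hN' : K.Mem N') (b : ι → N) (b' : ι → N') :
    gtp hN b (Function.Embedding.ofIsEmpty : PEmpty.{u + 1} ↪ N) =
      gtp hN' b' (Function.Embedding.ofIsEmpty : PEmpty.{u + 1} ↪ N') ↔ K.SameType b b' := by
  rw [gtp_eq_iff hK hAP]
  constructor
  · intro h; exact h.reindex Sum.inl
  · rintro ⟨P, i, f, g, hf, hg, h⟩
    exact ⟨P, i, f, g, hf, hg, fun x => by
      rcases x with x | x
      · exact h x
      · exact x.elim⟩

end SameType

/-! ### Counting types -/

/-- Isomorphism invariants of a structure whose elements are labelled by elements of `X` and of a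
sequence of elements of the structure. -/
abbrev Code (L : FirstOrder.Language.{u, u}) (ι X : Type u) : Type u :=
  Set X × Set (Σ n, L.Functions n × (Fin n → X) × X) × Set (Σ n, L.Relations n × (Fin n → X)) ×
    (ι → X)

/-- The code of the structure `S` with labels `e` and the sequence `w`. -/
def codeOf {ι X S : Type u} [L.Structure S] (e : S → X) (w : ι → S) : Code L ι X :=
  (Set.range e, {p | ∃ x, p.2.2.1 = e ∘ x ∧ p.2.2.2 = e (Structure.funMap p.2.1 x)},
    {p | ∃ x, p.2.2 = e ∘ x ∧ Structure.RelMap p.2.1 x}, e ∘ w)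

/-- The code records the copy of the structure on a subset of `X`, so equal codes make `e'⁻¹ ∘ e` an
isomorphism. -/
theorem exists_equiv_of_codeOf_eq {ι X S S' : Type u} [L.Structure S] [L.Structure S']
    {e : S → X} {e' : S' → X} (he : Function.Injective e) (he' : Function.Injective e')
    {w : ι → S} {w' : ι → S'} (h : codeOf (L := L) e w = codeOf (L := L) e' w') :
    ∃ σ : S ≃[L] S', ∀ i, σ (w i) = w' i := by
  simp only [codeOf, Prod.mk.injEq] at h
  obtain ⟨h1, h2, h3, h4⟩ := h
  let τ : S ≃ S' := ((_root_.Equiv.ofInjective e he).trans (_root_.Equiv.setCongr h1)).trans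
    (_root_.Equiv.ofInjective e' he').symm
  have hτ : ∀ x, e' (τ x) = e x := by
    intro x
    have := (_root_.Equiv.ofInjective e' he').apply_symm_apply
      (_root_.Equiv.setCongr h1 (_root_.Equiv.ofInjective e he x))
    exact congrArg Subtype.val this
  have hτ' : ∀ {n : ℕ} (x : Fin n → S) (x' : Fin n → S'), e ∘ x = e' ∘ x' → x' = τ ∘ x := by
    intro n x x' h
    funext i
    apply he'
    have := congrFun h i
    simp only [Function.comp_apply] at this ⊢
    rw [hτ, this]
  refine ⟨⟨τ, ?_, ?_⟩, ?_⟩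
  · intro n f x
    have : (⟨n, f, e ∘ x, e (Structure.funMap f x)⟩ : Σ n, L.Functions n × (Fin n → X) × X) ∈
        {p : Σ n, L.Functions n × (Fin n → X) × X |
          ∃ x, p.2.2.1 = e ∘ x ∧ p.2.2.2 = e (Structure.funMap p.2.1 x)} := ⟨x, rfl, rfl⟩
    rw [h2] at this
    obtain ⟨x', hx, hy⟩ := this
    simp only at hx hy
    apply he'
    refine (hτ _).trans (hy.trans ?_)
    rw [hτ' x x' hx]
    rfl
  · intro n r x
    have h5 := Set.ext_iff.mp h3 ⟨n, r, e ∘ x⟩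
    simp only [Set.mem_ofPred_eq] at h5
    constructor
    · intro hr
      obtain ⟨y, hy, hr'⟩ := h5.mpr ⟨τ ∘ x, by funext i; simp [hτ], hr⟩
      have : x = y := by
        funext i
        exact he (congrFun hy i)
      rwa [this]
    · intro hr
      obtain ⟨y, hy, hr'⟩ := h5.mp ⟨x, rfl, hr⟩
      rw [hτ' x y hy] at hr'
      exact hr'
  · intro i
    apply he'
    rw [← Function.comp_apply (f := e') (g := w'), ← h4]
    exact hτ _

theorem card_code_le {ι X : Type u} {ν : Cardinal.{u}} (hν : ℵ₀ ≤ ν) (hX : #X = ν)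
    (hL : L.card ≤ ν) (hι : #ι ≤ ν) : #(Code L ι X) ≤ 2 ^ ν := by
  have hinf : Infinite X := by rw [Cardinal.infinite_iff, hX]; exact hν
  have hF : #(Σ n, L.Functions n) ≤ ν := by
    refine le_trans ?_ hL
    rw [Language.card, Language.Symbols, mk_sum, lift_id, lift_id]
    exact self_le_add_right _ _
  have hR : #(Σ n, L.Relations n) ≤ ν := by
    refine le_trans ?_ hL
    rw [Language.card, Language.Symbols, mk_sum, lift_id, lift_id]
    exact self_le_add_left _ _
  have hlist : #(List X) = ν := by rw [mk_list_eq_mk, hX]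
  have h1 : #(Σ n, L.Functions n × (Fin n → X) × X) ≤ ν := by
    have : #(Σ n, L.Functions n × (Fin n → X) × X) ≤ #((Σ n, L.Functions n) × List X × X) := by
      refine mk_le_of_injective (f := fun p => (⟨p.1, p.2.1⟩, List.ofFn p.2.2.1, p.2.2.2)) ?_
      rintro ⟨n, f, x, y⟩ ⟨m, g, x', y'⟩ h
      simp only [Prod.mk.injEq, Sigma.mk.injEq] at h
      obtain ⟨⟨rfl, h1⟩, h2, rfl⟩ := h
      rw [heq_eq_eq] at h1
      rw [List.ofFn_injective h2, h1]
    refine this.trans ?_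
    simp only [mk_prod, lift_id, hX, hlist]
    rw [mul_eq_self hν]
    exact (mul_le_mul_left hF ν).trans (mul_eq_self hν).le
  have h2 : #(Σ n, L.Relations n × (Fin n → X)) ≤ ν := by
    have : #(Σ n, L.Relations n × (Fin n → X)) ≤ #((Σ n, L.Relations n) × List X) := by
      refine mk_le_of_injective (f := fun p => (⟨p.1, p.2.1⟩, List.ofFn p.2.2)) ?_
      rintro ⟨n, f, x⟩ ⟨m, g, x'⟩ h
      simp only [Prod.mk.injEq, Sigma.mk.injEq] at h
      obtain ⟨⟨rfl, h1⟩, h2⟩ := h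
      rw [heq_eq_eq] at h1
      rw [List.ofFn_injective h2, h1]
    refine this.trans ?_
    simp only [mk_prod, lift_id, hlist]
    exact (mul_le_mul_left hR ν).trans (mul_eq_self hν).le
  have h3 : #(ι → X) ≤ 2 ^ ν := by
    rw [← power_def, hX, ← power_self_eq hν]
    exact power_le_power_left (aleph0_pos.trans_le hν).ne' hι
  have h2ν : ℵ₀ ≤ 2 ^ ν := hν.trans (cantor ν).le
  have hp : (2 : Cardinal) ≠ 0 := two_ne_zero
  simp only [mk_prod, lift_id, mk_set, hX]
  refine (mul_le_mul' le_rfl (mul_le_mul' (power_le_power_left hp h1)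
    (mul_le_mul' (power_le_power_left hp h2) h3))).trans ?_
  simp only [mul_eq_self h2ν, le_refl]

/-- At most `2 ^ ν` types of `ι`-sequences, for `ν ≥ LS(K)` and `ν ≥ #ι`. -/
theorem IsAEC.exists_code (hK : K.IsAEC) (hAP : K.Amalgamation) (ι : Type u) {ν : Cardinal.{u}}
    (hι : #ι ≤ ν) (hν : K.LS ≤ ν) :
    ∃ (C : Type u) (code : ∀ (N : Type u) [L.Structure N], (ι → N) → C), #C ≤ 2 ^ ν ∧
      ∀ (N N' : Type u) [L.Structure N] [L.Structure N'] (v : ι → N) (v' : ι → N'),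
        K.Mem N → K.Mem N' → code N v = code N' v' → K.SameType v v' := by
  classical
  have hν0 : ℵ₀ ≤ ν := hK.aleph0_le_LS.trans hν
  obtain ⟨X, hX⟩ : ∃ X : Type u, #X = ν := ⟨ν.out, mk_out ν⟩
  have hinf : Infinite X := by rw [Cardinal.infinite_iff, hX]; exact hν0
  -- The code depends on the chosen small submodel `S` and its labelling, so it is no invariant of
  -- the type. Only the implication from equal codes to equal types is needed, and any choice gives
  -- it.
  let IsCode (N : Type u) [L.Structure N] (v : ι → N) (c : Code L ι X) : Prop :=
    ∃ (S : L.Substructure N) (e : S → X) (w : ι → S), K.Strong N S ∧ Function.Injective e ∧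
      (∀ i, v i = w i) ∧ c = codeOf (L := L) e w
  have hex : ∀ (N : Type u) [L.Structure N] (v : ι → N), K.Mem N → ∃ c, IsCode N v c := by
    intro N _ v hN
    obtain ⟨S, hS, hA, hcard⟩ := hK.exists_strong hN (Set.range v)
    have hc : #S ≤ #X := by
      rw [hX]
      refine hcard.trans ((add_le_add (mk_range_le.trans hι) hν).trans ?_)
      rw [add_eq_self hν0]
    obtain ⟨e⟩ := (Cardinal.le_def _ _).mp hc
    exact ⟨_, S, e, fun i => ⟨v i, hA ⟨i, rfl⟩⟩, hS, e.injective, fun _ => rfl, rfl⟩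
  refine ⟨Code L ι X, fun N _ v => Classical.epsilon (IsCode N v),
    card_code_le hν0 hX (hK.card_le_LS.trans hν) hι, ?_⟩
  intro N N' _ _ v v' hN hN' hc
  obtain ⟨S, e, w, hS, he, hw, h⟩ := Classical.epsilon_spec (hex N v hN)
  obtain ⟨S', e', w', hS', he', hw', h'⟩ := Classical.epsilon_spec (hex N' v' hN')
  obtain ⟨σ, hσ⟩ := exists_equiv_of_codeOf_eq he he' (h.symm.trans (hc.trans h'))
  have hS0 := hK.isEmbedding_subtype hS
  -- Both models contain a copy of `S` holding the sequence; amalgamating over it identifies the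
  -- sequences.
  obtain ⟨P, i, f, g, hf, hg, hfg⟩ := hAP S N N' S.subtype (S'.subtype.comp σ.toEmbedding) hS0
    (hK.isEmbedding_comp (hK.isEmbedding_subtype hS') (hK.isEmbedding_equiv σ hS0.mem_dom))
  refine ⟨P, i, f, g, hf, hg, fun j => ?_⟩
  have := hfg (w j)
  rw [hw, hw', ← hσ]
  exact this

/-! ### Structures on subsets of a set -/

/-- A structure of the class whose universe is a subset of `Ω`. -/
structure Partial (K : ModelClass L) (Ω : Type u) where
  carrier : Set Ω
  [str : L.Structure carrier]
  mem : K.Mem carrier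

attribute [instance] Partial.str

variable {Ω : Type u}

/-- The inclusion of `p` in `q` is an embedding of the class. -/
def Partial.Ext (p q : K.Partial Ω) : Prop :=
  ∃ f : p.carrier ↪[L] q.carrier, K.IsEmbedding f ∧ ∀ x, (f x : Ω) = x

theorem IsAbstractClass.ext_refl (hK : K.IsAbstractClass) (p : K.Partial Ω) : p.Ext p :=
  ⟨_, hK.isEmbedding_refl p.mem, fun _ => rfl⟩

theorem Partial.Ext.trans (hK : K.IsAbstractClass) {p q r : K.Partial Ω} (h : p.Ext q)
    (h' : q.Ext r) : p.Ext r := by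
  obtain ⟨f, hf, h⟩ := h
  obtain ⟨g, hg, h'⟩ := h'
  exact ⟨g.comp f, hK.isEmbedding_comp hg hf, fun x => by
    rw [Embedding.comp_apply, h', h]⟩

theorem Partial.Ext.subset {p q : K.Partial Ω} (h : p.Ext q) : p.carrier ⊆ q.carrier := by
  obtain ⟨f, hf, h⟩ := h
  intro x hx
  have := h ⟨x, hx⟩
  simp only at this
  rw [← this]
  exact (f ⟨x, hx⟩).2

theorem IsAbstractClass.exists_partial (hK : K.IsAbstractClass) {N : Type u} [L.Structure N]
    (hN : K.Mem N) {φ : N → Ω} (hφ : Function.Injective φ) :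
    ∃ (q : K.Partial Ω) (σ : N ≃[L] q.carrier), q.carrier = Set.range φ ∧
      ∀ x, (σ x : Ω) = φ x := by
  let e : N ≃ Set.range φ := _root_.Equiv.ofInjective φ hφ
  let _ : L.Structure (Set.range φ) := e.inducedStructure
  let σ : N ≃[L] Set.range φ := e.inducedStructureEquiv
  exact ⟨⟨Set.range φ, hK.mem_equiv σ hN⟩, σ, rfl, fun x => rfl⟩

/-- The complement of the carrier of `p` still has the size of `Ω`, which leaves room for the new
elements of `N`. -/
theorem IsAbstractClass.exists_partial_ext (hK : K.IsAbstractClass) {p : K.Partial Ω} {N : Type u}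
    [L.Structure N] {f : p.carrier ↪[L] N} (hf : K.IsEmbedding f) {lam : Cardinal.{u}}
    (hlam : ℵ₀ ≤ lam) (hΩ : lam < #Ω) (hN : #N ≤ lam) :
    ∃ (q : K.Partial Ω) (σ : N ≃[L] q.carrier), ∀ x, (σ (f x) : Ω) = x := by
  classical
  have hinf : Infinite Ω := by rw [Cardinal.infinite_iff]; exact hlam.trans hΩ.le
  have hp : #p.carrier ≤ lam := (mk_le_of_injective f.injective).trans hN
  have hc : #(p.carrierᶜ : Set Ω) = #Ω := mk_compl_of_infinite _ (hp.trans_lt hΩ)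
  obtain ⟨g⟩ : Nonempty (N ↪ (p.carrierᶜ : Set Ω)) := by
    rw [← Cardinal.le_def, hc]; exact hN.trans hΩ.le
  let φ : N → Ω := fun y => if h : ∃ x, f x = y then (h.choose : Ω) else g y
  have hφf : ∀ x, φ (f x) = x := by
    intro x
    have h : ∃ x', f x' = f x := ⟨x, rfl⟩
    simp only [φ, dif_pos h]
    rw [f.injective h.choose_spec]
  have hφg : ∀ y, (¬ ∃ x, f x = y) → φ y = g y := fun y h => by simp only [φ, dif_neg h]
  have hφ : Function.Injective φ := by
    intro y z hyz
    by_cases hy : ∃ x, f x = y <;> by_cases hz : ∃ x, f x = z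
    · obtain ⟨x, rfl⟩ := hy
      obtain ⟨x', rfl⟩ := hz
      rw [hφf, hφf] at hyz
      rw [Subtype.ext hyz]
    · obtain ⟨x, rfl⟩ := hy
      rw [hφf, hφg z hz] at hyz
      exact absurd (hyz ▸ x.2) (g z).2
    · obtain ⟨x, rfl⟩ := hz
      rw [hφf, hφg y hy] at hyz
      exact absurd (hyz ▸ x.2) (g y).2
    · rw [hφg y hy, hφg z hz] at hyz
      exact g.injective (Subtype.ext hyz)
  obtain ⟨q, σ, -, hσ⟩ := hK.exists_partial hf.mem_cod hφ
  exact ⟨q, σ, fun x => by rw [hσ, hφf]⟩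

/-- The union axioms speak of submodels of a structure already at hand. The direct limit supplies
that structure; its points are determined by their labels in `Ω`, so it can be copied onto the union
of the carriers. -/
theorem IsAEC.exists_union (hK : K.IsAEC) {I : Type u} [LinearOrder I] [Nonempty I]
    (p : I → K.Partial Ω) (hp : ∀ i j, i ≤ j → (p i).Ext (p j)) :
    ∃ q : K.Partial Ω, q.carrier = ⋃ i, (p i).carrier ∧ ∀ i, (p i).Ext q := by
  choose f hf hfx using hp
  have hds : DirectedSystem (fun i => (p i).carrier) fun i j h => f i j h := by
    refine ⟨fun i x => Subtype.ext (hfx _ _ _ _), fun i j k hij hjk x => Subtype.ext ?_⟩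
    rw [hfx, hfx, hfx]
  let D := Language.DirectLimit (fun i => (p i).carrier) f
  let ι : ∀ i, (p i).carrier ↪[L] D := fun i => Language.DirectLimit.of L I _ f i
  have hι : ∀ i j (h : i ≤ j) x, ι j (f i j h x) = ι i x := fun i j h x => Language.DirectLimit.of_f
  have hsurj : ∀ d : D, ∃ i x, ι i x = d := fun d => Language.DirectLimit.exists_of d
  have hkey : ∀ i j (x : (p i).carrier) (y : (p j).carrier), ι i x = ι j y ↔ (x : Ω) = y := by
    intro i j x y
    rw [← hι i (max i j) (le_max_left _ _), ← hι j (max i j) (le_max_right _ _),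
      (ι _).injective.eq_iff, Subtype.ext_iff, hfx, hfx]
  choose a b hab using hsurj
  let φ : D → Ω := fun d => (b d : Ω)
  have hφ : ∀ i x, φ (ι i x) = x := fun i x => (hkey _ _ _ _).mp (hab _)
  have hφinj : Function.Injective φ := by
    intro d e hde
    rw [← hab d, ← hab e]
    exact (hkey _ _ _ _).mpr hde
  have hstrong : ∀ i j, i ≤ j → K.StrongLE (ι i).toHom.range (ι j).toHom.range := by
    intro i j hij
    have h1 : (ι i).toHom.range = (f i j hij).toHom.range.map (ι j).toHom := by
      ext x
      simp only [Hom.mem_range, Substructure.mem_map, Embedding.coe_toHom]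
      constructor
      · rintro ⟨y, rfl⟩
        exact ⟨_, ⟨y, rfl⟩, hι _ _ _ _⟩
      · rintro ⟨_, ⟨y, rfl⟩, rfl⟩
        exact ⟨y, (hι _ _ _ _).symm⟩
    rw [h1]
    refine ⟨Hom.map_le_range, ?_⟩
    rw [comap_range_eq_map_equivRange]
    exact hK.iso _ _ _ _ (hf i j hij).strong_range
  obtain ⟨hD, hDi⟩ := hK.union_mem D I (fun i => (ι i).toHom.range)
    (fun i => hK.mem_equiv (ι i).equivRange (p i).mem) (fun i j h => hstrong i j h.le)
    (fun d => ⟨a d, b d, hab d⟩)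
  obtain ⟨q, σ, hq, hσ⟩ := hK.exists_partial hD hφinj
  refine ⟨q, ?_, fun i => ⟨σ.toEmbedding.comp (ι i), hK.isEmbedding_comp
    (hK.isEmbedding_equiv σ hD) (hK.isEmbedding_of_strong_range _ (hDi i)), fun x => ?_⟩⟩
  · rw [hq]
    ext x
    simp only [Set.mem_range, Set.mem_iUnion]
    constructor
    · rintro ⟨d, rfl⟩
      exact ⟨a d, (b d).2⟩
    · rintro ⟨i, hx⟩
      exact ⟨ι i ⟨x, hx⟩, hφ _ _⟩
  · exact (hσ _).trans (hφ i x)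

/-! ### Towers -/

/-- Each `S i` is chosen above all earlier `F j (S j)`. The predicate `G` is the invariant (later a
size bound) under which upper bounds of chains exist. -/
theorem exists_tower {P J : Type u} [LinearOrder J] [WellFoundedLT J] [Nonempty P]
    {r : P → P → Prop} (htrans : ∀ p q s, r p q → r q s → r p s) {G : P → Prop} {F : J → P → P}
    (hF : ∀ j p, G p → r p (F j p) ∧ G (F j p))
    (hub : ∀ (i : J) (w : Set.Iio i → P), (∀ j k, j < k → r (w j) (w k)) → (∀ j, G (w j)) →
      ∃ q, G q ∧ ∀ j, r (w j) q) :
    ∃ S : J → P, (∀ j, G (S j)) ∧ ∀ j i, j < i → r (F j (S j)) (S i) := by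
  let S : J → P := wellFounded_lt.fix fun i S =>
    Classical.epsilon fun q => G q ∧ ∀ j (h : j < i), r (F j (S j h)) q
  have hS : ∀ i, S i = Classical.epsilon fun q => G q ∧ ∀ j, j < i → r (F j (S j)) q := by
    intro i
    exact wellFounded_lt.fix_eq _ i
  have main : ∀ i, G (S i) ∧ ∀ j, j < i → r (F j (S j)) (S i) := by
    intro i
    induction i using WellFoundedLT.induction with
    | ind i ih =>
      obtain ⟨q, hq, hq'⟩ := hub i (fun j => F j (S j))
        (fun j k hjk => htrans _ _ _ ((ih k k.2).2 j hjk) (hF k _ (ih k k.2).1).1)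
        (fun j => (hF j _ (ih j j.2).1).2)
      have := Classical.epsilon_spec (p := fun q => G q ∧ ∀ j, j < i → r (F j (S j)) q)
        ⟨q, hq, fun j hj => hq' ⟨j, hj⟩⟩
      rw [← hS i] at this
      exact this
  exact ⟨S, fun j => (main j).1, fun j i h => (main i).2 j h⟩

theorem IsAEC.exists_upper_bound (hK : K.IsAEC) (p₀ : K.Partial Ω) {lam : Cardinal.{u}}
    (hlam : ℵ₀ ≤ lam) (hp₀ : #p₀.carrier ≤ lam) {I : Type u} [LinearOrder I] (hI : #I ≤ lam)
    (w : I → K.Partial Ω) (hw : ∀ j k, j < k → (w j).Ext (w k))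
    (hG : ∀ j, p₀.Ext (w j) ∧ #(w j).carrier ≤ lam) :
    ∃ q : K.Partial Ω, (p₀.Ext q ∧ #q.carrier ≤ lam) ∧ (∀ j, (w j).Ext q) ∧
      (Nonempty I → q.carrier = ⋃ i, (w i).carrier) := by
  rcases isEmpty_or_nonempty I with hI0 | hI0
  · exact ⟨p₀, ⟨hK.ext_refl p₀, hp₀⟩, fun j => hI0.elim j, fun ⟨j⟩ => hI0.elim j⟩
  · obtain ⟨q, hq, hq'⟩ := hK.exists_union w fun i j hij => by
      rcases hij.eq_or_lt with rfl | h
      · exact hK.ext_refl _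
      · exact hw i j h
    refine ⟨q, ⟨(hG hI0.some).1.trans hK.toIsAbstractClass (hq' _), ?_⟩, hq', fun _ => hq⟩
    rw [hq]
    refine (mk_iUnion_le _).trans ?_
    refine (mul_le_mul' hI (ciSup_le' fun i => (hG i).2)).trans ?_
    rw [mul_eq_self hlam]

/-! ### Existence of saturated extensions -/

/-- The ordinal `j < κ` as a type. -/
abbrev Idx {κ : Cardinal.{u}} (j : κ.ord.ToType) : Type u := (Ordinal.ToType.toOrd j).1.ToType

theorem mk_idx_lt {κ : Cardinal.{u}} (j : κ.ord.ToType) : #(Idx j) < κ := by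
  rw [Cardinal.mk_toType]
  exact lt_ord.mp (Ordinal.ToType.toOrd j).2

theorem exists_idx_eq {κ : Cardinal.{u}} {γ : Ordinal.{u}} (h : γ < κ.ord) :
    ∃ j : κ.ord.ToType, Idx j = γ.ToType :=
  ⟨Ordinal.ToType.mk ⟨γ, h⟩, by simp [Idx]⟩

theorem exists_equiv_idx {κ : Cardinal.{u}} {V : Type u} (h : #V < κ) :
    ∃ j : κ.ord.ToType, Nonempty (Idx j ≃ V) := by
  obtain ⟨j, hj⟩ := exists_idx_eq (ord_lt_ord.mpr h)
  refine ⟨j, ?_⟩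
  rw [hj, ← Cardinal.eq, mk_ord_toType]

theorem mk_Iio_toType_lt {c : Cardinal.{u}} (i : c.ord.ToType) : #(Set.Iio i) < c :=
  (mk_Iio_lt i (by simp)).trans_eq (mk_ord_toType c)

theorem exists_mk_Iio_eq {c d : Cardinal.{u}} (h : d < c) :
    ∃ i : c.ord.ToType, #(Set.Iio i) = d := by
  obtain ⟨i, hi⟩ := Ordinal.typein_surj (α := c.ord.ToType) (· < ·) (o := d.ord)
    (by rw [Ordinal.type_toType]; exact ord_lt_ord.mpr h)
  refine ⟨i, ?_⟩
  rw [← Ordinal.card_type (α := Set.Iio i) (· < ·), Ordinal.type_Iio_lt, hi, card_ord]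

theorem exists_forall_lt_of_isRegular {c : Cardinal.{u}} (hc : c.IsRegular) {A : Type u}
    (hA : #A < c) (g : A → c.ord.ToType) : ∃ j, ∀ a, g a < j := by
  have h1 : ⨆ a, (Ordinal.ToType.toOrd (g a)).1 < c.ord :=
    Ordinal.iSup_lt_of_lt_cof (by rwa [hc.cof_ord]) fun a => (Ordinal.ToType.toOrd (g a)).2
  have h2 : Order.succ (⨆ a, (Ordinal.ToType.toOrd (g a)).1) < c.ord :=
    (isSuccLimit_ord hc.aleph0_le).succ_lt h1
  refine ⟨Ordinal.ToType.mk ⟨_, h2⟩, fun a => ?_⟩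
  rw [← OrderIso.symm_apply_lt]
  refine Subtype.mk_lt_mk.mpr ?_
  exact Order.lt_succ_of_le (Ordinal.le_iSup (fun a => (Ordinal.ToType.toOrd (g a)).1) a)

/-- One tower handles all types of small length over small subsequences of `p`. There are at most
`lam` tasks: small sequences of parameters number at most `lam ^ θ` with `θ < κ`, and types are
coded by a set of size `2 ^ ν` with `ν < κ`, which is where `LS < κ` matters. A task once solved
stays solved in extensions. -/
theorem IsAEC.exists_realizing (hK : K.IsAEC) (hAP : K.Amalgamation) {κ lam : Cardinal.{u}}
    (hκ : K.LS < κ) (hκlam : κ ≤ lam) (hpow : ∀ θ < κ, lam ^ θ ≤ lam) (hΩ : lam < #Ω)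
    (p : K.Partial Ω) (hp : #p.carrier ≤ lam) :
    ∃ q : K.Partial Ω, p.Ext q ∧ #q.carrier ≤ lam ∧
      ∀ (N : Type u) [L.Structure N] (f : p.carrier ↪[L] N), K.IsEmbedding f →
        ∀ (i j : κ.ord.ToType) (a : Idx j → p.carrier) (b : Idx i → N),
          ∃ (a' : Idx i → q.carrier) (x : Idx j → q.carrier), (∀ k, (x k : Ω) = a k) ∧
            K.SameType (Sum.elim a' x) (Sum.elim b (f ∘ a)) := by
  classical
  have hκ0 : ℵ₀ ≤ κ := hK.aleph0_le_LS.trans hκ.le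
  have hlam : ℵ₀ ≤ lam := hκ0.trans hκlam
  have hcode : ∀ i j : κ.ord.ToType, ∃ ν < κ, #(Idx i ⊕ Idx j) ≤ ν ∧ K.LS ≤ ν := by
    intro i j
    refine ⟨#(Idx i ⊕ Idx j) + K.LS, ?_, self_le_add_right _ _, self_le_add_left _ _⟩
    rw [mk_sum, lift_id, lift_id]
    exact add_lt_of_lt hκ0 (add_lt_of_lt hκ0 (mk_idx_lt i) (mk_idx_lt j)) hκ
  choose ν hν hν1 hν2 using hcode
  choose C code hC hcode using fun i j => hK.exists_code hAP (Idx i ⊕ Idx j) (hν1 i j) (hν2 i j)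
  -- A task consists of two lengths, a sequence of parameters from `p`, and the code of the type to
  -- be realized.
  let T : Type u := Σ t : κ.ord.ToType × κ.ord.ToType, (Idx t.2 → p.carrier) × C t.1 t.2
  have hT : #T ≤ lam := by
    have : #T ≤ Cardinal.sum fun _ : κ.ord.ToType × κ.ord.ToType => lam := by
      rw [mk_sigma]
      refine sum_le_sum _ _ fun t => ?_
      rw [mk_prod, lift_id, lift_id, ← power_def]
      refine (mul_le_mul' ((power_le_power_right hp).trans (hpow _ (mk_idx_lt _)))
        ((hC _ _).trans ((power_le_power_right ?_).trans (hpow _ (hν _ _))))).trans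
        (mul_eq_self hlam).le
      exact (natCast_lt_aleph0 (n := 2)).le.trans hlam
    refine this.trans ?_
    rw [sum_const, lift_id, lift_id, mk_prod, lift_id, mk_ord_toType, mul_eq_self hκ0]
    exact (mul_le_mul' hκlam le_rfl).trans (mul_eq_self hlam).le
  let Solved (t : T) (q : K.Partial Ω) : Prop :=
    ∀ (N : Type u) [L.Structure N] (f : p.carrier ↪[L] N), K.IsEmbedding f →
      ∀ (b : Idx t.1.1 → N), code t.1.1 t.1.2 N (Sum.elim b (f ∘ t.2.1)) = t.2.2 →
          ∃ (a' : Idx t.1.1 → q.carrier) (x : Idx t.1.2 → q.carrier),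
            (∀ k, (x k : Ω) = t.2.1 k) ∧ K.SameType (Sum.elim a' x) (Sum.elim b (f ∘ t.2.1))
  have hSolved : ∀ t q r, q.Ext r → Solved t q → Solved t r := by
    intro t q r hqr h N _ f hf b hb
    obtain ⟨a', x, hx, hax⟩ := h N f hf b hb
    obtain ⟨g, hg, hgx⟩ := hqr
    refine ⟨g ∘ a', g ∘ x, fun k => by rw [Function.comp_apply, hgx, hx], ?_⟩
    rw [← Sum.comp_elim]
    exact (hK.sameType_embedding hg _).symm.trans hK.toIsAbstractClass hAP hax
  let G : K.Partial Ω → Prop := fun q => p.Ext q ∧ #q.carrier ≤ lam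
  have hstep : ∀ (t : T) (q : K.Partial Ω), G q → ∃ r, q.Ext r ∧ G r ∧ Solved t r := by
    intro t q hq
    by_cases hex : ∃ (N : Type u) (_ : L.Structure N) (f : p.carrier ↪[L] N)
        (b : Idx t.1.1 → N), K.IsEmbedding f ∧
          code t.1.1 t.1.2 N (Sum.elim b (f ∘ t.2.1)) = t.2.2
    · obtain ⟨N, _, f, b, hf, hb⟩ := hex
      obtain ⟨g, hg, hgx⟩ := hq.1
      -- One witness for the code is amalgamated with `q` over `p` and cut down to size `lam`. It
      -- serves every other extension with this code, because equal codes give equal types.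
      obtain ⟨P, _, k, l, hk, hl, hkl⟩ := hAP _ _ _ g f hg hf
      obtain ⟨S, hS, hsub, hcard⟩ := hK.exists_strong hk.mem_cod
        (Set.range k ∪ Set.range (l ∘ b))
      have hcS : #S ≤ lam := by
        refine hcard.trans ?_
        refine (add_le_add ((mk_union_le _ _).trans (add_le_add (mk_range_le.trans hq.2)
          (mk_range_le.trans ((mk_idx_lt _).le.trans hκlam)))) (hκ.le.trans hκlam)).trans ?_
        rw [add_eq_self hlam, add_eq_self hlam]
      let k' : q.carrier ↪[L] S := k.codRestrict S fun c => hsub (.inl ⟨c, rfl⟩)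
      have hk' : K.IsEmbedding k' :=
        hK.isEmbedding_of_comp (hK.isEmbedding_subtype hS) (by simpa [k'] using hk)
      obtain ⟨r, σ, hσ⟩ := hK.exists_partial_ext hk' hlam hΩ hcS
      have hσS := hK.isEmbedding_equiv σ hk'.mem_cod
      have hqr : q.Ext r := ⟨σ.toEmbedding.comp k', hK.isEmbedding_comp hσS hk', hσ⟩
      refine ⟨r, hqr, ⟨hq.1.trans hK.toIsAbstractClass hqr, ?_⟩, ?_⟩
      · exact (mk_congr σ.toEquiv).symm.le.trans hcS
      · intro N' _ f' hf' b' hb'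
        have h1 : K.SameType (Sum.elim b (f ∘ t.2.1)) (Sum.elim b' (f' ∘ t.2.1)) :=
          hcode _ _ N N' _ _ hf.mem_cod hf'.mem_cod (hb.trans hb'.symm)
        let b'' : Idx t.1.1 → S := fun i => ⟨l (b i), hsub (.inr ⟨i, rfl⟩)⟩
        refine ⟨σ ∘ b'', σ ∘ k' ∘ g ∘ t.2.1, fun i => ?_, ?_⟩
        · exact (hσ _).trans (hgx _)
        · rw [← Sum.comp_elim]
          refine (hK.sameType_embedding hσS _).symm.trans hK.toIsAbstractClass hAP ?_
          refine (hK.sameType_embedding (hK.isEmbedding_subtype hS) _).trans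
            hK.toIsAbstractClass hAP ?_
          refine SameType.trans hK.toIsAbstractClass hAP ?_ h1
          have h2 : (S.subtype ∘ Sum.elim b'' (k' ∘ g ∘ t.2.1)) =
              l ∘ Sum.elim b (f ∘ t.2.1) := by
            funext i
            rcases i with i | i
            · rfl
            · exact hkl _
          rw [h2]
          exact (hK.sameType_embedding hl _).symm
    · refine ⟨q, hK.ext_refl q, hq, fun N _ f hf b hb => ?_⟩
      exact absurd ⟨N, _, f, b, hf, hb⟩ hex
  let F : T → K.Partial Ω → K.Partial Ω := fun t q =>
    if h : G q then (hstep t q h).choose else q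
  have hF : ∀ t q, G q → (q.Ext (F t q) ∧ G (F t q)) ∧ Solved t (F t q) := by
    intro t q h
    simp only [F, dif_pos h]
    exact ⟨⟨(hstep t q h).choose_spec.1, (hstep t q h).choose_spec.2.1⟩,
      (hstep t q h).choose_spec.2.2⟩
  obtain ⟨_, _⟩ := exists_wellFoundedLT T
  have : Nonempty (K.Partial Ω) := ⟨p⟩
  obtain ⟨S, hSG, hS⟩ := exists_tower (r := Partial.Ext) (G := G) (F := F)
    (fun _ _ _ h h' => h.trans hK.toIsAbstractClass h') (fun t q h => (hF t q h).1)
    (fun i w hw hG => by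
      obtain ⟨q, hq, hq', -⟩ := hK.exists_upper_bound p hlam hp ((mk_set_le _).trans hT) w hw hG
      exact ⟨q, hq, hq'⟩)
  obtain ⟨q, hq, hq', -⟩ := hK.exists_upper_bound p hlam hp hT (fun t => F t (S t))
    (fun j k h => (hS j k h).trans hK.toIsAbstractClass (hF k _ (hSG k)).1.1)
    (fun j => (hF j _ (hSG j)).1.2)
  refine ⟨q, hq.1, hq.2, fun N _ f hf i j a b => ?_⟩
  let t : T := ⟨(i, j), a, code i j N (Sum.elim b (f ∘ a))⟩
  exact hSolved t _ _ (hq' t) (hF t _ (hSG t)).2 N f hf b rfl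

/-- The tower has length `κ⁺`, which is regular even when `κ` is not: fewer than `κ` elements of the
union lie in one stage, and types over them are realized in the next. -/
theorem IsAEC.exists_saturated_partial (hK : K.IsAEC) (hAP : K.Amalgamation)
    {κ lam : Cardinal.{u}} (hκ : K.LS < κ) (hκlam : Order.succ κ ≤ lam)
    (hpow : ∀ θ < κ, lam ^ θ ≤ lam) (hΩ : lam < #Ω) (p : K.Partial Ω) (hp : #p.carrier ≤ lam) :
    ∃ q : K.Partial Ω, p.Ext q ∧ K.Saturated κ q.carrier := by
  classical
  have hκ0 : ℵ₀ ≤ κ := hK.aleph0_le_LS.trans hκ.le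
  have hκlam' : κ ≤ lam := (Order.le_succ κ).trans hκlam
  have hlam : ℵ₀ ≤ lam := hκ0.trans hκlam'
  let G : K.Partial Ω → Prop := fun q => p.Ext q ∧ #q.carrier ≤ lam
  choose! F hF1 hF2 hF3 using fun q hq => hK.exists_realizing hAP hκ hκlam' hpow hΩ (p := q) hq
  have hreg : (Order.succ κ).IsRegular := isRegular_succ hκ0
  let J := (Order.succ κ).ord.ToType
  have hJ : #J ≤ lam := by rw [mk_ord_toType]; exact hκlam
  have : Nonempty (K.Partial Ω) := ⟨p⟩
  have hJ0 : Nonempty J := by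
    rw [← mk_ne_zero_iff, mk_ord_toType]; exact hreg.pos.ne'
  obtain ⟨S, hSG, hS⟩ := exists_tower (J := J) (r := Partial.Ext) (G := G) (F := fun _ => F)
    (fun _ _ _ h h' => h.trans hK.toIsAbstractClass h')
    (fun t q h => ⟨hF1 q h.2, h.1.trans hK.toIsAbstractClass (hF1 q h.2), hF2 q h.2⟩)
    (fun i w hw hG => by
      obtain ⟨q, hq, hq', -⟩ := hK.exists_upper_bound p hlam hp ((mk_set_le _).trans hJ) w hw hG
      exact ⟨q, hq, hq'⟩)
  obtain ⟨q, hq, hq', hun⟩ := hK.exists_upper_bound p hlam hp hJ S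
    (fun j k h => (hF1 _ (hSG j).2).trans hK.toIsAbstractClass (hS j k h)) hSG
  refine ⟨q, hq.1, ?_⟩
  intro N _ f hf A hA γ hγ b
  have hcov : ∀ x : A, ∃ j, ((x : q.carrier) : Ω) ∈ (S j).carrier := by
    intro x
    exact Set.mem_iUnion.mp ((hun hJ0).subset x.1.2)
  choose g hg using hcov
  obtain ⟨j, hj⟩ := exists_forall_lt_of_isRegular hreg (hA.trans (Order.lt_succ κ)) g
  -- A stage strictly above `j`, so that it extends `F (S j)`, where the type is realized.
  obtain ⟨j', hj'⟩ := exists_forall_lt_of_isRegular hreg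
    (A := PUnit) ((mk_punit).trans_lt (one_lt_aleph0.trans_le hreg.aleph0_le)) fun _ => j
  have hA' : ∀ x : A, ((x : q.carrier) : Ω) ∈ (S j).carrier := fun x =>
    ((hF1 _ (hSG _).2).trans hK.toIsAbstractClass (hS _ _ (hj x))).subset (hg x)
  obtain ⟨e, he, hex⟩ := hq' j
  obtain ⟨e', he', hex'⟩ := (hS j j' (hj' ⟨⟩)).trans hK.toIsAbstractClass (hq' j')
  obtain ⟨i, hi⟩ := exists_idx_eq hγ
  obtain ⟨k, ⟨ε⟩⟩ := exists_equiv_idx hA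
  obtain ⟨a', x, hx, hax⟩ := hF3 (S j) (hSG j).2 N (f.comp e) (hK.isEmbedding_comp hf he) i k
    (fun l => ⟨_, hA' (ε l)⟩) (fun l => b (cast hi l))
  refine ⟨fun l => e' (a' (cast hi.symm l)), ?_⟩
  rw [gtp_eq_iff hK.toIsAbstractClass hAP]
  have h1 := (hK.sameType_embedding he' _).symm.trans hK.toIsAbstractClass hAP hax
  have h2 := h1.reindex (Sum.map (cast hi.symm) ε.symm)
  convert h2 using 1
  · funext l
    rcases l with l | l
    · rfl
    · refine Subtype.ext ?_
      refine Eq.trans ?_ (hex' _).symm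
      refine Eq.trans ?_ (hx _).symm
      simp
  · funext l
    rcases l with l | l
    · simp
    · simp only [Function.comp_apply, Sum.map_inr, Sum.elim_inr, Embedding.comp_apply,
        _root_.Equiv.apply_symm_apply, Function.Embedding.trans_apply]
      refine congrArg f (Subtype.ext (hex ⟨_, hA' l⟩).symm)

theorem IsAEC.exists_saturated_extension (hK : K.IsAEC) (hAP : K.Amalgamation)
    {κ : Cardinal.{u}} (hκ : K.LS < κ) {N : Type u} [L.Structure N] (hN : K.Mem N)
    (hcard : κ ≤ #N) :
    ∃ (N' : Type u) (_ : L.Structure N') (f : N ↪[L] N'), K.IsEmbedding f ∧ (K.sat κ).Mem N' := by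
  have hκ0 : ℵ₀ ≤ κ := hK.aleph0_le_LS.trans hκ.le
  have hN0 : ℵ₀ ≤ #N := hκ0.trans hcard
  -- This value absorbs powers with exponent below `κ` and exceeds `κ`.
  let lam : Cardinal.{u} := 2 ^ #N
  have hlam : ∀ θ < κ, lam ^ θ ≤ lam := by
    intro θ hθ
    rw [← power_mul]
    refine power_le_power_left two_ne_zero ?_
    exact (mul_le_mul' le_rfl (hθ.le.trans hcard)).trans (mul_eq_self hN0).le
  obtain ⟨Ω, hΩ⟩ : ∃ Ω : Type u, #Ω = 2 ^ lam := ⟨Quotient.out (2 ^ lam : Cardinal.{u}), mk_out _⟩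
  have hNlam : #N < lam := cantor _
  have hΩlam : lam < #Ω := hΩ ▸ cantor _
  obtain ⟨φ⟩ : Nonempty (N ↪ Ω) := (Cardinal.le_def _ _).mp (hNlam.trans hΩlam).le
  obtain ⟨p, σ, hp, -⟩ := hK.exists_partial hN φ.injective
  obtain ⟨q, ⟨f, hf, -⟩, hq⟩ := hK.exists_saturated_partial hAP hκ
    (Order.succ_le_of_lt (hcard.trans_lt hNlam)) hlam hΩlam p
    ((mk_congr σ.toEquiv).symm.le.trans hNlam.le)
  refine ⟨q.carrier, _, f.comp σ.toEmbedding, hK.isEmbedding_comp hf (hK.isEmbedding_equiv σ hN),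
    q.mem, ?_, hq⟩
  exact hcard.trans (mk_le_of_injective (f.comp σ.toEmbedding).injective)

/-! ### The class of saturated models -/

section Saturated

variable {M N N' : Type u} [L.Structure M] [L.Structure N] [L.Structure N']

theorem saturated_iff (hK : K.IsAbstractClass) (hAP : K.Amalgamation) :
    K.Saturated κ M ↔ ∀ (N : Type u) [L.Structure N] (f : M ↪[L] N), K.IsEmbedding f →
      ∀ (I J : Type u), #I < κ → #J < κ → ∀ (x : I → M) (b : J → N),
        ∃ a : J → M, K.SameType (Sum.elim a x) (Sum.elim b (f ∘ x)) := by
  constructor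
  · intro h N _ f hf I J hI hJ x b
    obtain ⟨ε⟩ : Nonempty ((#J).ord.ToType ≃ J) := by rw [← Cardinal.eq, mk_ord_toType]
    obtain ⟨a, ha⟩ := h N f hf (Set.range x) (mk_range_le.trans_lt hI) (#J).ord
      (ord_lt_ord.mpr hJ) (b ∘ ε)
    rw [gtp_eq_iff hK hAP] at ha
    refine ⟨a ∘ ε.symm, ?_⟩
    convert ha.reindex (Sum.map ε.symm (Set.rangeFactorization x)) using 1
    · funext i; rcases i with i | i <;> rfl
    · funext i
      rcases i with i | i
      · simp
      · rfl
  · intro h N _ f hf A hA γ hγ b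
    obtain ⟨a, ha⟩ := h N f hf A γ.ToType hA (by rw [Cardinal.mk_toType]; exact lt_ord.mp hγ)
      Subtype.val b
    exact ⟨a, (gtp_eq_iff hK hAP _ _ _ _ _ _).mpr ha⟩

theorem Saturated.equiv (hK : K.IsAbstractClass) (hAP : K.Amalgamation) (e : M ≃[L] N)
    (hM : K.Mem M) (h : K.Saturated κ M) : K.Saturated κ N := by
  rw [saturated_iff hK hAP] at *
  intro P _ f hf I J hI hJ x b
  have he := hK.isEmbedding_equiv e hM
  obtain ⟨a, ha⟩ := h P (f.comp e.toEmbedding) (hK.isEmbedding_comp hf he) I J hI hJ (e.symm ∘ x) b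
  refine ⟨e ∘ a, ?_⟩
  convert (hK.sameType_embedding he _).symm.trans hK hAP ha using 1
  · funext i
    rcases i with i | i
    · rfl
    · exact (e.apply_symm_apply _).symm
  · funext i
    rcases i with i | i
    · rfl
    · exact congrArg f (e.apply_symm_apply _).symm

theorem sat_mem_equiv (hK : K.IsAbstractClass) (hAP : K.Amalgamation) (e : M ≃[L] N)
    (h : (K.sat κ).Mem M) : (K.sat κ).Mem N :=
  ⟨hK.mem_equiv e h.1, h.2.1.trans (mk_congr e.toEquiv).le, h.2.2.equiv hK hAP e h.1⟩

theorem sat_isAbstractClass (hK : K.IsAbstractClass) (hAP : K.Amalgamation) :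
    (K.sat κ).IsAbstractClass where
  mem_of_strong N _ S h := h.2
  refl N _ h := ⟨hK.refl N h.1, h, sat_mem_equiv hK hAP Substructure.topEquiv.symm h⟩
  trans N _ S T h h' := by
    refine ⟨hK.trans N S T ⟨h.1, h.2.1⟩ h'.1, h'.2.1, ?_⟩
    have h1 : (S.comap T.subtype.toHom).map T.subtype.toHom = S := by
      ext x
      simp only [Substructure.mem_map, Substructure.mem_comap]
      constructor
      · rintro ⟨y, hy, rfl⟩; exact hy
      · intro hx; exact ⟨⟨x, h.1 hx⟩, hx, rfl⟩
    have h2 := sat_mem_equiv hK hAP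
      (T.subtype.substructureEquivMap (S.comap T.subtype.toHom)) h.2.2.2
    rwa [h1] at h2
  iso N N' _ _ S e h :=
    ⟨hK.iso N N' S e h.1, sat_mem_equiv hK hAP e h.2.1,
      sat_mem_equiv hK hAP (e.toEmbedding.substructureEquivMap S) h.2.2⟩

theorem isEmbedding_sat_iff (hK : K.IsAbstractClass) (hAP : K.Amalgamation) (f : M ↪[L] N) :
    (K.sat κ).IsEmbedding f ↔ K.IsEmbedding f ∧ (K.sat κ).Mem M ∧ (K.sat κ).Mem N := by
  constructor
  · intro h
    exact ⟨⟨h.mem_dom.1, h.mem_cod.1, h.strong_range.1⟩, h.mem_dom, h.mem_cod⟩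
  · rintro ⟨h, hM, hN⟩
    exact ⟨hM, hN, h.strong_range, hN, sat_mem_equiv hK hAP f.equivRange hM⟩

/-- A common extension in `K` contains a copy of `N`, so it has size at least `κ` and can be
enlarged to a saturated model. -/
theorem sameType_sat_iff (hK : K.IsAEC) (hAP : K.Amalgamation) (hκ : K.LS < κ) {V : Type u}
    (hN : (K.sat κ).Mem N) (hN' : (K.sat κ).Mem N') (v : V → N) (w : V → N') :
    (K.sat κ).SameType v w ↔ K.SameType v w := by
  constructor
  · rintro ⟨P, i, f, g, hf, hg, h⟩
    rw [isEmbedding_sat_iff hK.toIsAbstractClass hAP] at hf hg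
    exact ⟨P, i, f, g, hf.1, hg.1, h⟩
  · rintro ⟨P, i, f, g, hf, hg, h⟩
    obtain ⟨Q, j, k, hk, hQ⟩ := hK.exists_saturated_extension hAP hκ hf.mem_cod
      (hN.2.1.trans (mk_le_of_injective f.injective))
    refine ⟨Q, j, k.comp f, k.comp g, ?_, ?_, fun i => congrArg k (h i)⟩
    · exact (isEmbedding_sat_iff hK.toIsAbstractClass hAP _).mpr
        ⟨hK.isEmbedding_comp hk hf, hN, hQ⟩
    · exact (isEmbedding_sat_iff hK.toIsAbstractClass hAP _).mpr
        ⟨hK.isEmbedding_comp hk hg, hN', hQ⟩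

theorem sat_amalgamation (hK : K.IsAEC) (hAP : K.Amalgamation) (hκ : K.LS < κ) :
    (K.sat κ).Amalgamation := by
  intro M₀ M₁ M₂ _ _ _ f₁ f₂ h₁ h₂
  have h₁' := ((isEmbedding_sat_iff hK.toIsAbstractClass hAP _).mp h₁).1
  have h₂' := ((isEmbedding_sat_iff hK.toIsAbstractClass hAP _).mp h₂).1
  obtain ⟨P, i, f, g, hf, hg, h⟩ := hAP M₀ M₁ M₂ f₁ f₂ h₁' h₂'
  obtain ⟨Q, j, k, hk, hQ⟩ := hK.exists_saturated_extension hAP hκ hf.mem_cod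
    (h₁.mem_cod.2.1.trans (mk_le_of_injective f.injective))
  refine ⟨Q, j, k.comp f, k.comp g, ?_, ?_, fun i => congrArg k (h i)⟩
  · exact (isEmbedding_sat_iff hK.toIsAbstractClass hAP _).mpr
      ⟨hK.isEmbedding_comp hk hf, h₁.mem_cod, hQ⟩
  · exact (isEmbedding_sat_iff hK.toIsAbstractClass hAP _).mpr
      ⟨hK.isEmbedding_comp hk hg, h₂.mem_cod, hQ⟩

end Saturated

/-! ### Quantifier-free formulas and types -/

theorem realize_term_congr {V N : Type u} [L.Structure N] (t : L.Term V) {v w : V → N}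
    (h : ∀ x ∈ termVars t, v x = w x) : t.realize v = t.realize w := by
  induction t with
  | var x => exact h x rfl
  | func f ts ih =>
    simp only [Term.realize]
    congr 1
    funext i
    exact ih i fun x hx => h x (Set.mem_iUnion.mpr ⟨i, hx⟩)

theorem PreQF.realize_congr {V N : Type u} [L.Structure N] (φ : K.PreQF κ V) {v w : V → N}
    (h : ∀ x ∈ φ.vars, v x = w x) : φ.Realize v ↔ φ.Realize w := by
  induction φ with
  | eq s t =>
    simp only [PreQF.Realize]
    rw [realize_term_congr s fun x hx => h x (.inl hx),
      realize_term_congr t fun x hx => h x (.inr hx)]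
  | rel R ts =>
    simp only [PreQF.Realize]
    rw [funext fun i => realize_term_congr (ts i) fun x hx => h x (Set.mem_iUnion.mpr ⟨i, hx⟩)]
  | gal p ts =>
    simp only [PreQF.Realize]
    rw [funext fun i => realize_term_congr (ts i) fun x hx => h x (Set.mem_iUnion.mpr ⟨i, hx⟩)]
  | neg φ ih => exact not_congr (ih h)
  | conj I hI φ ih =>
    exact forall_congr' fun i => ih i fun x hx => h x (Set.mem_iUnion.mpr ⟨i, hx⟩)

theorem PreQF.realize_embedding (hK : K.IsAbstractClass) {V N P : Type u} [L.Structure N]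
    [L.Structure P] {f : N ↪[L] P} (hf : K.IsEmbedding f) (φ : K.PreQF κ V) (v : V → N) :
    φ.Realize (f ∘ v) ↔ φ.Realize v := by
  have ht : ∀ t : L.Term V, t.realize (f ∘ v) = f (t.realize v) := fun t =>
    HomClass.realize_term f
  induction φ with
  | eq s t => simp only [PreQF.Realize, ht, f.injective.eq_iff]
  | rel R ts =>
    simp only [PreQF.Realize, ht]
    exact f.map_rel R fun i => (ts i).realize v
  | gal p ts =>
    simp only [PreQF.Realize, ht]
    have : gtp hf.mem_cod (fun i => f ((ts i).realize v))
        (Function.Embedding.ofIsEmpty : PEmpty.{u + 1} ↪ P) =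
        gtp hf.mem_dom (fun i => (ts i).realize v)
          (Function.Embedding.ofIsEmpty : PEmpty.{u + 1} ↪ N) :=
      Quot.sound ⟨P, _, Embedding.refl L P, f, hK.isEmbedding_refl hf.mem_cod, hf,
        fun x => x.elim, fun i => rfl⟩
    constructor
    · rintro ⟨_, h⟩; exact ⟨hf.mem_dom, this ▸ h⟩
    · rintro ⟨_, h⟩; exact ⟨hf.mem_cod, this ▸ h⟩
  | neg φ ih => exact not_congr ih
  | conj I hI φ ih => exact forall_congr' fun i => ih i

theorem PreQF.realize_of_sameType (hK : K.IsAbstractClass) {V N N' : Type u} [L.Structure N]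
    [L.Structure N'] (φ : K.PreQF κ V) {v : V → N} {w : V → N'}
    (h : K.SameType (fun x : φ.vars => v x) fun x => w x) : φ.Realize v ↔ φ.Realize w := by
  obtain ⟨P, _, f, g, hf, hg, h⟩ := h
  rw [← φ.realize_embedding hK hf, ← φ.realize_embedding hK hg]
  exact φ.realize_congr fun x hx => h ⟨x, hx⟩

/-- The formula is the atomic `R_p` for the type `p` of `v` restricted to `S`. Together with
`realize_of_sameType` it makes small Galois types and quantifier-free formulas interchangeable. -/
theorem exists_type_formula (hK : K.IsAbstractClass) (hAP : K.Amalgamation) {V N : Type u}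
    [L.Structure N] (hN : K.Mem N) (v : V → N) {S : Set V} (hS : #S < κ) :
    ∃ φ : K.QF κ V, φ.1.vars = S ∧ ∀ (N' : Type u) [L.Structure N'] (w : V → N'),
      φ.1.Realize w ↔ K.SameType (fun x : S => v x) fun x => w x := by
  obtain ⟨ε⟩ : Nonempty ((#S).ord.ToType ≃ S) := by rw [← Cardinal.eq, mk_ord_toType]
  let φ : K.PreQF κ V := .gal ⟨⟨(#S).ord, ord_lt_ord.mpr hS⟩,
    gtp hN (fun i => v (ε i)) (Function.Embedding.ofIsEmpty : PEmpty.{u + 1} ↪ N)⟩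
    fun i => .var (ε i)
  have hvars : φ.vars = S := by
    ext x
    simp only [φ, PreQF.vars, termVars, Set.mem_iUnion, Set.mem_singleton_iff]
    constructor
    · rintro ⟨i, rfl⟩; exact (ε i).2
    · intro hx; exact ⟨ε.symm ⟨x, hx⟩, by simp⟩
  refine ⟨⟨φ, hvars ▸ hS⟩, hvars, fun N' _ w => ?_⟩
  constructor
  · rintro ⟨hN', h⟩
    have := ((gtp_empty_eq_iff hK hAP hN' hN _ _).mp h).symm
    exact this.of_reindex ε ε.surjective
  · intro h
    exact ⟨h.mem_right, (gtp_empty_eq_iff hK hAP h.mem_right hN _ _).mpr (h.reindex ε).symm⟩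

/-- Every small sequence of elements of `A` has the same type over any small sequence of elements
of `B` as some sequence of elements of `M`. -/
def CoheirIn (K : ModelClass L) (κ : Cardinal.{u}) {N : Type u} [L.Structure N] (M A B : Set N) :
    Prop :=
  ∀ (I J : Type u), #I < κ → #J < κ → ∀ (x : I → N) (y : J → N), (∀ i, x i ∈ A) → (∀ j, y j ∈ B) →
    ∃ x' : I → N, (∀ i, x' i ∈ M) ∧ K.SameType (Sum.elim x y) (Sum.elim x' y)

/-- In one direction, the coheir condition is applied to the formula isolating the type of the
chosen small tuples; in the other, a formula mentions fewer than `κ` variables and only their type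
counts. -/
theorem isCoheir_tp_iff (hK : K.IsAbstractClass) (hAP : K.Amalgamation) (hκ : ℵ₀ ≤ κ)
    {ι B N : Type u} [L.Structure N] (hN : K.Mem N) (j : B ↪ N) (b : ι → N) (M : Set N) :
    IsCoheir j (K.tp κ b j) M ↔ K.CoheirIn κ M (Set.range b) (Set.range j) := by
  classical
  constructor
  · intro h I J hI hJ x y hx hy
    choose x₁ hx₁ using hx
    choose y₁ hy₁ using hy
    obtain rfl : b ∘ x₁ = x := funext hx₁
    obtain rfl : j ∘ y₁ = y := funext hy₁
    have hS : #(Set.range (Sum.map x₁ y₁) : Set (ι ⊕ B)) < κ := by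
      refine mk_range_le.trans_lt ?_
      rw [mk_sum, lift_id, lift_id]
      exact add_lt_of_lt hκ hI hJ
    obtain ⟨φ, hφ, hφ'⟩ := exists_type_formula hK hAP hN (Sum.elim b j) hS
    obtain ⟨a, ha, ha'⟩ := h φ ((hφ' _ _).mpr (hK.sameType_refl hN _))
    refine ⟨a ∘ x₁, fun i => ha _ (hφ ▸ ⟨.inl i, rfl⟩), ?_⟩
    convert ((hφ' _ _).mp ha').reindex (Set.rangeFactorization (Sum.map x₁ y₁)) using 1
    · funext i; rcases i with i | i <;> rfl
    · funext i; rcases i with i | i <;> rfl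
  · intro h φ hφ
    have hI : #{i : ι | Sum.inl i ∈ φ.1.vars} < κ :=
      (mk_le_of_injective (f := fun i : {i : ι | Sum.inl i ∈ φ.1.vars} => (⟨Sum.inl i.1, i.2⟩ : φ.1.vars))
        fun i i' hi => Subtype.ext (Sum.inl_injective (congrArg Subtype.val hi))).trans_lt φ.2
    have hJ : #{c : B | Sum.inr c ∈ φ.1.vars} < κ :=
      (mk_le_of_injective (f := fun i : {c : B | Sum.inr c ∈ φ.1.vars} => (⟨Sum.inr i.1, i.2⟩ : φ.1.vars))
        fun i i' hi => Subtype.ext (Sum.inr_injective (congrArg Subtype.val hi))).trans_lt φ.2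
    obtain ⟨x', hx', hs⟩ := h _ _ hI hJ (fun i => b i) (fun c => j c) (fun i => ⟨_, rfl⟩)
      (fun i => ⟨_, rfl⟩)
    -- Off the variables of the formula the value is irrelevant; `b i` is a filler.
    refine ⟨fun i => if hi : Sum.inl i ∈ φ.1.vars then x' ⟨i, hi⟩ else b i, fun i hi => ?_, ?_⟩
    · simp only [dif_pos hi]; exact hx' _
    · refine (φ.1.realize_of_sameType hK ?_).mp hφ
      obtain ⟨P, _, f, g, hf, hg, hfg⟩ := hs
      refine ⟨P, _, f, g, hf, hg, ?_⟩
      rintro ⟨i | c, hi⟩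
      · simp only [Sum.elim_inl]
        rw [dif_pos hi]
        exact hfg (.inl ⟨i, hi⟩)
      · exact hfg (.inr ⟨c, hi⟩)

theorem coheirIn_sat_iff (hK : K.IsAEC) (hAP : K.Amalgamation) (hκ : K.LS < κ) {N : Type u}
    [L.Structure N] (hN : (K.sat κ).Mem N) (M A B : Set N) :
    (K.sat κ).CoheirIn κ M A B ↔ K.CoheirIn κ M A B := by
  simp only [CoheirIn, sameType_sat_iff hK hAP hκ hN hN]

theorem isCoheir_sat_tp_iff (hK : K.IsAEC) (hAP : K.Amalgamation) (hκ : K.LS < κ)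
    {ι B N : Type u} [L.Structure N] (hN : (K.sat κ).Mem N) (j : B ↪ N) (b : ι → N) (M : Set N) :
    IsCoheir j ((K.sat κ).tp κ b j) M ↔ K.CoheirIn κ M (Set.range b) (Set.range j) := by
  rw [isCoheir_tp_iff (sat_isAbstractClass hK.toIsAbstractClass hAP) (sat_amalgamation hK hAP hκ)
    (hK.aleph0_le_LS.trans hκ.le) hN, coheirIn_sat_iff hK hAP hκ hN]

theorem indep_sat_iff (hK : K.IsAEC) (hAP : K.Amalgamation) (hκ : K.LS < κ) {N : Type u}
    [L.Structure N] (M : L.Substructure N) (A B : Set N) :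
    (K.sat κ).Indep κ N M A B ↔
      (K.sat κ).Strong N M ∧ K.CoheirIn κ (M : Set N) A ((M : Set N) ∪ B) := by
  refine and_congr_right fun h => ?_
  rw [isCoheir_sat_tp_iff hK hAP hκ h.2.1]
  have h1 : Set.range (Subtype.val : A → N) = A := Subtype.range_val
  have h2 : Set.range (Function.Embedding.subtype (· ∈ (M : Set N) ∪ B)) = (M : Set N) ∪ B :=
    Subtype.range_val
  rw [h1, h2]

/-! ### Sets closed under operations of small arity -/

/-- The closure is the set of values of well-founded trees whose nodes have fewer than `κ` children.
A small set of values is the set of children of a further node, so closure under `F` is immediate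
and no regularity of `κ` is needed. -/
theorem exists_closed_set {N : Type u} (F : Set N → Set N) {χ : Cardinal.{u}} (hκ : ℵ₀ ≤ κ)
    (hκχ : κ ≤ χ) (hpow : ∀ θ < κ, χ ^ θ ≤ χ) (hF : ∀ C : Set N, #C < κ → #(F C) ≤ χ)
    (X : Set N) (hX : #X ≤ χ) :
    ∃ G : Set N, X ⊆ G ∧ #G ≤ χ ∧ ∀ C ⊆ G, #C < κ → F C ⊆ G := by
  classical
  rcases isEmpty_or_nonempty N with hN | hN
  · exact ⟨∅, fun x => (hN.false x).elim, by simp, fun C _ _ x => (hN.false x).elim⟩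
  obtain ⟨U, hU⟩ : ∃ U : Type u, #U = χ := ⟨χ.out, mk_out χ⟩
  have henum : ∀ C : Set N, ∃ e : U → N, #C < κ → F C ⊆ Set.range e := by
    intro C
    by_cases hC : #C < κ
    · obtain ⟨g⟩ : Nonempty (F C ↪ U) := by rw [← Cardinal.le_def, hU]; exact hF C hC
      refine ⟨fun u => if h : ∃ x, g x = u then (h.choose : N) else hN.some, fun _ x hx => ?_⟩
      have h : ∃ x', g x' = g ⟨x, hx⟩ := ⟨_, rfl⟩
      refine ⟨g ⟨x, hx⟩, ?_⟩
      simp only [dif_pos h]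
      rw [g.injective h.choose_spec]
    · exact ⟨fun _ => hN.some, fun h => absurd h hC⟩
  choose e he using henum
  -- A leaf names an element of `X`; a node `(j, u)` names the element of index `u` in the
  -- enumeration of `F C`, where `C` is the set of values of its `j` children.
  let α : Type u := X ⊕ κ.ord.ToType × U
  let β : α → Type u := Sum.elim (fun _ => PEmpty) fun p => Idx p.1
  let ev : (Σ a : α, β a → N) → N
    | ⟨.inl x, _⟩ => x
    | ⟨.inr p, c⟩ => e (Set.range c) p.2
  have hχ : ℵ₀ ≤ χ := hκ.trans hκχ
  have hα : #α ≤ χ := by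
    simp only [α, mk_sum, mk_prod, lift_id, mk_ord_toType, hU]
    refine (add_le_add hX (mul_le_mul' hκχ le_rfl)).trans ?_
    rw [mul_eq_self hχ, add_eq_self hχ]
  have hW : #(WType β) ≤ χ := by
    refine WType.cardinalMk_le_of_le' ?_
    refine le_trans (b := Cardinal.sum fun _ : α => χ) (sum_le_sum _ _ ?_) ?_
    · rintro (x | p)
      · rw [lift_id]
        exact hpow _ ((mk_pempty).trans_lt (aleph0_pos.trans_le hκ))
      · rw [lift_id]
        exact hpow _ (mk_idx_lt p.1)
    · rw [sum_const, lift_id, lift_id]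
      exact (mul_le_mul' hα le_rfl).trans (mul_eq_self hχ).le
  refine ⟨Set.range (WType.elim N ev), fun x hx => ?_, mk_range_le.trans hW, fun C hC hCκ => ?_⟩
  · exact ⟨.mk (.inl ⟨x, hx⟩) fun i => PEmpty.elim i, rfl⟩
  · intro x hx
    obtain ⟨u, rfl⟩ := he C hCκ hx
    obtain ⟨j, ⟨ε⟩⟩ := exists_equiv_idx hCκ
    choose w hw using hC
    refine ⟨.mk (.inr (j, u)) fun i => w (ε i).2, ?_⟩
    have : Set.range (fun i : Idx j => WType.elim N ev (w (ε i).2)) = C := by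
      ext y
      simp only [hw]
      constructor
      · rintro ⟨i, rfl⟩; exact (ε i).2
      · intro hy; exact ⟨ε.symm ⟨y, hy⟩, by simp⟩
    show e (Set.range fun i : Idx j => WType.elim N ev (w (ε i).2)) u = _
    rw [this]

/-! ### Small submodels -/

theorem IsAEC.strong_of_directed (hK : K.IsAEC) {N : Type u} [L.Structure N]
    (𝒮 : Set (L.Substructure N)) (hne : 𝒮.Nonempty) (hS : ∀ S ∈ 𝒮, K.Strong N S)
    (hdir : ∀ S ∈ 𝒮, ∀ T ∈ 𝒮, ∃ U ∈ 𝒮, S ≤ U ∧ T ≤ U) :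
    ∃ M : L.Substructure N, K.Strong N M ∧ ∀ x, x ∈ M ↔ ∃ S ∈ 𝒮, x ∈ S := by
  have : Nonempty 𝒮 := hne.to_subtype
  have hd : Directed (· ≤ ·) fun S : 𝒮 => (S : L.Substructure N) := by
    intro S T
    obtain ⟨U, hU, h1, h2⟩ := hdir S S.2 T T.2
    exact ⟨⟨U, hU⟩, h1, h2⟩
  have : IsDirected 𝒮 (· ≤ ·) := ⟨hd⟩
  refine ⟨⨆ S : 𝒮, (S : L.Substructure N), hK.union_strong N 𝒮 _ (fun S => hS S S.2)
    fun S T h => hK.coherence N _ _ (hS S S.2) (hS T T.2) h.le, fun x => ?_⟩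
  rw [Substructure.mem_iSup_of_directed hd]
  simp

theorem coheirIn_self (hK : K.IsAEC) (hAP : K.Amalgamation) {N : Type u} [L.Structure N]
    {M : L.Substructure N} (hM : (K.sat κ).Strong N M) (A : Set N) :
    K.CoheirIn κ (M : Set N) A (M : Set N) := by
  intro I J hI hJ x y hx hy
  have h := (saturated_iff hK.toIsAbstractClass hAP).mp hM.2.2.2.2
  have hs := hK.isEmbedding_subtype hM.1
  obtain ⟨a, ha⟩ := h N M.subtype hs J I hJ hI (fun j => ⟨y j, hy j⟩) x
  refine ⟨fun i => a i, fun i => (a i).2, ?_⟩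
  have h1 := ((hK.sameType_embedding hs _).symm.trans hK.toIsAbstractClass hAP ha).symm
  convert h1 using 1
  · funext i; rcases i with i | i <;> rfl
  · funext i; rcases i with i | i <;> rfl

/-- A type over a small part of `M₀` is first realized in the saturated model `M`, after
amalgamating over `M₀`; the coheir hypothesis then moves the realization into `M₀`. -/
theorem saturated_of_coheirIn (hK : K.IsAEC) (hAP : K.Amalgamation) {N : Type u} [L.Structure N]
    {M M₀ : L.Substructure N} (hM : (K.sat κ).Strong N M) (hM₀ : K.Strong N M₀) (hle : M₀ ≤ M)
    (h : K.CoheirIn κ (M₀ : Set N) (M : Set N) (M₀ : Set N)) : K.Saturated κ M₀ := by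
  have hA := hK.toIsAbstractClass
  rw [saturated_iff hA hAP]
  intro P _ f hf I J hI hJ x b
  have hs := hK.isEmbedding_subtype hM.1
  have hs₀ := hK.isEmbedding_subtype hM₀
  have hinc := hK.isEmbedding_inclusion hM₀ hM.1 hle
  obtain ⟨Q, _, g, k, hg, hk, hgk⟩ := hAP _ _ _ f (Substructure.inclusion hle) hf hinc
  obtain ⟨a, ha⟩ := (saturated_iff hA hAP).mp hM.2.2.2.2 Q k hk I J hI hJ
    (Substructure.inclusion hle ∘ x) (g ∘ b)
  obtain ⟨a', ha', haa'⟩ := h J I hJ hI (fun j => a j) (fun i => x i) (fun j => (a j).2)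
    fun i => (x i).2
  refine ⟨fun j => ⟨a' j, ha' j⟩, ?_⟩
  refine (hA.sameType_embedding hs₀ _).trans hA hAP ?_
  have e1 : M₀.subtype ∘ Sum.elim (fun j => (⟨a' j, ha' j⟩ : M₀)) x =
      Sum.elim a' fun i => (x i : N) := by
    funext i; rcases i with i | i <;> rfl
  rw [e1]
  refine haa'.symm.trans hA hAP ?_
  have e2 : (Sum.elim (fun j => (a j : N)) fun i => (x i : N)) =
      M.subtype ∘ Sum.elim a (Substructure.inclusion hle ∘ x) := by
    funext i; rcases i with i | i <;> rfl
  rw [e2]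
  refine (hA.sameType_embedding hs _).symm.trans hA hAP (ha.trans hA hAP ?_)
  have e3 : Sum.elim (g ∘ b) (k ∘ Substructure.inclusion hle ∘ x) =
      g ∘ Sum.elim b (f ∘ x) := by
    funext i
    rcases i with i | i
    · rfl
    · exact (hgk _).symm
  rw [e3]
  exact (hA.sameType_embedding hg _).symm

/-- A Löwenheim-Skolem argument that also realizes types: it prepares local character, where `D` is
the sequence whose base is sought. -/
theorem exists_small_submodel (hK : K.IsAEC) (hAP : K.Amalgamation) (hκ : K.LS < κ) {N : Type u}
    [L.Structure N] {M : L.Substructure N} (hM : (K.sat κ).Strong N M) {χ : Cardinal.{u}}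
    (hκχ : κ ≤ χ) (hpow : ∀ θ < κ, χ ^ θ ≤ χ) (X : Set N) (hXM : X ⊆ (M : Set N)) (hX : #X ≤ χ)
    (D : Set N) (hD : #D ≤ χ) :
    ∃ M₀ : L.Substructure N, (K.sat κ).Strong N M₀ ∧ M₀ ≤ M ∧ X ⊆ (M₀ : Set N) ∧ #M₀ ≤ χ ∧
      K.CoheirIn κ (M₀ : Set N) (M : Set N) ((M₀ : Set N) ∪ D) := by
  classical
  have hκ0 : ℵ₀ ≤ κ := hK.aleph0_le_LS.trans hκ.le
  have hχ : ℵ₀ ≤ χ := hκ0.trans hκχ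
  have hskolem : ∀ C : Set N, ∃ S : L.Substructure N, K.Strong N S ∧ S ≤ M ∧
      C ∩ (M : Set N) ⊆ (S : Set N) ∧ #S ≤ #C + K.LS := by
    intro C
    obtain ⟨S, hS, hCS, hcard⟩ := hK.exists_strong hM.2.2.1 (Subtype.val ⁻¹' C : Set M)
    refine ⟨S.map M.subtype.toHom, hK.strong_map (hK.isEmbedding_subtype hM.1) hS, ?_, ?_, ?_⟩
    · rintro _ ⟨y, -, rfl⟩; exact y.2
    · rintro x ⟨hx, hxM⟩; exact ⟨⟨x, hxM⟩, hCS hx, rfl⟩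
    · refine mk_image_le.trans (hcard.trans (add_le_add ?_ le_rfl))
      exact mk_le_of_injective (f := fun y : (Subtype.val ⁻¹' C : Set M) => (⟨y.1, y.2⟩ : C))
        fun y y' h => Subtype.ext (Subtype.ext (congrArg (fun z : C => (z : N)) h))
  choose S hS hSM hCS hScard using hskolem
  have hcodes : ∀ (C : Set N) (i : κ.ord.ToType), ∃ (U : Type u) (code : (Idx i → M) → U),
      (#C < κ → #U ≤ χ) ∧ ∀ m m', code m = code m' →
        K.SameType (Sum.elim (fun k => (m k : N)) (Subtype.val : C → N))
          (Sum.elim (fun k => (m' k : N)) (Subtype.val : C → N)) := by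
    intro C i
    obtain ⟨U, code, hU, hcode⟩ := hK.exists_code hAP (Idx i ⊕ C) (ν := #(Idx i ⊕ C) + K.LS)
      (self_le_add_right _ _) (self_le_add_left _ _)
    refine ⟨U, fun m => code N (Sum.elim (fun k => (m k : N)) (Subtype.val : C → N)),
      fun hC => hU.trans ?_, fun m m' h => hcode _ _ _ _ hM.2.1.1 hM.2.1.1 h⟩
    refine (power_le_power_right ((natCast_lt_aleph0 (n := 2)).le.trans hχ)).trans (hpow _ ?_)
    rw [mk_sum, lift_id, lift_id]
    exact add_lt_of_lt hκ0 (add_lt_of_lt hκ0 (mk_idx_lt i) hC) hκ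
  choose U code hU hcode using hcodes
  have hinv : ∀ C i (u : U C i), ∃ m : Idx i → M, (∃ m', code C i m' = u) → code C i m = u := by
    intro C i u
    have hMne : Nonempty M := by
      rw [← mk_ne_zero_iff]
      exact (aleph0_pos.trans_le (hκ0.trans hM.2.2.2.1)).ne'
    by_cases h : ∃ m', code C i m' = u
    · exact ⟨h.choose, fun _ => h.choose_spec⟩
    · exact ⟨fun _ => hMne.some, fun h' => absurd h' h⟩
  choose m hm using hinv
  -- To `C` are added a small strong submodel of `M` containing `C ∩ M` and, for each code of a
  -- small tuple of `M` over `C`, one tuple of `M` with that code.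
  let F : Set N → Set N := fun C => (S C : Set N) ∪
    ⋃ p : (Σ i, U C i), Set.range fun k => (m C p.1 p.2 k : N)
  have hF : ∀ C : Set N, #C < κ → #(F C) ≤ χ := by
    intro C hC
    refine (mk_union_le _ _).trans ((add_le_add (b := χ) (d := χ) ?_ ?_).trans
      (add_eq_self hχ).le)
    · exact ((hScard C).trans (add_lt_of_lt hκ0 hC hκ).le).trans hκχ
    · refine (mk_iUnion_le _).trans ((mul_le_mul' (b := χ) (d := χ) ?_ (ciSup_le' fun p =>
        mk_range_le.trans ((mk_idx_lt _).le.trans hκχ))).trans (mul_eq_self hχ).le)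
      rw [mk_sigma]
      refine (sum_le_sum _ (fun _ => χ) fun i => hU C i hC).trans ?_
      rw [sum_const, lift_id, lift_id, mk_ord_toType]
      exact (mul_le_mul' hκχ le_rfl).trans (mul_eq_self hχ).le
  -- A subset of `M` of size `κ` is put into the closure so that `M₀` is large enough to belong to
  -- `K.sat κ`.
  obtain ⟨X₁, hX₁card⟩ := le_mk_iff_exists_set.mp hM.2.2.2.1
  have hX' : #(X ∪ Subtype.val '' X₁ ∪ D : Set N) ≤ χ := by
    refine (mk_union_le _ _).trans ((add_le_add ((mk_union_le _ _).trans (add_le_add hX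
      (mk_image_le.trans (hX₁card.le.trans hκχ)))) hD).trans ?_)
    rw [add_eq_self hχ, add_eq_self hχ]
  obtain ⟨G, hXG, hGcard, hG⟩ := exists_closed_set F hκ0 hκχ hpow hF _ hX'
  have hSG : ∀ C ⊆ G, #C < κ → (S C : Set N) ⊆ G := fun C hC hCκ =>
    Set.subset_union_left.trans (hG C hC hCκ)
  have hScard' : ∀ C : Set N, #C < κ → #(S C) < κ := fun C hC =>
    (hScard C).trans_lt (add_lt_of_lt hκ0 hC hκ)
  -- `M₀` is `G ∩ M` (the set `D` in `G` need not lie in `M`). It is a directed union of strong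
  -- submodels of size less than `κ`, since `LS < κ` keeps the hulls small.
  obtain ⟨M₀, hM₀, hM₀mem⟩ := hK.strong_of_directed
    {T | K.Strong N T ∧ T ≤ M ∧ (T : Set N) ⊆ G ∧ #T < κ}
    (by
      have h0 : #(∅ : Set N) < κ := by simpa using aleph0_pos.trans_le hκ0
      exact ⟨S ∅, hS _, hSM _, hSG _ (Set.empty_subset _) h0, hScard' _ h0⟩)
    (fun T hT => hT.1)
    (by
      rintro T ⟨hT, hTM, hTG, hTκ⟩ T' ⟨hT', hTM', hTG', hTκ'⟩
      have hC : #((T : Set N) ∪ T' : Set N) < κ :=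
        (mk_union_le _ _).trans_lt (add_lt_of_lt hκ0 hTκ hTκ')
      have hCG : (T : Set N) ∪ T' ⊆ G := Set.union_subset hTG hTG'
      exact ⟨_, ⟨hS _, hSM _, hSG _ hCG hC, hScard' _ hC⟩,
        fun x hx => hCS _ ⟨.inl hx, hTM hx⟩, fun x hx => hCS _ ⟨.inr hx, hTM' hx⟩⟩)
  have hmem : ∀ x, x ∈ M₀ ↔ x ∈ G ∧ x ∈ M := by
    intro x
    rw [hM₀mem]
    constructor
    · rintro ⟨T, ⟨-, hTM, hTG, -⟩, hx⟩; exact ⟨hTG hx, hTM hx⟩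
    · rintro ⟨hxG, hxM⟩
      have h1 : #({x} : Set N) < κ := by simpa using one_lt_aleph0.trans_le hκ0
      have hC : ({x} : Set N) ⊆ G := Set.singleton_subset_iff.mpr hxG
      exact ⟨S {x}, ⟨hS _, hSM _, hSG _ hC h1, hScard' _ h1⟩, hCS _ ⟨rfl, hxM⟩⟩
  have hle : M₀ ≤ M := fun x hx => ((hmem x).mp hx).2
  have hcoh : K.CoheirIn κ (M₀ : Set N) (M : Set N) ((M₀ : Set N) ∪ D) := by
    intro I J hI hJ x y hx hy
    obtain ⟨i, ⟨ε⟩⟩ := exists_equiv_idx hI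
    have hCκ : #(Set.range y) < κ := mk_range_le.trans_lt hJ
    have hCG : Set.range y ⊆ G := by
      rintro _ ⟨j, rfl⟩
      rcases hy j with h | h
      · exact ((hmem _).mp h).1
      · exact hXG (.inr h)
    let u := code (Set.range y) i fun k => ⟨x (ε k), hx _⟩
    have h1 := (hcode _ _ _ _ (hm (Set.range y) i u ⟨_, rfl⟩)).symm
    refine ⟨fun k => m (Set.range y) i u (ε.symm k), fun k => (hmem _).mpr ⟨?_, Subtype.prop _⟩, ?_⟩
    · refine hG _ hCG hCκ (.inr ?_)
      exact Set.mem_iUnion.mpr ⟨⟨i, u⟩, ⟨_, rfl⟩⟩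
    · convert h1.reindex (Sum.map ε.symm (Set.rangeFactorization y)) using 1
      · funext k
        rcases k with k | k
        · simp
        · rfl
      · funext k; rcases k with k | k <;> rfl
  have hsat := saturated_of_coheirIn hK hAP hM hM₀ hle fun I J hI hJ x y hx hy =>
    hcoh I J hI hJ x y hx fun j => .inl (hy j)
  refine ⟨M₀, ⟨hM₀, hM.2.1, (hK.mem_of_strong _ _ hM₀).2, ?_, hsat⟩, hle, ?_, ?_, hcoh⟩
  · rw [← hX₁card, ← mk_image_eq (s := X₁) Subtype.val_injective]
    refine mk_le_mk_of_subset (t := (M₀ : Set N)) ?_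
    rintro _ ⟨y, hy, rfl⟩
    exact (hmem _).mpr ⟨hXG (.inl (.inr ⟨y, hy, rfl⟩)), y.2⟩
  · intro y hy
    exact (hmem _).mpr ⟨hXG (.inl (.inl hy)), hXM hy⟩
  · exact (mk_le_mk_of_subset (s := (M₀ : Set N)) fun y hy => ((hmem y).mp hy).1).trans hGcard

/-! ### The order property -/

theorem exists_wellFounded_rec {P J : Type u} [LinearOrder J] [WellFoundedLT J] [Nonempty P]
    (R : ∀ i : J, (Set.Iio i → P) → P → Prop) (h : ∀ i w, ∃ p, R i w p) :
    ∃ S : J → P, ∀ i, R i (fun j => S j) (S i) := by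
  let S : J → P := wellFounded_lt.fix fun i S =>
    Classical.epsilon (R i fun j => S j j.2)
  have hS : ∀ i, S i = Classical.epsilon (R i fun j => S j) := fun i => wellFounded_lt.fix_eq _ i
  refine ⟨S, fun i => ?_⟩
  have := Classical.epsilon_spec (h i fun j => S j)
  rwa [← hS i] at this

/-- At stage `i`, `a i` is chosen against the earlier `b j`, then `b i` in favour of all `a j` with
`j ≤ i`. The invariants `PA` and `PB` keep the choice possible. -/
theorem exists_ordered_sequence {A B : Type u} {Φ : A → B → Prop} {PA : A → Prop} {PB : B → Prop}
    (hκ : ℵ₀ ≤ κ)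
    (h₁ : ∀ (J : Type u), #J < κ → ∀ b : J → B, (∀ j, PB (b j)) → ∃ a, PA a ∧ ∀ j, ¬ Φ a (b j))
    (h₂ : ∀ (J : Type u), #J < κ → ∀ a : J → A, (∀ j, PA (a j)) → ∃ b, PB b ∧ ∀ j, Φ (a j) b) :
    ∃ (a : κ.ord.ToType → A) (b : κ.ord.ToType → B), ∀ i j, Φ (a i) (b j) ↔ i ≤ j := by
  have h0 : #PEmpty.{u + 1} < κ := by simpa using aleph0_pos.trans_le hκ
  have : Nonempty ({a // PA a} × {b // PB b}) := by
    obtain ⟨a, ha, -⟩ := h₁ PEmpty h0 PEmpty.elim (fun j => j.elim)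
    obtain ⟨b, hb, -⟩ := h₂ PEmpty h0 PEmpty.elim (fun j => j.elim)
    exact ⟨⟨⟨a, ha⟩, ⟨b, hb⟩⟩⟩
  obtain ⟨S, hS⟩ := exists_wellFounded_rec (J := κ.ord.ToType) (P := {a // PA a} × {b // PB b})
    (fun i w p => (∀ j, ¬ Φ p.1.1 (w j).2.1) ∧ (∀ j, Φ (w j).1.1 p.2.1) ∧ Φ p.1.1 p.2.1) (by
      intro i w
      have hi : #(Set.Iio i) < κ := mk_Iio_toType_lt i
      obtain ⟨a, ha, ha'⟩ := h₁ _ hi (fun j => (w j).2.1) fun j => (w j).2.2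
      -- The extra point is the `a` just chosen; it puts the diagonal into the relation.
      have hi' : #(Option (Set.Iio i)) < κ := by
        rw [mk_option]; exact add_lt_of_lt hκ hi (one_lt_aleph0.trans_le hκ)
      obtain ⟨b, hb, hb'⟩ := h₂ _ hi' (fun j => j.elim a fun j => (w j).1.1) (by
        rintro (_ | j)
        · exact ha
        · exact (w j).1.2)
      exact ⟨⟨⟨a, ha⟩, ⟨b, hb⟩⟩, ha', fun j => hb' (some j), hb' none⟩)
  refine ⟨fun i => (S i).1.1, fun i => (S i).2.1, fun i j => ?_⟩
  constructor
  · intro h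
    by_contra hij
    exact (hS i).1 ⟨j, not_le.mp hij⟩ h
  · intro h
    rcases h.eq_or_lt with rfl | h
    · exact (hS i).2.2
    · exact (hS j).2.1 ⟨i, h⟩

/-- The ordered tuples are `c_i = (a_i, b_i, m)`. The formula denies that the `a`-part of the second
tuple with the `b`-part and `m`-part of the first has the type of `t`; so it holds of `(c_i, c_j)`
iff `¬ j ≤ i`. -/
theorem syntacticOrderProperty_of_ordered (hK : K.IsAbstractClass) (hAP : K.Amalgamation)
    (hκ : ℵ₀ ≤ κ) {M N : Type u} [L.Structure M] [L.Structure N] (hM : K.Mem M) (hN : K.Mem N)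
    {Ia Ib Im : Type u} (hIa : #Ia < κ) (hIb : #Ib < κ) (hIm : #Im < κ) (m : Im → M)
    (t : (Ia ⊕ Ib) ⊕ Im → N) (a : κ.ord.ToType → Ia → M) (b : κ.ord.ToType → Ib → M)
    (hab : ∀ i j, K.SameType (Sum.elim (Sum.elim (a i) (b j)) m) t ↔ i ≤ j) :
    K.SyntacticOrderProperty κ κ := by
  have hT : #((Ia ⊕ Ib) ⊕ Im) < κ := by
    simp only [mk_sum, lift_id]
    exact add_lt_of_lt hκ (add_lt_of_lt hκ hIa hIb) hIm
  refine ⟨M, _, hM, #((Ia ⊕ Ib) ⊕ Im), hT, ?_⟩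
  obtain ⟨ε⟩ : Nonempty ((#((Ia ⊕ Ib) ⊕ Im)).ord.ToType ≃ (Ia ⊕ Ib) ⊕ Im) := by
    rw [← Cardinal.eq, mk_ord_toType]
  let s : (Ia ⊕ Ib) ⊕ Im → (#((Ia ⊕ Ib) ⊕ Im)).ord.ToType ⊕ (#((Ia ⊕ Ib) ⊕ Im)).ord.ToType :=
    Sum.elim (Sum.elim (fun k => .inr (ε.symm (.inl (.inl k))))
      fun k => .inl (ε.symm (.inl (.inr k)))) fun k => .inl (ε.symm (.inr k))
  have hs : #(Set.range s) < κ := mk_range_le.trans_lt hT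
  obtain ⟨φ, hφ, hφ'⟩ := exists_type_formula hK hAP hN (Sum.elim (t ∘ ε) (t ∘ ε)) hs
  refine ⟨fun i => Sum.elim (Sum.elim (a i) (b i)) m ∘ ε, ⟨.neg φ.1, φ.2⟩, fun i j => ?_⟩
  rw [← not_le, ← hab]
  refine not_congr ((hφ' _ _).trans ?_)
  have h1 : (fun x : Set.range s => Sum.elim (t ∘ ε) (t ∘ ε) x) ∘ Set.rangeFactorization s = t := by
    funext k; rcases k with (k | k) | k <;> simp [s, Set.rangeFactorization]
  have h2 : (fun x : Set.range s => Sum.elim (Sum.elim (Sum.elim (a i) (b i)) m ∘ ε)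
      (Sum.elim (Sum.elim (a j) (b j)) m ∘ ε) (x : _ ⊕ _)) ∘ Set.rangeFactorization s =
      Sum.elim (Sum.elim (a j) (b i)) m := by
    funext k; rcases k with (k | k) | k <;> simp [s, Set.rangeFactorization]
  constructor
  · intro h
    have := h.reindex (Set.rangeFactorization s)
    rw [h1, h2] at this
    exact this.symm
  · intro h
    refine SameType.of_reindex (Set.rangeFactorization s) Set.rangeFactorization_surjective ?_
    rw [h1, h2]
    exact h.symm

theorem false_of_ordered (hK : K.IsAEC) (hAP : K.Amalgamation) (hκ : K.LS < κ)
    (hSOP : ¬ (K.sat κ).SyntacticOrderProperty κ κ) {M N : Type u} [L.Structure M]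
    [L.Structure N] (hM : (K.sat κ).Mem M) (hN : (K.sat κ).Mem N)
    {Ia Ib Im : Type u} (hIa : #Ia < κ) (hIb : #Ib < κ) (hIm : #Im < κ) (m : Im → M)
    (t : (Ia ⊕ Ib) ⊕ Im → N) (PA : (Ia → M) → Prop) (PB : (Ib → M) → Prop)
    (h₁ : ∀ (J : Type u), #J < κ → ∀ b : J → Ib → M, (∀ j, PB (b j)) →
      ∃ a, PA a ∧ ∀ j, ¬ K.SameType (Sum.elim (Sum.elim a (b j)) m) t)
    (h₂ : ∀ (J : Type u), #J < κ → ∀ a : J → Ia → M, (∀ j, PA (a j)) →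
      ∃ b, PB b ∧ ∀ j, K.SameType (Sum.elim (Sum.elim (a j) b) m) t) : False := by
  have hκ0 : ℵ₀ ≤ κ := hK.aleph0_le_LS.trans hκ.le
  obtain ⟨a, b, hab⟩ := exists_ordered_sequence
    (Φ := fun a b => K.SameType (Sum.elim (Sum.elim a b) m) t) hκ0 h₁ h₂
  refine hSOP (syntacticOrderProperty_of_ordered (sat_isAbstractClass hK.toIsAbstractClass hAP)
    (sat_amalgamation hK hAP hκ) hκ0 hM hN hIa hIb hIm m t a b fun i j => ?_)
  rw [sameType_sat_iff hK hAP hκ hM hN, hab]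

/-! ### Properties of coheirs -/

section Coheir

variable {N N' : Type u} [L.Structure N] [L.Structure N']

theorem CoheirIn.mono {M M' A A' B B' : Set N} (h : K.CoheirIn κ M A B) (hM : M ⊆ M')
    (hA : A' ⊆ A) (hB : B' ⊆ B) : K.CoheirIn κ M' A' B' := by
  intro I J hI hJ x y hx hy
  obtain ⟨x', hx', hs⟩ := h I J hI hJ x y (fun i => hA (hx i)) fun j => hB (hy j)
  exact ⟨x', fun i => hM (hx' i), hs⟩

theorem CoheirIn.of_embedding (hK : K.IsAbstractClass) (hAP : K.Amalgamation) {f : N ↪[L] N'}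
    (hf : K.IsEmbedding f) {M A B : Set N} (h : K.CoheirIn κ (f '' M) (f '' A) (f '' B)) :
    K.CoheirIn κ M A B := by
  intro I J hI hJ x y hx hy
  obtain ⟨x', hx', hs⟩ := h I J hI hJ (f ∘ x) (f ∘ y) (fun i => ⟨_, hx i, rfl⟩)
    fun j => ⟨_, hy j, rfl⟩
  choose z hz hzx using hx'
  obtain rfl : f ∘ z = x' := funext hzx
  refine ⟨z, hz, ?_⟩
  rw [← Sum.comp_elim, ← Sum.comp_elim] at hs
  exact (hK.sameType_embedding hf _).trans hK hAP
    (hs.trans hK hAP (hK.sameType_embedding hf _).symm)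

theorem CoheirIn.map (hK : K.IsAbstractClass) (hAP : K.Amalgamation) {f : N ↪[L] N'}
    (hf : K.IsEmbedding f) {M A B : Set N} (h : K.CoheirIn κ M A B) :
    K.CoheirIn κ (f '' M) (f '' A) (f '' B) := by
  intro I J hI hJ x y hx hy
  choose x₁ hx₁ hx₂ using hx
  choose y₁ hy₁ hy₂ using hy
  obtain rfl : f ∘ x₁ = x := funext hx₂
  obtain rfl : f ∘ y₁ = y := funext hy₂
  obtain ⟨x', hx', hs⟩ := h I J hI hJ x₁ y₁ hx₁ hy₁
  refine ⟨f ∘ x', fun i => ⟨_, hx' i, rfl⟩, ?_⟩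
  rw [← Sum.comp_elim, ← Sum.comp_elim]
  exact (hK.sameType_embedding hf _).symm.trans hK hAP
    (hs.trans hK hAP (hK.sameType_embedding hf _))

/-- Entries of the tuple already in `M` are moved to the parameters and kept unchanged; the coheir
hypothesis moves the rest. -/
theorem CoheirIn.union_left (hκ : ℵ₀ ≤ κ) {M A B : Set N}
    (h : K.CoheirIn κ M A (M ∪ B)) : K.CoheirIn κ M (A ∪ M) (M ∪ B) := by
  classical
  intro I J hI hJ x y hx hy
  let I₁ := {i : I // x i ∈ M}
  let I₂ := {i : I // x i ∉ M}
  have hI₁ : #I₁ < κ := (mk_subtype_le _).trans_lt hI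
  have hI₂ : #I₂ < κ := (mk_subtype_le _).trans_lt hI
  obtain ⟨x', hx', hs⟩ := h I₂ (J ⊕ I₁) hI₂
    (by rw [mk_sum, lift_id, lift_id]; exact add_lt_of_lt hκ hJ hI₁)
    (fun i => x i) (Sum.elim y fun i => x i) (fun i => (hx i).resolve_right i.2)
    (by rintro (j | i); exacts [hy j, .inl i.2])
  refine ⟨fun i => if hi : x i ∈ M then x i else x' ⟨i, hi⟩, fun i => ?_, ?_⟩
  · by_cases hi : x i ∈ M
    · simpa only [dif_pos hi] using hi
    · simpa only [dif_neg hi] using hx' _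
  · have := hs.reindex (Sum.elim (fun i : I => if hi : x i ∈ M then .inr (.inr ⟨i, hi⟩) else
      .inl ⟨i, hi⟩) fun j => .inr (.inl j))
    convert this using 1
    · funext i
      rcases i with i | j
      · by_cases hi : x i ∈ M <;> simp [hi]
      · rfl
    · funext i
      rcases i with i | j
      · by_cases hi : x i ∈ M <;> simp [hi]
      · rfl

/-- The type of the pair `(c, c)` records equality, so a copy of `c` in `M` over `c` is `c` itself.
-/
theorem CoheirIn.inter_subset (hκ : ℵ₀ ≤ κ) {M A B : Set N} (h : K.CoheirIn κ M A B) :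
    A ∩ B ⊆ M := by
  rintro c ⟨hA, hB⟩
  have h1 : #PUnit.{u + 1} < κ := by simpa using one_lt_aleph0.trans_le hκ
  obtain ⟨x', hx', hs⟩ := h PUnit PUnit h1 h1 (fun _ => c) (fun _ => c) (fun _ => hA) fun _ => hB
  have := (hs.eq_iff (.inl ⟨⟩) (.inr ⟨⟩)).mp rfl
  simp only [Sum.elim_inl, Sum.elim_inr] at this
  exact this ▸ hx' ⟨⟩

theorem coheirIn_subset (hK : K.IsAbstractClass) (hN : K.Mem N) (M B : Set N) :
    K.CoheirIn κ M M B :=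
  fun _ _ _ _ x _ hx _ => ⟨x, hx, hK.sameType_refl hN _⟩

theorem coheirIn_iff_forall_small {M A B : Set N} :
    K.CoheirIn κ M A (M ∪ B) ↔
      ∀ A₀ ⊆ A, ∀ B₀ ⊆ B, #A₀ < κ → #B₀ < κ → K.CoheirIn κ M A₀ (M ∪ B₀) := by
  constructor
  · intro h A₀ hA B₀ hB _ _
    exact h.mono subset_rfl hA (Set.union_subset_union_right _ hB)
  · intro h I J hI hJ x y hx hy
    refine h (Set.range x) (by rintro _ ⟨i, rfl⟩; exact hx i) (Set.range y ∩ B)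
      Set.inter_subset_right (mk_range_le.trans_lt hI)
      ((mk_le_mk_of_subset Set.inter_subset_left).trans_lt (mk_range_le.trans_lt hJ))
      I J hI hJ x y (fun i => ⟨i, rfl⟩) fun j => ?_
    rcases hy j with h | h
    · exact .inl h
    · exact .inr ⟨⟨j, rfl⟩, h⟩

theorem CoheirIn.trans_left (hK : K.IsAbstractClass) (hAP : K.Amalgamation)
    {M₀ M₁ A B : Set N} (h₀ : K.CoheirIn κ M₀ M₁ B) (h₁ : K.CoheirIn κ M₁ A B) :
    K.CoheirIn κ M₀ A B := by
  intro I J hI hJ x y hx hy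
  obtain ⟨x', hx', hs⟩ := h₁ I J hI hJ x y hx hy
  obtain ⟨x'', hx'', hs'⟩ := h₀ I J hI hJ x' y hx' hy
  exact ⟨x'', hx'', hs.trans hK hAP hs'⟩

/-- If symmetry failed at `x` in `B` and `y` in `M ∪ A`, tuples of `M` imitating `y` and `x` in turn
would be ordered by the type of the configuration. -/
theorem CoheirIn.symm (hK : K.IsAEC) (hAP : K.Amalgamation) (hκ : K.LS < κ)
    (hSOP : ¬ (K.sat κ).SyntacticOrderProperty κ κ) {M : L.Substructure N}
    (hM : (K.sat κ).Strong N M) {A B : Set N} (h : K.CoheirIn κ (M : Set N) A ((M : Set N) ∪ B)) :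
    K.CoheirIn κ (M : Set N) B ((M : Set N) ∪ A) := by
  classical
  have hA := hK.toIsAbstractClass
  have hκ0 : ℵ₀ ≤ κ := hK.aleph0_le_LS.trans hκ.le
  have hs := hK.isEmbedding_subtype hM.1
  intro I J hI hJ x y hx hy
  by_contra hcon
  push Not at hcon
  -- The part of `y` inside `M` is held fixed as `m`; the rest, `y₂`, lies in `A`.
  let J₁ := {j : J // y j ∈ (M : Set N)}
  let J₂ := {j : J // y j ∉ (M : Set N)}
  have hJ₁ : #J₁ < κ := (mk_subtype_le _).trans_lt hJ
  have hJ₂ : #J₂ < κ := (mk_subtype_le _).trans_lt hJ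
  let m : J₁ → M := fun j => ⟨y j, j.2⟩
  let y₂ : J₂ → N := fun j => y j
  let t : (J₂ ⊕ I) ⊕ J₁ → N := Sum.elim (Sum.elim y₂ x) (M.subtype ∘ m)
  have hΦ : ∀ (a : J₂ → M) (b : I → M),
      K.SameType (Sum.elim (Sum.elim a b) m) t ↔
        K.SameType (Sum.elim (Sum.elim (M.subtype ∘ a) (M.subtype ∘ b)) (M.subtype ∘ m)) t := by
    intro a b
    rw [← Sum.comp_elim, ← Sum.comp_elim]
    have := hA.sameType_embedding hs (Sum.elim (Sum.elim a b) m)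
    exact ⟨fun h => this.symm.trans hA hAP h, fun h => this.trans hA hAP h⟩
  refine false_of_ordered hK hAP hκ hSOP hM.2.2 hM.2.1 hJ₂ hI hJ₁ m t
    (fun a => K.SameType (Sum.elim (Sum.elim (M.subtype ∘ a) x) (M.subtype ∘ m)) t)
    (fun _ => True) ?_ ?_
  -- Here `a` copies `y₂` over `x`, `m` and the given `b j`. If some `a (b j) m` had the type of
  -- `t`, so would `y₂ (b j) m`, and `b j` would be the copy of `x` in `M` that was assumed not to
  -- exist.
  · intro J' hJ' b _
    have hcard : #(I ⊕ J₁ ⊕ J' × I) < κ := by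
      simp only [mk_sum, mk_prod, lift_id]
      exact add_lt_of_lt hκ0 hI (add_lt_of_lt hκ0 hJ₁ (mul_lt_of_lt hκ0 hJ' hI))
    obtain ⟨a, ha, hsa⟩ := h J₂ (I ⊕ J₁ ⊕ J' × I) hJ₂ hcard y₂
      (Sum.elim x (Sum.elim (M.subtype ∘ m) fun p => b p.1 p.2))
      (fun j => (hy j).resolve_left j.2) (by
        rintro (i | j | p)
        · exact .inr (hx i)
        · exact .inl (m j).2
        · exact .inl (b p.1 p.2).2)
    refine ⟨fun j => ⟨a j, ha j⟩, ?_, fun j hj => ?_⟩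
    · convert (hsa.reindex (Sum.elim (Sum.elim .inl fun i => .inr (.inl i))
        fun k => .inr (.inr (.inl k)))).symm using 1
      · funext k; rcases k with (k | k) | k <;> rfl
      · funext k; rcases k with (k | k) | k <;> rfl
    · rw [hΦ] at hj
      have h1 := hsa.reindex (Sum.elim (Sum.elim .inl fun i => .inr (.inr (.inr (j, i))))
        fun k : J₁ => .inr (.inr (.inl k)))
      have h2 : K.SameType (Sum.elim (Sum.elim y₂ (M.subtype ∘ b j)) (M.subtype ∘ m)) t := by
        refine SameType.trans hA hAP ?_ hj
        convert h1 using 1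
        · funext k; rcases k with (k | k) | k <;> rfl
        · funext k; rcases k with (k | k) | k <;> rfl
      refine hcon (M.subtype ∘ b j) (fun i => (b j i).2) ?_
      have h3 := h2.symm.reindex (Sum.elim (fun i : I => .inl (.inr i)) fun k : J =>
        if hk : y k ∈ (M : Set N) then .inr ⟨k, hk⟩ else .inl (.inl ⟨k, hk⟩))
      convert h3 using 1
      · funext k
        rcases k with k | k
        · rfl
        · by_cases hk : y k ∈ M <;> simp [hk, t, y₂, m]
      · funext k
        rcases k with k | k
        · rfl
        · by_cases hk : y k ∈ M <;> simp [hk, y₂, m]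
  -- By saturation of `M`, some `b` copies `x` over `m` and the given `a j`.
  · intro J' hJ' a ha
    have hcard : #(J₁ ⊕ J' × J₂) < κ := by
      simp only [mk_sum, mk_prod, lift_id]
      exact add_lt_of_lt hκ0 hJ₁ (mul_lt_of_lt hκ0 hJ' hJ₂)
    obtain ⟨b, hb, hsb⟩ := coheirIn_self hK hAP hM Set.univ I (J₁ ⊕ J' × J₂) hI hcard x
      (Sum.elim (M.subtype ∘ m) fun p => a p.1 p.2) (fun _ => trivial) (by
        rintro (j | p)
        · exact (m j).2
        · exact (a p.1 p.2).2)
    refine ⟨fun i => ⟨b i, hb i⟩, trivial, fun j => ?_⟩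
    rw [hΦ]
    refine SameType.trans hA hAP ?_ (ha j)
    convert (hsb.reindex (Sum.elim (Sum.elim (fun k : J₂ => .inr (.inr (j, k))) .inl)
      fun k => .inr (.inl k))).symm using 1
    · funext k; rcases k with (k | k) | k <;> rfl
    · funext k; rcases k with (k | k) | k <;> rfl

end Coheir

/-! ### Uniqueness of coheirs -/

/-- Let `τ` be the type of `b₁ c₁` and suppose that `b₂ c₂` does not have it. Tuples `a` of `M₀`
with `a c₁` of type `τ` and tuples `b` of `M₀` with `b₂ b` not of type `τ` are chosen alternately,
and the relation "`a b` has type `τ`" orders them. -/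
theorem coheirIn_unique (hK : K.IsAEC) (hAP : K.Amalgamation) (hκ : K.LS < κ)
    (hSOP : ¬ (K.sat κ).SyntacticOrderProperty κ κ) {M₀ N₁ N₂ : Type u} [L.Structure M₀]
    [L.Structure N₁] [L.Structure N₂] {g₁ : M₀ ↪[L] N₁} {g₂ : M₀ ↪[L] N₂}
    (hg₁ : (K.sat κ).IsEmbedding g₁) (hg₂ : (K.sat κ).IsEmbedding g₂) {ι B : Type u}
    {b₁ : ι → N₁} {b₂ : ι → N₂} {c₁ : B → N₁} {c₂ : B → N₂}
    (hc : K.SameType (Sum.elim g₁ c₁) (Sum.elim g₂ c₂))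
    (h₁ : K.CoheirIn κ (Set.range g₁) (Set.range b₁) (Set.range g₁ ∪ Set.range c₁))
    (h₂ : K.CoheirIn κ (Set.range g₂) (Set.range b₂) (Set.range g₂ ∪ Set.range c₂))
    (hb : ∀ (I J : Type u), #I < κ → #J < κ → ∀ (x : I → ι) (y : J → M₀),
      K.SameType (Sum.elim (b₁ ∘ x) (g₁ ∘ y)) (Sum.elim (b₂ ∘ x) (g₂ ∘ y)))
    {I J : Type u} (hI : #I < κ) (hJ : #J < κ) (x : I → ι) (y : J → B) :
    K.SameType (Sum.elim (b₁ ∘ x) (c₁ ∘ y)) (Sum.elim (b₂ ∘ x) (c₂ ∘ y)) := by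
  have hA := hK.toIsAbstractClass
  have hκ0 : ℵ₀ ≤ κ := hK.aleph0_le_LS.trans hκ.le
  have he₁ := ((isEmbedding_sat_iff hA hAP _).mp hg₁).1
  have he₂ := ((isEmbedding_sat_iff hA hAP _).mp hg₂).1
  have hsymm : K.CoheirIn κ (Set.range g₂) (Set.range c₂) (Set.range g₂ ∪ Set.range b₂) := by
    have h := CoheirIn.symm (M := g₂.toHom.range) (A := Set.range b₂) (B := Set.range c₂)
      hK hAP hκ hSOP hg₂.strong_range
    rw [Hom.range_coe] at h
    exact h h₂
  by_contra hcon
  have hp : #PEmpty.{u + 1} < κ := by simpa using aleph0_pos.trans_le hκ0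
  let τ : I ⊕ J → N₁ := Sum.elim (b₁ ∘ x) (c₁ ∘ y)
  have hΦ : ∀ (a : I → M₀) (b : J → M₀),
      K.SameType (Sum.elim (Sum.elim a b) PEmpty.elim) (Sum.elim τ PEmpty.elim) ↔
        K.SameType (Sum.elim a b) τ := by
    intro a b
    refine ⟨fun h => h.reindex Sum.inl, fun h => SameType.of_reindex Sum.inl ?_ h⟩
    rintro (k | k)
    · exact ⟨k, rfl⟩
    · exact k.elim
  refine false_of_ordered hK hAP hκ hSOP hg₁.mem_dom hg₁.mem_cod hI hJ hp PEmpty.elim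
    (Sum.elim τ PEmpty.elim) (fun a => K.SameType (Sum.elim (g₁ ∘ a) (c₁ ∘ y)) τ)
    (fun b => ¬ K.SameType (Sum.elim (b₂ ∘ x) (g₂ ∘ b)) τ) ?_ ?_
  -- The tuple `a` copies `b₁` over `c₁` and the given `b j`; `a (b j)` of type `τ` would give `b₁
  -- (b j)`, hence `b₂ (b j)`, that type.
  · intro J' hJ' b hPb
    have hcard : #(J ⊕ J' × J) < κ := by
      simp only [mk_sum, mk_prod, lift_id]
      exact add_lt_of_lt hκ0 hJ (mul_lt_of_lt hκ0 hJ' hJ)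
    obtain ⟨a, ha, hsa⟩ := h₁ I (J ⊕ J' × J) hI hcard (b₁ ∘ x)
      (Sum.elim (c₁ ∘ y) fun p => g₁ (b p.1 p.2)) (fun i => ⟨_, rfl⟩) (by
        rintro (j | p)
        · exact .inr ⟨_, rfl⟩
        · exact .inl ⟨_, rfl⟩)
    choose a' ha' using ha
    obtain rfl : g₁ ∘ a' = a := funext ha'
    refine ⟨a', ?_, fun j hj => hPb j ?_⟩
    · convert (hsa.reindex (Sum.map id Sum.inl)).symm using 1
      · funext k; rcases k with k | k <;> rfl
      · funext k; rcases k with k | k <;> rfl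
    · rw [hΦ] at hj
      refine SameType.trans hA hAP ?_ hj
      refine (hb I J hI hJ x (b j)).symm.trans hA hAP ?_
      have h3 := (hA.sameType_embedding he₁ (Sum.elim a' (b j))).symm
      refine SameType.trans hA hAP ?_ h3
      convert hsa.reindex (Sum.map id fun k => .inr (j, k)) using 1
      · funext k; rcases k with k | k <;> rfl
      · funext k; rcases k with k | k <;> rfl
  -- By symmetry on the second side, `b` copies `c₂` over `b₂` and the given `a j`. So `b₂ b`
  -- resembles `b₂ c₂`, while `(a j) b` resembles `(a j) c₂`, hence `(a j) c₁`.
  · intro J' hJ' a hPa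
    have hcard : #(I ⊕ J' × I) < κ := by
      simp only [mk_sum, mk_prod, lift_id]
      exact add_lt_of_lt hκ0 hI (mul_lt_of_lt hκ0 hJ' hI)
    obtain ⟨b, hb', hsb⟩ := hsymm J (I ⊕ J' × I) hJ hcard (c₂ ∘ y)
      (Sum.elim (b₂ ∘ x) fun p => g₂ (a p.1 p.2)) (fun i => ⟨_, rfl⟩) (by
        rintro (j | p)
        · exact .inr ⟨_, rfl⟩
        · exact .inl ⟨_, rfl⟩)
    choose b' hb'' using hb'
    obtain rfl : g₂ ∘ b' = b := funext hb''
    refine ⟨b', fun hj => hcon ?_, fun j => ?_⟩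
    · refine (SameType.symm ?_)
      refine SameType.trans hA hAP ?_ hj
      convert hsb.reindex (Sum.elim (fun k : I => .inr (.inl k)) .inl) using 1
      · funext k; rcases k with k | k <;> rfl
      · funext k; rcases k with k | k <;> rfl
    · rw [hΦ]
      refine SameType.trans hA hAP ?_ (hPa j)
      refine (hA.sameType_embedding he₂ (Sum.elim (a j) b')).trans hA hAP ?_
      have h3 := hc.symm.reindex (Sum.map (a j) y)
      have h4 : K.SameType (g₂ ∘ Sum.elim (a j) b') (Sum.elim g₂ c₂ ∘ Sum.map (a j) y) := by
        convert (hsb.reindex (Sum.elim (fun k : I => .inr (.inr (j, k))) .inl)).symm using 1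
        · funext k; rcases k with k | k <;> rfl
        · funext k; rcases k with k | k <;> rfl
      refine h4.trans hA hAP ?_
      convert h3 using 1
      · funext k; rcases k with k | k <;> rfl

/-! ### Syntactic types and small subsequences -/

theorem realize_iff_of_forall_small (hK : K.IsAbstractClass) {ι B N N' : Type u} [L.Structure N]
    [L.Structure N'] {b : ι → N} {b' : ι → N'} {j : B → N} {j' : B → N'}
    (h : ∀ (I J : Type u), #I < κ → #J < κ → ∀ (x : I → ι) (y : J → B),
      K.SameType (Sum.elim (b ∘ x) (j ∘ y)) (Sum.elim (b' ∘ x) (j' ∘ y)))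
    (φ : K.QFOver κ ι B) : φ.1.Realize (Sum.elim b j) ↔ φ.1.Realize (Sum.elim b' j') := by
  have hI : #{i : ι | Sum.inl i ∈ φ.1.vars} < κ :=
    (mk_le_of_injective (f := fun i : {i : ι | Sum.inl i ∈ φ.1.vars} =>
      (⟨Sum.inl i.1, i.2⟩ : φ.1.vars))
      fun i i' hi => Subtype.ext (Sum.inl_injective (congrArg Subtype.val hi))).trans_lt φ.2
  have hJ : #{c : B | Sum.inr c ∈ φ.1.vars} < κ :=
    (mk_le_of_injective (f := fun i : {c : B | Sum.inr c ∈ φ.1.vars} =>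
      (⟨Sum.inr i.1, i.2⟩ : φ.1.vars))
      fun i i' hi => Subtype.ext (Sum.inr_injective (congrArg Subtype.val hi))).trans_lt φ.2
  obtain ⟨P, _, f, g, hf, hg, hfg⟩ := h _ _ hI hJ Subtype.val Subtype.val
  refine φ.1.realize_of_sameType hK ⟨P, _, f, g, hf, hg, ?_⟩
  rintro ⟨i | c, hi⟩
  · exact hfg (.inl ⟨i, hi⟩)
  · exact hfg (.inr ⟨c, hi⟩)

theorem sameType_of_restrictSyn_eq (hK : K.IsAbstractClass) (hAP : K.Amalgamation)
    (hκ : ℵ₀ ≤ κ) {ι B N N' : Type u} [L.Structure N] [L.Structure N'] (hN : K.Mem N)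
    {b : ι → N} {b' : ι → N'} {j : B ↪ N} {j' : B ↪ N'} {C : Set B}
    (h : restrictSyn (K.tp κ b j) C = restrictSyn (K.tp κ b' j') C) {I J : Type u} (hI : #I < κ)
    (hJ : #J < κ) (x : I → ι) (y : J → B) (hy : ∀ k, y k ∈ C) :
    K.SameType (Sum.elim (b ∘ x) (j ∘ y)) (Sum.elim (b' ∘ x) (j' ∘ y)) := by
  have hS : #(Set.range (Sum.map x y) : Set (ι ⊕ B)) < κ := by
    refine mk_range_le.trans_lt ?_
    rw [mk_sum, lift_id, lift_id]
    exact add_lt_of_lt hκ hI hJ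
  obtain ⟨φ, hφ, hφ'⟩ := exists_type_formula hK hAP hN (Sum.elim b j) hS
  have h1 : φ ∈ restrictSyn (K.tp κ b j) C := by
    refine ⟨(hφ' _ _).mpr (hK.sameType_refl hN _), fun c hc => ?_⟩
    rw [hφ] at hc
    obtain ⟨i | k, hk⟩ := hc
    · simp at hk
    · rw [← Sum.inr_injective hk]; exact hy k
  rw [h] at h1
  convert ((hφ' _ _).mp h1.1).reindex (Set.rangeFactorization (Sum.map x y)) using 1
  · funext i; rcases i with i | i <;> rfl
  · funext i; rcases i with i | i <;> rfl

/-! ### Tameness and shortness -/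

/-- Shortness reduces a difference of types to fewer than `κ` indices, then tameness reduces it to a
domain of size less than `κ`. -/
theorem sameType_of_forall_small (hK : K.IsAbstractClass) (hAP : K.Amalgamation)
    {α : Ordinal.{u}} (hT : K.TameFor κ α) (hS : K.ShortFor κ α) {ι M N N' : Type u}
    [L.Structure M] [L.Structure N] [L.Structure N'] (hι : (#ι).ord < α) {f : M ↪[L] N}
    {f' : M ↪[L] N'} (hf : K.IsEmbedding f) (hf' : K.IsEmbedding f') (b : ι → N) (b' : ι → N')
    (h : ∀ (I J : Type u), #I < κ → #J < κ → ∀ (x : I → ι) (y : J → M),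
      K.SameType (Sum.elim (b ∘ x) (f ∘ y)) (Sum.elim (b' ∘ x) (f' ∘ y))) :
    K.SameType (Sum.elim b f) (Sum.elim b' f') := by
  obtain ⟨ε⟩ : Nonempty ((#ι).ord.ToType ≃ ι) := by rw [← Cardinal.eq, mk_ord_toType]
  have hpq : gtp hf.mem_cod (b ∘ ε) f.toEmbedding = gtp hf'.mem_cod (b' ∘ ε) f'.toEmbedding := by
    by_contra hne
    obtain ⟨I, hI, hIne⟩ := hS _ hι M hf.mem_dom _ ⟨N, _, f, hf, _, rfl⟩ _
      ⟨N', _, f', hf', _, rfl⟩ hne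
    obtain ⟨ε'⟩ : Nonempty ((#I).ord.ToType ≃ I) := by rw [← Cardinal.eq, mk_ord_toType]
    have hIα : (#I).ord < α := by
      refine lt_of_le_of_lt (ord_le_ord.mpr ?_) hι
      exact (mk_set_le I).trans (mk_ord_toType _).le
    have hne' : gtp hf.mem_cod (fun i => b (ε (ε' i))) f.toEmbedding ≠
        gtp hf'.mem_cod (fun i => b' (ε (ε' i))) f'.toEmbedding := by
      intro heq
      refine hIne ((gtp_eq_iff hK hAP hf.mem_cod hf'.mem_cod (fun i : I => b (ε i)) _
        (fun i : I => b' (ε i)) _).mpr ?_)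
      rw [gtp_eq_iff hK hAP] at heq
      refine SameType.of_reindex (Sum.map ε' id)
        (Sum.map_surjective.mpr ⟨ε'.surjective, Function.surjective_id⟩) ?_
      convert heq using 1
      · funext k; rcases k with k | k <;> rfl
      · funext k; rcases k with k | k <;> rfl
    obtain ⟨A₀, hA₀, hA₀ne⟩ := hT _ hIα M hf.mem_dom _ ⟨N, _, f, hf, _, rfl⟩ _
      ⟨N', _, f', hf', _, rfl⟩ hne'
    refine hA₀ne ((gtp_eq_iff hK hAP hf.mem_cod hf'.mem_cod (fun i => b (ε (ε' i)))
      ((Function.Embedding.subtype _).trans f.toEmbedding) (fun i => b' (ε (ε' i)))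
      ((Function.Embedding.subtype _).trans f'.toEmbedding)).mpr ?_)
    exact h _ A₀ (by rwa [mk_ord_toType]) hA₀ (fun i => ε (ε' i)) Subtype.val
  rw [gtp_eq_iff hK hAP] at hpq
  refine SameType.of_reindex (Sum.map ε id)
    (Sum.map_surjective.mpr ⟨ε.surjective, Function.surjective_id⟩) ?_
  convert hpq using 1
  · funext k; rcases k with k | k <;> rfl
  · funext k; rcases k with k | k <;> rfl

end ModelClass

/-! ### The cardinal `μ_α` -/

theorem regCeil_spec {κ : Cardinal.{u}} (hκ : ℵ₀ ≤ κ) : κ ≤ regCeil κ ∧ (regCeil κ).IsRegular :=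
  csInf_mem (s := {c | κ ≤ c ∧ c.IsRegular}) ⟨Order.succ κ, Order.le_succ κ, isRegular_succ hκ⟩

/-- Otherwise `μ_α` is itself an allowed exponent, so `2 ^ μ_α ≤ μ_α`, against Cantor. -/
theorem regCeil_le_muCard {κ : Cardinal.{u}} (α : Cardinal.{u}) :
    regCeil κ ≤ muCard κ α := by
  by_contra h
  have h1 : (α + 2) ^ muCard κ α ≤ muCard κ α := le_powerlt _ (not_le.mp h)
  have h2 : 2 ^ muCard κ α ≤ (α + 2) ^ muCard κ α := power_le_power_right (self_le_add_left _ _)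
  exact (cantor _).not_ge (h2.trans h1)

theorem le_muCard {κ : Cardinal.{u}} (hκ : ℵ₀ ≤ κ) (α : Cardinal.{u}) : κ ≤ muCard κ α :=
  (regCeil_spec hκ).1.trans (regCeil_le_muCard α)

theorem self_le_muCard {κ : Cardinal.{u}} (hκ : ℵ₀ ≤ κ) (α : Cardinal.{u}) :
    α ≤ muCard κ α := by
  refine le_trans ?_ (le_powerlt (α + 2) (one_lt_aleph0.trans_le (regCeil_spec hκ).2.aleph0_le))
  rw [power_one]
  exact self_le_add_right _ _

/-- By regularity of `κ_r`, the lengths of `θ` sequences, each shorter than `κ_r`, are bounded by a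
single `j`. So the family is coded by `j`, the lengths and one function on `θ × j`. -/
theorem muCard_power_le {κ : Cardinal.{u}} (hκ : ℵ₀ ≤ κ) (α : Cardinal.{u}) {θ : Cardinal.{u}}
    (hθ : θ < κ) : muCard κ α ^ θ ≤ muCard κ α := by
  classical
  obtain ⟨hκr, hreg⟩ := regCeil_spec hκ
  have hρ := hreg.aleph0_le
  have hθρ : θ < regCeil κ := hθ.trans_le hκr
  have hμρ := regCeil_le_muCard (κ := κ) α
  have hμ := hρ.trans hμρ
  obtain ⟨B, hB⟩ : ∃ B : Type u, #B = α + 2 := ⟨(α + 2).out, mk_out _⟩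
  obtain ⟨Θ, rfl⟩ : ∃ Θ : Type u, #Θ = θ := ⟨θ.out, mk_out _⟩
  have hB0 : Nonempty B := by rw [← mk_ne_zero_iff, hB]; simp
  let J := (regCeil κ).ord.ToType
  let T : Type u := Σ j : J, Set.Iio j → B
  let W : Type u := Σ j : J, (Θ → Set.Iio j) × (Θ × Set.Iio j → B)
  have hIio : ∀ j : J, #(Set.Iio j) < regCeil κ := fun j => ModelClass.mk_Iio_toType_lt j
  have hT : muCard κ α ≤ #T := by
    refine powerlt_le.mpr fun c hc => ?_
    obtain ⟨j, hj⟩ : ∃ j : J, #(Set.Iio j) = c := ModelClass.exists_mk_Iio_eq hc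
    rw [← hB, ← hj, power_def]
    exact mk_le_of_injective (f := fun s => (⟨j, s⟩ : T)) fun s s' h =>
      sigma_mk_injective h
  have hW : #W ≤ muCard κ α := by
    rw [mk_sigma]
    refine (sum_le_sum _ (fun _ => muCard κ α) fun j => ?_).trans ?_
    · have h1 : (#Θ * #(Set.Iio j)) < regCeil κ := mul_lt_of_lt hρ hθρ (hIio j)
      have h2 : (α + 2) ^ (#Θ * #(Set.Iio j)) ≤ muCard κ α := le_powerlt _ h1
      rw [mk_prod, lift_id, lift_id, ← power_def, ← power_def, mk_prod, lift_id, lift_id, hB]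
      refine (mul_le_mul' (le_trans ?_ h2) h2).trans (mul_eq_self hμ).le
      rw [mul_comm, power_mul]
      refine power_le_power_right ((cantor _).le.trans ?_)
      exact power_le_power_right (self_le_add_left _ _)
    · rw [sum_const, lift_id, lift_id, mk_ord_toType]
      exact (mul_le_mul' hμρ le_rfl).trans (mul_eq_self hμ).le
  have hWT : #(Θ → T) ≤ #W := by
    refine mk_le_of_surjective (f := fun (w : W) (t : Θ) =>
      (⟨w.2.1 t, fun k => w.2.2 (t, ⟨k, Set.mem_Iio.mpr (lt_trans k.2 (w.2.1 t).2)⟩)⟩ : T)) ?_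
    intro f
    obtain ⟨j, hj⟩ := ModelClass.exists_forall_lt_of_isRegular hreg hθρ fun t => (f t).1
    refine ⟨⟨j, fun t => ⟨(f t).1, hj t⟩, fun p => if h : (p.2 : J) < (f p.1).1 then
      (f p.1).2 ⟨p.2, h⟩ else hB0.some⟩, ?_⟩
    funext t
    refine Sigma.ext rfl (heq_of_eq ?_)
    funext k
    have : (k : J) < (f t).1 := k.2
    simp only [dif_pos this]
  rw [← power_def] at hWT
  exact (power_le_power_right hT).trans (hWT.trans hW)

namespace ModelClass

open FirstOrder.Language

variable {L : FirstOrder.Language.{u, u}} {K : ModelClass L} {κ : Cardinal.{u}}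

/-! ### Local character -/

/-- The small submodel makes `M` a coheir over `M₀` with respect to `D`; symmetry exchanges `M` and
`D`. -/
theorem exists_coheirIn_base (hK : K.IsAEC) (hAP : K.Amalgamation) (hκ : K.LS < κ)
    (hSOP : ¬ (K.sat κ).SyntacticOrderProperty κ κ) {N : Type u} [L.Structure N]
    {M : L.Substructure N} (hM : (K.sat κ).Strong N M) {α : Cardinal.{u}} {D : Set N}
    (hD : #D ≤ α) :
    ∃ M₀ : L.Substructure N, (K.sat κ).Strong N M₀ ∧ M₀ ≤ M ∧ #M₀ ≤ muCard κ α ∧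
      K.CoheirIn κ (M₀ : Set N) D ((M₀ : Set N) ∪ M) := by
  have hκ0 : ℵ₀ ≤ κ := hK.aleph0_le_LS.trans hκ.le
  obtain ⟨M₀, hM₀, hle, -, hcard, h⟩ := exists_small_submodel hK hAP hκ hM (le_muCard hκ0 α)
    (fun θ hθ => muCard_power_le hκ0 α hθ) ∅ (Set.empty_subset _) (by simp) D
    (hD.trans (self_le_muCard hκ0 α))
  exact ⟨M₀, hM₀, hle, hcard, h.symm hK hAP hκ hSOP hM₀⟩

theorem strong_of_strong_map (hK : K.IsAEC) (hAP : K.Amalgamation) {M N : Type u} [L.Structure M]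
    [L.Structure N] {f : M ↪[L] N} (hf : (K.sat κ).IsEmbedding f) {S : L.Substructure M}
    (h : (K.sat κ).Strong N (S.map f.toHom)) : (K.sat κ).Strong M S := by
  have hA := hK.toIsAbstractClass
  have h1 : (f.comp S.subtype).toHom.range = S.map f.toHom := by
    ext x; simp
  have h2 : K.IsEmbedding (f.comp S.subtype) :=
    hK.isEmbedding_of_strong_range _ (by rw [h1]; exact h.1)
  have h3 := (hK.isEmbedding_of_comp ((isEmbedding_sat_iff hA hAP _).mp hf).1 h2).strong_range
  rw [Substructure.range_subtype] at h3
  exact ⟨h3, hf.mem_dom, sat_mem_equiv hA hAP (f.substructureEquivMap S).symm h.2.2⟩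

/-! ### Counting types over models -/

/-- A sequence is coded by an enumeration of a base of size at most `μ_α` and by its type over that
enumeration, giving at most `lam ^ μ_α · 2 ^ μ_α` codes. Uniqueness of coheirs recovers the small
types over `M`. -/
theorem exists_code_over (hK : K.IsAEC) (hAP : K.Amalgamation) (hκ : K.LS < κ)
    (hSOP : ¬ (K.sat κ).SyntacticOrderProperty κ κ) {N : Type u} [L.Structure N]
    {M : L.Substructure N} (hM : (K.sat κ).Strong N M) {α lam : Cardinal.{u}} (hLS : K.LS ≤ lam)
    (hpow : lam ^ muCard κ α = lam) (hMlam : #M ≤ lam) {ι : Type u} (hι : #ι ≤ α) :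
    ∃ (C : Type u) (code : (ι → N) → C), #C ≤ lam ∧ ∀ b b', code b = code b' →
      ∀ (I J : Type u), #I < κ → #J < κ → ∀ (x : I → ι) (y : J → M),
        K.SameType (Sum.elim (b ∘ x) (M.subtype ∘ y)) (Sum.elim (b' ∘ x) (M.subtype ∘ y)) := by
  have hA := hK.toIsAbstractClass
  have hκ0 : ℵ₀ ≤ κ := hK.aleph0_le_LS.trans hκ.le
  have hlam : ℵ₀ ≤ lam := hK.aleph0_le_LS.trans hLS
  have hκμ := le_muCard hκ0 α
  have hμ : ℵ₀ ≤ muCard κ α := hκ0.trans hκμ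
  obtain ⟨U, hU⟩ : ∃ U : Type u, #U = muCard κ α := ⟨(muCard κ α).out, mk_out _⟩
  have hbase : ∀ b : ι → N, ∃ (M₀ : L.Substructure N) (e : U → M), (K.sat κ).Strong N M₀ ∧
      K.CoheirIn κ (M₀ : Set N) (Set.range b) ((M₀ : Set N) ∪ M) ∧
        Set.range (M.subtype ∘ e) = M₀ := by
    intro b
    obtain ⟨M₀, hM₀, hle, hcard, h⟩ := exists_coheirIn_base hK hAP hκ hSOP hM
      (mk_range_le.trans hι : #(Set.range b) ≤ α)
    have : Nonempty M₀ := by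
      rw [← mk_ne_zero_iff]
      exact (aleph0_pos.trans_le (hκ0.trans hM₀.2.2.2.1)).ne'
    obtain ⟨g⟩ : Nonempty (M₀ ↪ U) := by rw [← Cardinal.le_def, hU]; exact hcard
    refine ⟨M₀, fun u => Substructure.inclusion hle (Function.invFun g u), hM₀, h, ?_⟩
    ext z
    constructor
    · rintro ⟨u, rfl⟩
      exact (Function.invFun g u).2
    · intro hz
      refine ⟨g ⟨z, hz⟩, ?_⟩
      simp [Function.leftInverse_invFun g.injective _]
  choose M₀ e hM₀ hcoh he using hbase
  obtain ⟨C, code, hC, hcode⟩ := hK.exists_code hAP (ι ⊕ U) (ν := muCard κ α)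
    (by
      rw [mk_sum, lift_id, lift_id, hU]
      exact (add_le_add (hι.trans (self_le_muCard hκ0 α)) le_rfl).trans (add_eq_self hμ).le)
    (hκ.le.trans hκμ)
  refine ⟨(U → M) × C, fun b => (e b, code N (Sum.elim b (M.subtype ∘ e b))), ?_, ?_⟩
  · rw [mk_prod, lift_id, lift_id, ← power_def, hU]
    refine (mul_le_mul' (b := lam) (d := lam) ?_ ?_).trans (mul_eq_self hlam).le
    · exact (power_le_power_right hMlam).trans hpow.le
    · refine hC.trans ((power_le_power_right ?_).trans hpow.le)
      exact (natCast_lt_aleph0 (n := 2)).le.trans hlam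
  · intro b b' hbb' I J hI hJ x y
    simp only [Prod.mk.injEq] at hbb'
    obtain ⟨h1, h2⟩ := hbb'
    have h3 : (M₀ b : Set N) = M₀ b' := by rw [← he, ← he, h1]
    rw [← h1] at h2
    have h4 := hcode _ _ _ _ hM.2.1.1 hM.2.1.1 h2
    have hg : (K.sat κ).IsEmbedding (M₀ b).subtype :=
      (sat_isAbstractClass hA hAP).isEmbedding_subtype (hM₀ b)
    have hr : Set.range (M₀ b).subtype = (M₀ b : Set N) := by simp
    have hr' : Set.range M.subtype = (M : Set N) := by simp
    refine coheirIn_unique hK hAP hκ hSOP hg hg (hK.sameType_refl hM.2.1.1 _) ?_ ?_ ?_ hI hJ x y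
    · rw [hr, hr']; exact hcoh b
    · rw [hr, hr', h3]; exact hcoh b'
    · intro I J _ _ x y
      have h5 : ∀ k, ∃ u, (M.subtype ∘ e b) u = (M₀ b).subtype (y k) := fun k =>
        (he b).superset (y k).2
      choose u hu using h5
      have h6 : (M.subtype ∘ e b) ∘ u = (M₀ b).subtype ∘ y := funext hu
      rw [← h6]
      convert h4.reindex (Sum.map x u) using 1
      · funext k; rcases k with k | k <;> rfl
      · funext k; rcases k with k | k <;> rfl

theorem exists_strong_card_le (hK : K.IsAEC) (hAP : K.Amalgamation) (hκ : K.LS < κ) {N : Type u}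
    [L.Structure N] (hN : (K.sat κ).Mem N) {α lam : Cardinal.{u}} (hLS : K.LS ≤ lam)
    (hpow : lam ^ muCard κ α = lam) (A : Set N) (hAlam : #A ≤ lam) :
    ∃ M : L.Substructure N, (K.sat κ).Strong N M ∧ A ⊆ (M : Set N) ∧ #M ≤ lam := by
  have hκ0 : ℵ₀ ≤ κ := hK.aleph0_le_LS.trans hκ.le
  have hlam : ℵ₀ ≤ lam := hK.aleph0_le_LS.trans hLS
  have hμlam : muCard κ α ≤ lam := by
    refine (cantor _).le.trans ((power_le_power_right ?_).trans hpow.le)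
    exact (natCast_lt_aleph0 (n := 2)).le.trans hlam
  obtain ⟨M, hM, -, hAM, hcard, -⟩ := exists_small_submodel hK hAP hκ
    ((sat_isAbstractClass hK.toIsAbstractClass hAP).refl N hN) ((le_muCard hκ0 α).trans hμlam)
    (fun θ hθ => (power_le_power_left (aleph0_pos.trans_le hlam).ne'
      (hθ.le.trans (le_muCard hκ0 α))).trans hpow.le) A (fun _ _ => trivial) hAlam ∅ (by simp)
  exact ⟨M, hM, hAM, hcard⟩

/-- There are at most `α⁺ ≤ lam` lengths, each with at most `lam` codes. The types live one universe
higher, hence the lift. -/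
theorem mk_sigma_le_of_codes {α lam : Cardinal.{u}} (hlam : ℵ₀ ≤ lam) (hα : Order.succ α ≤ lam)
    {T : Ordinal.{u} → Type (u + 1)} {X : Ordinal.{u} → Type u} (F : ∀ γ, X γ → T γ)
    (h : ∀ γ < (Order.succ α).ord, ∃ (C : Type u) (code : X γ → C), #C ≤ lam ∧
      ∀ x x', code x = code x' → F γ x = F γ x') :
    #{p : Σ γ : Ordinal.{u}, T γ | p.1 < (Order.succ α).ord ∧ p.2 ∈ Set.range (F p.1)} ≤
      Cardinal.lift.{u + 1} lam := by
  choose C code hC hcode using h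
  obtain ⟨U, hU⟩ : ∃ U : Type u, #U = lam := ⟨lam.out, mk_out _⟩
  have hCU : ∀ γ h, Nonempty (C γ h ↪ U) := by
    intro γ h
    rw [← Cardinal.le_def, hU]; exact hC γ h
  let j := fun γ h => (hCU γ h).some
  have hcard : #((Order.succ α).ord.ToType × U) ≤ lam := by
    rw [mk_prod, lift_id, lift_id, mk_ord_toType, hU]
    exact (mul_le_mul' hα le_rfl).trans (mul_eq_self hlam).le
  have hinj : lift.{u} #{p : Σ γ : Ordinal.{u}, T γ | p.1 < (Order.succ α).ord ∧
      p.2 ∈ Set.range (F p.1)} ≤ lift.{u + 1} #((Order.succ α).ord.ToType × U) := by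
    refine lift_mk_le_lift_mk_of_injective (f := fun p => (Ordinal.ToType.mk ⟨p.1.1, p.2.1⟩,
      j _ p.2.1 (code _ p.2.1 p.2.2.choose))) ?_
    rintro ⟨⟨γ, t⟩, h1, h2⟩ ⟨⟨γ', t'⟩, h1', h2'⟩ heq
    simp only [Prod.mk.injEq, EmbeddingLike.apply_eq_iff_eq] at heq
    obtain ⟨h0, heq⟩ := heq
    obtain rfl : γ = γ' := congrArg Subtype.val h0
    have h3 := hcode _ _ _ _ ((j _ h1).injective heq)
    rw [h2.choose_spec, h2'.choose_spec] at h3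
    simp only at h3
    subst h3
    rfl
  rw [lift_id'.{u, u + 1}] at hinj
  exact hinj.trans (lift_le.mpr hcard)

theorem muCard_lt_of_power_eq (hK : K.IsAEC) {α lam : Cardinal.{u}} (hLS : K.LS ≤ lam)
    (hpow : lam ^ muCard κ α = lam) : muCard κ α < lam := by
  refine (cantor _).trans_le ((power_le_power_right ?_).trans hpow.le)
  exact (natCast_lt_aleph0 (n := 2)).le.trans (hK.aleph0_le_LS.trans hLS)

theorem mk_toType_le_of_lt_succ {α : Cardinal.{u}} {γ : Ordinal.{u}}
    (h : γ < (Order.succ α).ord) : #γ.ToType ≤ α := by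
  rw [Cardinal.mk_toType]
  exact Order.lt_succ_iff.mp (lt_ord.mp h)

/-! ### Stability and uniqueness -/

theorem syntacticallyStable_sat (hK : K.IsAEC) (hAP : K.Amalgamation) (hκ : K.LS < κ)
    (hSOP : ¬ (K.sat κ).SyntacticOrderProperty κ κ) {α lam : Cardinal.{u}} (hLS : K.LS ≤ lam)
    (hpow : lam ^ muCard κ α = lam) : (K.sat κ).SyntacticallyStable κ α lam := by
  intro N _ hN A hA
  have hAbs := hK.toIsAbstractClass
  have hκ0 : ℵ₀ ≤ κ := hK.aleph0_le_LS.trans hκ.le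
  have hμ := muCard_lt_of_power_eq hK hLS hpow
  obtain ⟨M, hM, hAM, hMlam⟩ := exists_strong_card_le hK hAP hκ hN hLS hpow A hA
  refine mk_sigma_le_of_codes (hK.aleph0_le_LS.trans hLS)
    (Order.succ_le_of_lt ((self_le_muCard hκ0 α).trans_lt hμ))
    (fun γ (b : γ.ToType → N) => (K.sat κ).tp κ b (Function.Embedding.subtype (· ∈ A))) ?_
  intro γ hγ
  obtain ⟨C, code, hC, hcode⟩ := exists_code_over hK hAP hκ hSOP hM hLS hpow hMlam
    (mk_toType_le_of_lt_succ hγ)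
  refine ⟨C, code, hC, fun b b' hbb' => ?_⟩
  ext φ
  refine realize_iff_of_forall_small (sat_isAbstractClass hAbs hAP) (fun I J hI hJ x y => ?_) φ
  rw [sameType_sat_iff hK hAP hκ hN hN]
  exact hcode b b' hbb' I J hI hJ x fun k => ⟨y k, hAM (y k).2⟩

theorem galoisStable_of_tame_of_short (hK : K.IsAEC) (hAP : K.Amalgamation) (hκ : K.LS < κ)
    (hSOP : ¬ (K.sat κ).SyntacticOrderProperty κ κ) {α : Ordinal.{u}} (hT : K.TameFor κ α)
    (hS : K.ShortFor κ α) {β lam : Cardinal.{u}} (hβ : β.ord < α) (hLS : K.LS ≤ lam)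
    (hpow : lam ^ muCard κ β = lam) : K.GaloisStable β lam := by
  intro N _ hN A hA
  have hAbs := hK.toIsAbstractClass
  have hκ0 : ℵ₀ ≤ κ := hK.aleph0_le_LS.trans hκ.le
  have hlam := hK.aleph0_le_LS.trans hLS
  have hμ := muCard_lt_of_power_eq hK hLS hpow
  refine mk_sigma_le_of_codes hlam (Order.succ_le_of_lt ((self_le_muCard hκ0 β).trans_lt hμ))
    (fun γ (b : γ.ToType → N) => gtp hN b (Function.Embedding.subtype (· ∈ A))) ?_
  intro γ hγ
  have hγβ := mk_toType_le_of_lt_succ hγ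
  -- The counting takes place in a saturated extension, available when `N` has size at least `κ`. A
  -- smaller `N` has too few sequences to matter.
  by_cases hcard : κ ≤ #N
  · obtain ⟨N', _, f, hf, hN'⟩ := hK.exists_saturated_extension hAP hκ hN hcard
    obtain ⟨M, hM, hAM, hMlam⟩ := exists_strong_card_le hK hAP hκ hN' hLS hpow (f '' A)
      (mk_image_le.trans hA)
    obtain ⟨C, code, hC, hcode⟩ := exists_code_over hK hAP hκ hSOP hM hLS hpow hMlam hγβ
    refine ⟨C, fun b => code (f ∘ b), hC, fun b b' hbb' => ?_⟩
    have hs := hK.isEmbedding_subtype hM.1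
    have h1 := sameType_of_forall_small hAbs hAP hT hS ((ord_le_ord.mpr hγβ).trans_lt hβ) hs hs
      (f ∘ b) (f ∘ b') fun I J hI hJ x y => hcode _ _ hbb' I J hI hJ x y
    rw [gtp_eq_iff hAbs hAP]
    have h2 := h1.reindex (Sum.map id fun a : A => (⟨f a, hAM ⟨a, a.2, rfl⟩⟩ : M))
    have h3 : ∀ b : γ.ToType → N, Sum.elim (f ∘ b) M.subtype ∘
        Sum.map id (fun a : A => (⟨f a, hAM ⟨a, a.2, rfl⟩⟩ : M)) =
        f ∘ Sum.elim b (Function.Embedding.subtype (· ∈ A)) := by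
      intro b
      funext k; rcases k with k | k <;> rfl
    rw [h3, h3] at h2
    exact (hAbs.sameType_embedding hf _).trans hAbs hAP
      (h2.trans hAbs hAP (hAbs.sameType_embedding hf _).symm)
  · refine ⟨γ.ToType → N, id, ?_, fun b b' h => by rw [show b = b' from h]⟩
    rw [← power_def]
    have h1 : #N ≤ lam := (not_le.mp hcard).le.trans ((le_muCard hκ0 β).trans hμ.le)
    exact ((power_le_power_right h1).trans (power_le_power_left (aleph0_pos.trans_le hlam).ne'
      (hγβ.trans (self_le_muCard hκ0 β)))).trans hpow.le

theorem coheir_unique_of_tame_of_short (hK : K.IsAEC) (hAP : K.Amalgamation) (hκ : K.LS < κ)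
    (hSOP : ¬ (K.sat κ).SyntacticOrderProperty κ κ) {α : Ordinal.{u}} (hT : K.TameFor κ α)
    (hS : K.ShortFor κ α) {γ : Ordinal.{u}} (hγ : γ < α) {M : Type u} [L.Structure M]
    {M₀ : L.Substructure M} (hM₀ : (K.sat κ).Strong M M₀) {p q : (K.sat κ).GType γ.ToType M}
    (hp : p.IsCoheirOver κ M₀) (hq : q.IsCoheirOver κ M₀)
    (hpq : p.restrictDom (M₀ : Set M) = q.restrictDom (M₀ : Set M)) : p = q := by
  have hAbs := hK.toIsAbstractClass
  have hAbs' := sat_isAbstractClass (κ := κ) hAbs hAP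
  have hAP' := sat_amalgamation hK hAP hκ
  obtain ⟨N₁, _, f₁, hf₁, b₁, rfl, hb₁⟩ := hp
  obtain ⟨N₂, _, f₂, hf₂, b₂, rfl, hb₂⟩ := hq
  have hpq' := (gtp_eq_iff hAbs' hAP' hf₁.mem_cod hf₂.mem_cod b₁
    ((Function.Embedding.subtype (· ∈ (M₀ : Set M))).trans f₁.toEmbedding) b₂
    ((Function.Embedding.subtype (· ∈ (M₀ : Set M))).trans f₂.toEmbedding)).mp hpq
  rw [sameType_sat_iff hK hAP hκ hf₁.mem_cod hf₂.mem_cod] at hpq'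
  have he₁ := ((isEmbedding_sat_iff hAbs hAP _).mp hf₁).1
  have he₂ := ((isEmbedding_sat_iff hAbs hAP _).mp hf₂).1
  have hs := hAbs'.isEmbedding_subtype hM₀
  rw [indep_sat_iff hK hAP hκ] at hb₁ hb₂
  have hr : ∀ (N : Type u) [L.Structure N] (f : M ↪[L] N),
      Set.range (f.comp M₀.subtype) = (M₀.map f.toHom : Set N) := by
    intro N _ f
    ext x; simp
  have hsame : ∀ (V : Type u) (v : V → M), K.SameType (f₁ ∘ v) (f₂ ∘ v) := fun V v =>
    (hAbs.sameType_embedding he₁ v).symm.trans hAbs hAP (hAbs.sameType_embedding he₂ v)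
  have h1 := sameType_of_forall_small hAbs hAP hT hS (ι := γ.ToType)
    (by rw [Cardinal.mk_toType]; exact (ord_card_le γ).trans_lt hγ) he₁ he₂ b₁ b₂
    fun I J hI hJ x y =>
      coheirIn_unique hK hAP hκ hSOP (g₁ := f₁.comp M₀.subtype) (g₂ := f₂.comp M₀.subtype)
        (hAbs'.isEmbedding_comp hf₁ hs) (hAbs'.isEmbedding_comp hf₂ hs) (c₁ := f₁) (c₂ := f₂)
        (by
          convert hsame _ (Sum.elim M₀.subtype id) using 1
          · funext k; rcases k with k | k <;> rfl
          · funext k; rcases k with k | k <;> rfl)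
        (by rw [hr]; exact hb₁.2) (by rw [hr]; exact hb₂.2)
        (fun I J hI hJ x y => by
          convert hpq'.reindex (Sum.map x y) using 1
          · funext k; rcases k with k | k <;> rfl
          · funext k; rcases k with k | k <;> rfl) hI hJ x y
  exact (gtp_eq_iff hAbs' hAP' _ _ _ _ _ _).mpr
    ((sameType_sat_iff hK hAP hκ hf₁.mem_cod hf₂.mem_cod _ _).mpr h1)

theorem syntactic_uniqueness (hK : K.IsAEC) (hAP : K.Amalgamation) (hκ : K.LS < κ)
    (hSOP : ¬ (K.sat κ).SyntacticOrderProperty κ κ) {M N₁ N₂ : Type u} [L.Structure M]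
    [L.Structure N₁] [L.Structure N₂] {M₀ : L.Substructure M} {f₁ : M ↪[L] N₁} {f₂ : M ↪[L] N₂}
    (hM₀ : (K.sat κ).Strong M M₀) (hf₁ : (K.sat κ).IsEmbedding f₁)
    (hf₂ : (K.sat κ).IsEmbedding f₂) {B : Set M} (hB : (M₀ : Set M) ⊆ B) {j₁ : B ↪ N₁}
    {j₂ : B ↪ N₂} (hj₁ : ∀ x : B, j₁ x = f₁ x) (hj₂ : ∀ x : B, j₂ x = f₂ x) {ι : Type u}
    (b₁ : ι → N₁) (b₂ : ι → N₂)
    (h : restrictSyn ((K.sat κ).tp κ b₁ j₁) {x : B | (x : M) ∈ M₀} =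
      restrictSyn ((K.sat κ).tp κ b₂ j₂) {x : B | (x : M) ∈ M₀})
    (h₁ : IsCoheir j₁ ((K.sat κ).tp κ b₁ j₁) (f₁ '' (M₀ : Set M)))
    (h₂ : IsCoheir j₂ ((K.sat κ).tp κ b₂ j₂) (f₂ '' (M₀ : Set M))) :
    (K.sat κ).tp κ b₁ j₁ = (K.sat κ).tp κ b₂ j₂ := by
  have hAbs := hK.toIsAbstractClass
  have hAbs' := sat_isAbstractClass (κ := κ) hAbs hAP
  have hAP' := sat_amalgamation hK hAP hκ
  have hκ0 : ℵ₀ ≤ κ := hK.aleph0_le_LS.trans hκ.le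
  have he₁ := ((isEmbedding_sat_iff hAbs hAP _).mp hf₁).1
  have he₂ := ((isEmbedding_sat_iff hAbs hAP _).mp hf₂).1
  have hs := hAbs'.isEmbedding_subtype hM₀
  rw [isCoheir_sat_tp_iff hK hAP hκ hf₁.mem_cod] at h₁
  rw [isCoheir_sat_tp_iff hK hAP hκ hf₂.mem_cod] at h₂
  have hr : ∀ (N : Type u) [L.Structure N] (f : M ↪[L] N),
      Set.range (f.comp M₀.subtype) = f '' (M₀ : Set M) := by
    intro N _ f
    ext x; simp
  have hu : ∀ (N : Type u) [L.Structure N] (f : M ↪[L] N) (j : B ↪ N), (∀ x : B, j x = f x) →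
      f '' (M₀ : Set M) ∪ Set.range j = Set.range j := by
    intro N _ f j hj
    refine Set.union_eq_self_of_subset_left ?_
    rintro _ ⟨x, hx, rfl⟩
    exact ⟨⟨x, hB hx⟩, hj _⟩
  have hsame : ∀ (V : Type u) (v : V → M), K.SameType (f₁ ∘ v) (f₂ ∘ v) := fun V v =>
    (hAbs.sameType_embedding he₁ v).symm.trans hAbs hAP (hAbs.sameType_embedding he₂ v)
  ext φ
  refine realize_iff_of_forall_small hAbs' (fun I J hI hJ x y => ?_) φ
  rw [sameType_sat_iff hK hAP hκ hf₁.mem_cod hf₂.mem_cod]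
  refine coheirIn_unique hK hAP hκ hSOP (g₁ := f₁.comp M₀.subtype) (g₂ := f₂.comp M₀.subtype)
    (hAbs'.isEmbedding_comp hf₁ hs) (hAbs'.isEmbedding_comp hf₂ hs) (c₁ := j₁) (c₂ := j₂)
    ?_ ?_ ?_ ?_ hI hJ x y
  · convert hsame _ (Sum.elim M₀.subtype (Subtype.val : B → M)) using 1
    · funext k
      rcases k with k | k
      · rfl
      · exact hj₁ k
    · funext k
      rcases k with k | k
      · rfl
      · exact hj₂ k
  · rw [hr, hu _ _ _ hj₁]; exact h₁
  · rw [hr, hu _ _ _ hj₂]; exact h₂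
  · intro I J hI hJ x y
    have h3 := sameType_of_restrictSyn_eq hAbs' hAP' hκ0 hf₁.mem_cod h hI hJ x
      (fun k => (⟨y k, hB (y k).2⟩ : B)) fun k => (y k).2
    rw [sameType_sat_iff hK hAP hκ hf₁.mem_cod hf₂.mem_cod] at h3
    convert h3 using 1
    · funext k
      rcases k with k | k
      · rfl
      · exact (hj₁ ⟨y k, _⟩).symm
    · funext k
      rcases k with k | k
      · rfl
      · exact (hj₂ ⟨y k, _⟩).symm

theorem exists_isCoheirOver (hK : K.IsAEC) (hAP : K.Amalgamation) (hκ : K.LS < κ)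
    (hSOP : ¬ (K.sat κ).SyntacticOrderProperty κ κ) (α : Cardinal.{u}) {M : Type u}
    [L.Structure M] {p : (K.sat κ).GType α.ord.ToType M}
    (hp : p ∈ (K.sat κ).gS α.ord.ToType M) :
    ∃ M₀ : L.Substructure M, (K.sat κ).Strong M M₀ ∧ #M₀ ≤ muCard κ α ∧ p.IsCoheirOver κ M₀ := by
  obtain ⟨N, _, f, hf, b, rfl⟩ := hp
  obtain ⟨M₁, hM₁, hle, hcard, h⟩ := exists_coheirIn_base hK hAP hκ hSOP hf.strong_range
    (D := Set.range b) (α := α) (mk_range_le.trans (mk_ord_toType α).le)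
  have hmap : (M₁.comap f.toHom).map f.toHom = M₁ := by
    ext x
    simp only [Substructure.mem_map, Substructure.mem_comap]
    constructor
    · rintro ⟨y, hy, rfl⟩; exact hy
    · intro hx
      obtain ⟨y, rfl⟩ := hle hx
      exact ⟨y, hx, rfl⟩
  refine ⟨M₁.comap f.toHom, strong_of_strong_map hK hAP hf (by rwa [hmap]), ?_, N, _, f, hf, b,
    rfl, ?_⟩
  · refine le_trans ?_ hcard
    exact mk_le_of_injective (f := fun x : M₁.comap f.toHom => (⟨f x, x.2⟩ : M₁))
      fun x x' hx => Subtype.ext (f.injective (congrArg Subtype.val hx))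
  · rw [hmap, indep_sat_iff hK hAP hκ]
    refine ⟨hM₁, ?_⟩
    rw [Hom.range_coe] at h
    exact h

end ModelClass

end CoheirAEC

theorem theorem5p12 {L : FirstOrder.Language.{u, u}} (K₀ : ModelClass L) (hAEC : K₀.IsAEC)
    (hAP : K₀.Amalgamation) (κ : Cardinal.{u}) (hκ : K₀.LS < κ)
    (K : ModelClass L) (hK : K = K₀.sat κ) :
    -- Unconditional properties
    ( -- Invariance
      (∀ (N N' : Type u) [L.Structure N] [L.Structure N'] (f : N ≃[L] N')
        (M : L.Substructure N) (A B : Set N), K.Indep κ N M A B →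
          K.Indep κ N' (M.map f.toHom) (f '' A) (f '' B)) ∧
      -- Monotonicity
      (∀ (N : Type u) [L.Structure N] (M M' N₀ : L.Substructure N) (A B A₀ B₀ : Set N),
        K.Indep κ N M A B → K.StrongLE M M' → K.StrongLE M' N₀ → K.Strong N N₀ →
        A₀ ⊆ A → B₀ ⊆ B → (M' : Set N) ⊆ B → A₀ ∪ B₀ ⊆ (N₀ : Set N) →
          K.Indep κ N₀ (M'.comap N₀.subtype.toHom)
            ((Subtype.val : N₀ → N) ⁻¹' A₀) ((Subtype.val : N₀ → N) ⁻¹' B₀)) ∧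
      -- Normality
      (∀ (N : Type u) [L.Structure N] (M : L.Substructure N) (A B : Set N),
        K.Indep κ N M A B → K.Indep κ N M (A ∪ (M : Set N)) (B ∪ (M : Set N))) ∧
      -- Disjointness
      (∀ (N : Type u) [L.Structure N] (M : L.Substructure N) (A B : Set N),
        K.Indep κ N M A B → A ∩ B ⊆ (M : Set N)) ∧
      -- Left and right existence
      (∀ (N : Type u) [L.Structure N] (M : L.Substructure N) (A B : Set N),
        K.Strong N M → K.Indep κ N M A (M : Set N) ∧ K.Indep κ N M (M : Set N) B) ∧
      -- Left and right `(<κ)`-set-witness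
      (∀ (N : Type u) [L.Structure N] (M : L.Substructure N) (A B : Set N),
        K.Indep κ N M A B ↔
          ∀ A₀ ⊆ A, ∀ B₀ ⊆ B, #A₀ < κ → #B₀ < κ → K.Indep κ N M A₀ B₀) ∧
      -- Strong left transitivity
      (∀ (N : Type u) [L.Structure N] (M₀ M₁ : L.Substructure N) (A B : Set N), M₀ ≤ M₁ →
        K.Indep κ N M₀ (M₁ : Set N) B → K.Indep κ N M₁ A B → K.Indep κ N M₀ A B)) ∧
    -- Properties that follow from the failure of the order property
    (¬ K.SyntacticOrderProperty κ κ →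
      -- Symmetry
      (∀ (N : Type u) [L.Structure N] (M : L.Substructure N) (A B : Set N),
        K.Indep κ N M A B ↔ K.Indep κ N M B A) ∧
      -- Strong right transitivity
      (∀ (N : Type u) [L.Structure N] (M₀ M₁ : L.Substructure N) (A B : Set N), M₀ ≤ M₁ →
        K.Indep κ N M₀ A (M₁ : Set N) → K.Indep κ N M₁ A B → K.Indep κ N M₀ A B) ∧
      -- Set local character
      (∀ (α : Cardinal.{u}) (M : Type u) [L.Structure M], K.Mem M →
        ∀ p ∈ K.gS α.ord.ToType M, ∃ M₀ : L.Substructure M,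
          K.Strong M M₀ ∧ #M₀ ≤ muCard κ α ∧ p.IsCoheirOver κ M₀) ∧
      -- Syntactic uniqueness
      (∀ (M N₁ N₂ : Type u) [L.Structure M] [L.Structure N₁] [L.Structure N₂]
        (M₀ : L.Substructure M) (f₁ : M ↪[L] N₁) (f₂ : M ↪[L] N₂),
        K.Strong M M₀ → K.IsEmbedding f₁ → K.IsEmbedding f₂ →
        ∀ B : Set M, (M₀ : Set M) ⊆ B → ∀ (j₁ : B ↪ N₁) (j₂ : B ↪ N₂),
        (∀ x : B, j₁ x = f₁ x) → (∀ x : B, j₂ x = f₂ x) →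
        ∀ (ι : Type u), ∀ q₁ ∈ K.synS κ ι j₁, ∀ q₂ ∈ K.synS κ ι j₂,
          ModelClass.restrictSyn q₁ {x : B | (x : M) ∈ M₀} = ModelClass.restrictSyn q₂ {x : B | (x : M) ∈ M₀} →
          ModelClass.IsCoheir j₁ q₁ (f₁ '' (M₀ : Set M)) → ModelClass.IsCoheir j₂ q₂ (f₂ '' (M₀ : Set M)) →
            q₁ = q₂) ∧
      -- Syntactic stability
      (∀ α lam : Cardinal.{u}, K₀.LS ≤ lam → lam ^ muCard κ α = lam →
        K.SyntacticallyStable κ α lam)) ∧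
    -- Properties that need tameness and shortness as well
    (∀ α : Ordinal.{u}, ¬ K.SyntacticOrderProperty κ κ → K₀.TameFor κ α → K₀.ShortFor κ α →
      -- Uniqueness
      (∀ γ < α, ∀ (M : Type u) [L.Structure M] (M₀ : L.Substructure M), K.Strong M M₀ →
        ∀ p ∈ K.gS γ.ToType M, ∀ q ∈ K.gS γ.ToType M,
          p.IsCoheirOver κ M₀ → q.IsCoheirOver κ M₀ →
          p.restrictDom (M₀ : Set M) = q.restrictDom (M₀ : Set M) → p = q) ∧
      -- Stability
      (∀ β lam : Cardinal.{u}, β.ord < α → K₀.LS ≤ lam → lam ^ muCard κ β = lam →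
        K₀.GaloisStable β lam)) := by
  subst hK
  have hAbs := hAEC.toIsAbstractClass
  have hAbs' := ModelClass.sat_isAbstractClass (κ := κ) hAbs hAP
  have hκ0 : ℵ₀ ≤ κ := hAEC.aleph0_le_LS.trans hκ.le
  have hiff := @ModelClass.indep_sat_iff L K₀ κ hAEC hAP hκ
  refine ⟨⟨?_, ?_, ?_, ?_, ?_, ?_, ?_⟩, fun hSOP => ⟨?_, ?_, ?_, ?_, ?_⟩,
    fun α hSOP hT hS => ⟨?_, ?_⟩⟩
  · intro N N' _ _ f M A B h
    rw [hiff] at *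
    refine ⟨hAbs'.iso N N' M f h.1, ?_⟩
    have h1 := h.2.map hAbs hAP (hAbs.isEmbedding_equiv f h.1.2.1.1)
    rw [Set.image_union] at h1
    exact h1
  · intro N _ M M' N₀ A B A₀ B₀ h hMM' hM'N₀ hN₀ hA₀ hB₀ hM'B _
    rw [hiff] at *
    -- Since `M' ⊆ B`, the new parameters `M' ∪ B₀` are among the old `M ∪ B`.
    refine ⟨hM'N₀.2, ModelClass.CoheirIn.of_embedding hAbs hAP
      (hAbs.isEmbedding_subtype hN₀.1) (h.2.mono ?_ ?_ ?_)⟩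
    · intro x hx
      exact ⟨⟨x, hM'N₀.1 (hMM'.1 hx)⟩, hMM'.1 hx, rfl⟩
    · rintro _ ⟨x, hx, rfl⟩
      exact hA₀ hx
    · rintro _ ⟨x, hx | hx, rfl⟩
      · exact .inr (hM'B hx)
      · exact .inr (hB₀ hx)
  · intro N _ M A B h
    rw [hiff] at *
    refine ⟨h.1, (h.2.union_left hκ0).mono subset_rfl subset_rfl ?_⟩
    rintro x (hx | hx | hx)
    · exact .inl hx
    · exact .inr hx
    · exact .inl hx
  · intro N _ M A B h
    rw [hiff] at h
    exact (Set.inter_subset_inter_right _ Set.subset_union_right).trans (h.2.inter_subset hκ0)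
  · intro N _ M A B h
    rw [hiff, hiff, Set.union_self]
    exact ⟨⟨h, ModelClass.coheirIn_self hAEC hAP h A⟩, h,
      ModelClass.coheirIn_subset hAbs h.2.1.1 _ _⟩
  · intro N _ M A B
    constructor
    · intro h A₀ hA₀ B₀ hB₀ h1 h2
      rw [hiff] at *
      exact ⟨h.1, ModelClass.coheirIn_iff_forall_small.mp h.2 A₀ hA₀ B₀ hB₀ h1 h2⟩
    · intro h
      simp only [hiff] at *
      have h0 : #(∅ : Set N) < κ := by simpa using aleph0_pos.trans_le hκ0
      exact ⟨(h ∅ (Set.empty_subset _) ∅ (Set.empty_subset _) h0 h0).1,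
        ModelClass.coheirIn_iff_forall_small.mpr fun A₀ hA₀ B₀ hB₀ h1 h2 =>
          (h A₀ hA₀ B₀ hB₀ h1 h2).2⟩
  · intro N _ M₀ M₁ A B hle h₀ h₁
    rw [hiff] at *
    exact ⟨h₀.1, h₀.2.trans_left hAbs hAP
      (h₁.2.mono subset_rfl subset_rfl (Set.union_subset_union_left _ hle))⟩
  · intro N _ M A B
    simp only [hiff]
    exact ⟨fun h => ⟨h.1, h.2.symm hAEC hAP hκ hSOP h.1⟩,
      fun h => ⟨h.1, h.2.symm hAEC hAP hκ hSOP h.1⟩⟩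
  · intro N _ M₀ M₁ A B hle h₀ h₁
    rw [hiff] at *
    -- Right transitivity is left transitivity conjugated by symmetry.
    have h₀' := h₀.2.symm hAEC hAP hκ hSOP h₀.1
    have h₁' := h₁.2.symm hAEC hAP hκ hSOP h₁.1
    exact ⟨h₀.1, (h₀'.trans_left hAbs hAP (h₁'.mono subset_rfl subset_rfl
      (Set.union_subset_union_left _ hle))).symm hAEC hAP hκ hSOP h₀.1⟩
  · intro α M _ _ p hp
    exact ModelClass.exists_isCoheirOver hAEC hAP hκ hSOP α hp
  · rintro M N₁ N₂ _ _ _ M₀ f₁ f₂ hM₀ hf₁ hf₂ B hB j₁ j₂ hj₁ hj₂ ι _ ⟨b₁, rfl⟩ _ ⟨b₂, rfl⟩ h h₁ h₂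
    exact ModelClass.syntactic_uniqueness hAEC hAP hκ hSOP hM₀ hf₁ hf₂ hB hj₁ hj₂ b₁ b₂ h h₁ h₂
  · intro α lam hLS hpow
    exact ModelClass.syntacticallyStable_sat hAEC hAP hκ hSOP hLS hpow
  · intro γ hγ M _ M₀ hM₀ p _ q _ hp hq hpq
    exact ModelClass.coheir_unique_of_tame_of_short hAEC hAP hκ hSOP hT hS hγ hM₀ hp hq hpq
  · intro β lam hβ hLS hpow
    exact ModelClass.galoisStable_of_tame_of_short hAEC hAP hκ hSOP hT hS hβ hLS hpow
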